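/- **Setting.** All logarithms are to the base $2$. For $\phi,\psi\in[0,1]$ let $H_b(\phi,\psi)=-\phi\log\psi-(1-\phi)\log(1-\psi)\in[0,\infty]$ be the binary cross entropy (with $0\cdot\infty=0$). Let $\mathcal S,\mathcal Y$ be finite sets, $P_S$ a distribution on $\mathcal S$, $P_{Y|S,X}$ a channel from $\mathcal S\times\mathbb F_2$ to $\mathcal Y$, $0<R<1$, $p_e:\mathcal S\to[0,1]$, $p_d:\mathcal Y\to[0,1]$, and let $P_Q$ be a distribution on $[0,1]$ with finite support that is symmetric about $1/2$ (if $Q\sim P_Q$ then $1-Q\sim P_Q$). **The weighted parity-check code with state.** Let $n\ge 1$ and $k=\lfloor nR\rfloor$. For $\mathbf q\in[0,1]^n$ and $\mathbf u\in\mathbb F_2^n$ put $w_{\mathbf q}(\mathbf u)=\prod_{i=1}^n q_i^{u_i}(1-q_i)^{1-u_i}$. For an invertible $\mathbf H\in\mathbb F_2^{n\times n}$ and $\mathbf p,\mathbf q\in[0,1]^n$ let $$f_{\mathbf H}(\mathbf p,\mathbf q)=\operatorname{argmax}_{\mathbf x\in\mathbb F_2^n} w_{\mathbf p}(\mathbf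 x)\,w_{\mathbf q}(\mathbf x\mathbf H^T),$$ where ties are broken by a fixed, arbitrary rule that depends only on the set of maximizers. Let the message $\mathbf m$ be uniform on $\mathbb F_2^k$, $\mathbf s=(s_1,\dots,s_n)$ i.i.d. $\sim P_S$, $\mathbf q=(q_1,\dots,q_{n-k})$ i.i.d. $\sim P_Q$, and $\mathbf H$ uniform over the invertible matrices in $\mathbb F_2^{n\times n}$, all independent. The encoder sends $\mathbf x=f_{\mathbf H}([p_e(s_1),\dots,p_e(s_n)],[\mathbf m,\mathbf q])$; given $(\mathbf m,\mathbf s,\mathbf q,\mathbf H)$, the outputs $y_i\sim P_{Y|S,X}(\cdot|s_i,x_i)$ are independent; the decoder computes $\hat{\mathbf x}=f_{\mathbf H}([p_d(y_1),\dots,p_d(y_n)],[\tfrac12,\dots,\tfrac12,\mathbf q])$ with $k$ entries $\tfrac12$, and outputs $\hat{\mathbf m}$, the first $k$ bits of $\hat{\mathbf x}\mathbf H^T$. **Nondegeneracy** (automatic if $p_e$, $p_d$ and $Q$ take values in $(0,1)$). 1. $P(0<p_e(S)<1)=1$, or $P(0<p_e(S)<1)+(1-R)P(0<Q<1)>1$.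 2. If $P_S(s)>0$, $H_b(x,p_e(s))<\infty$ and $P_{Y|S,X}(y|s,x)>0$, then $H_b(x,p_d(y))<\infty$. **Theorem.** Suppose that $(P_{X|S},P_{V|Q})$, with $X,V\in\{0,1\}$, is the unique minimizer of $$\mathbf E[H_b(X,p_e(S))]+(1-R)\,\mathbf E[H_b(V,Q)]$$ subject to $H(X|S)+(1-R)H(V|Q)\ge 1$, where $S\sim P_S$, $X|S\sim P_{X|S}$, $Q\sim P_Q$, $V|Q\sim P_{V|Q}$ (uniqueness is meant at the values of $S$ and $Q$ of positive probability). Let $Y|(S,X)\sim P_{Y|S,X}$, and suppose that for all conditional distributions $P_{\tilde X|Y},P_{\tilde V|Q}$ on $\{0,1\}$ with $H(\tilde X|Y)+(1-R)H(\tilde V|Q)\ge 1-R$, $$\mathbf E[H_b(\tilde X,p_d(Y))]+(1-R)\,\mathbf E[H_b(\tilde V,Q)]>\mathbf E[H_b(X,p_d(Y))]+(1-R)\,\mathbf E[H_b(V,Q)].$$ Then, as $n\to\infty$, $\mathbf P(\hat{\mathbf m}\ne\mathbf m)\to0$, and the empirical joint distribution of $(s_i,x_i)_{i=1,\dots,n}$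 tends to $P_SP_{X|S}$ in probability. -/

import Mathlib

open scoped ENNReal Matrix unitInterval Topology

namespace WPC

noncomputable section

/-! ### Information quantities, all to the base `2` and valued in `[0, ∞]` -/

/-- `-log₂ t` for `t ∈ [0,1]`, with the value `∞` at `t = 0`. -/
def negLog (t : I) : ℝ≥0∞ :=
  if t = 0 then ⊤ else ENNReal.ofReal (-Real.logb 2 (t : ℝ))

/-- The binary cross entropy `H_b(φ, ψ) = -φ log ψ - (1 - φ) log (1 - ψ)`, with `0 · ∞ = 0`. -/
def crossEntropy (φ ψ : I) : ℝ≥0∞ :=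
  ENNReal.ofReal (φ : ℝ) * negLog ψ + ENNReal.ofReal (1 - (φ : ℝ)) * negLog (σ ψ)

/-- A bit, seen as the number `0` or `1`. -/
def bit (b : ZMod 2) : I := if b = 1 then 1 else 0

/-- The Shannon entropy of a distribution on a finite alphabet. -/
def entropy {β : Type*} [Fintype β] (P : PMF β) : ℝ≥0∞ :=
  ∑ b, ENNReal.ofReal (Real.negMulLog (P b).toReal / Real.log 2)

/-- The expectation of a nonnegative function under a discrete distribution. -/
def expect {α : Type*} (P : PMF α) (f : α → ℝ≥0∞) : ℝ≥0∞ := ∑' a, P a * f a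

/-- The conditional entropy `H(B|A)`, where `A ∼ P` and `B|A ∼ W`. -/
def condEntropy {α β : Type*} [Fintype β] (P : PMF α) (W : α → PMF β) : ℝ≥0∞ :=
  expect P fun a => entropy (W a)

/-- The expected cross entropy `E[H_b(B, p(A))]`, where `A ∼ P` and `B|A ∼ W`. -/
def expCrossEntropy {α : Type*} (P : PMF α) (W : α → PMF (ZMod 2)) (p : α → I) : ℝ≥0∞ :=
  expect P fun a => expect (W a) fun b => crossEntropy (bit b) (p a)

/-! ### Product distributions -/

/-- The law of independent random variables `A_i ∼ P i`, for `i : Fin n`. -/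
def prodPMF {α : Type*} : {n : ℕ} → (Fin n → PMF α) → PMF (Fin n → α)
  | 0, _ => PMF.pure Fin.elim0
  | _ + 1, P => (P 0).bind fun a => (prodPMF fun i => P i.succ).map (Fin.cons a)

theorem prodPMF_apply {α : Type*} {n : ℕ} (P : Fin n → PMF α) (f : Fin n → α) :
    prodPMF P f = ∏ i, P i (f i) := by
  classical
  induction n with
  | zero =>
    have : f = Fin.elim0 := Subsingleton.elim _ _
    simp [prodPMF, this]
  | succ n ih =>
    rw [prodPMF, PMF.bind_apply, tsum_eq_single (f 0), PMF.map_apply,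
      tsum_eq_single (Fin.tail f), ih, Fin.prod_univ_succ]
    · simp [Fin.tail]
    · intro g hg
      rw [if_neg]
      intro h
      exact hg (by rw [h, Fin.tail_cons])
    · intro a ha
      rw [PMF.map_apply, ENNReal.tsum_eq_zero.2, mul_zero]
      intro g
      rw [if_neg]
      intro h
      exact ha (by rw [h, Fin.cons_zero])

/-! ### The weighted parity-check code -/

/-- The `q`-weight of `u`: the probability of `u` when its entries are independent `Bern(q i)`. -/
def weight {n : ℕ} (q : Fin n → I) (u : Fin n → ZMod 2) : ℝ :=
  ∏ i, if u i = 1 then (q i : ℝ) else 1 - (q i : ℝ)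

open Classical in
/-- The set of maximizers `x` of `w_p(x) w_q(x Hᵀ)`. -/
def maximizers {n : ℕ} (H : GL (Fin n) (ZMod 2)) (p q : Fin n → I) : Finset (Fin n → ZMod 2) :=
  Finset.univ.filter fun x => ∀ x' : Fin n → ZMod 2,
    weight p x' * weight q (x' ᵥ* (H : Matrix (Fin n) (Fin n) (ZMod 2))ᵀ) ≤
      weight p x * weight q (x ᵥ* (H : Matrix (Fin n) (Fin n) (ZMod 2))ᵀ)

/-- A tie-breaking rule: it selects an element of every nonempty set of vectors. -/
structure TieBreak where
  pick : {n : ℕ} → Finset (Fin n → ZMod 2) → (Fin n → ZMod 2)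
  pick_mem : ∀ {n : ℕ} (A : Finset (Fin n → ZMod 2)), A.Nonempty → pick A ∈ A

/-- The query function `f_H(p, q) = argmax_x w_p(x) w_q(x Hᵀ)`; ties are broken by `τ`. -/
def query (τ : TieBreak) {n : ℕ} (H : GL (Fin n) (ZMod 2)) (p q : Fin n → I) :
    Fin n → ZMod 2 :=
  τ.pick (maximizers H p q)

/-- The constant bias `1/2`. -/
def half : I := ⟨1 / 2, by norm_num, by norm_num⟩

variable {S Y : Type*}

/-- The encoder: codeword bias `[p_e(s_1), …, p_e(s_n)]` and parity bias `[m, q]`.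
The message has length `k`, there are `r` parity bits, and the blocklength is `n = k + r`. -/
def encode (τ : TieBreak) (pe : S → I) {k r : ℕ} (H : GL (Fin (k + r)) (ZMod 2))
    (q : Fin r → I) (m : Fin k → ZMod 2) (s : Fin (k + r) → S) : Fin (k + r) → ZMod 2 :=
  query τ H (fun i => pe (s i)) (Fin.append (fun i => bit (m i)) q)

/-- The decoder: codeword bias `[p_d(y_1), …, p_d(y_n)]` and parity bias `[1/2, …, 1/2, q]`;
it outputs the first `k` bits of `x̂ Hᵀ`. -/
def decode (τ : TieBreak) (pd : Y → I) {k r : ℕ} (H : GL (Fin (k + r)) (ZMod 2))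
    (q : Fin r → I) (y : Fin (k + r) → Y) : Fin k → ZMod 2 :=
  fun i => (query τ H (fun j => pd (y j)) (Fin.append (fun _ => half) q) ᵥ*
    (H : Matrix (Fin (k + r)) (Fin (k + r)) (ZMod 2))ᵀ) (Fin.castAdd r i)

/-- What happens in one use of the code. -/
structure Run (S Y : Type*) (k r : ℕ) where
  message : Fin k → ZMod 2
  state : Fin (k + r) → S
  parityBias : Fin r → I
  matrix : GL (Fin (k + r)) (ZMod 2)
  codeword : Fin (k + r) → ZMod 2
  output : Fin (k + r) → Y

/-- The joint law of one use of the code. The message is uniform, the states are i.i.d. `P_S`, the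
parity biases are i.i.d. `P_Q`, the full-rank matrix is uniform, all four are independent, and the
codeword is sent through the memoryless channel `P_{Y|S,X}`. -/
def runLaw (τ : TieBreak) (PS : PMF S) (PY : S → ZMod 2 → PMF Y) (pe : S → I) (PQ : PMF I)
    (k r : ℕ) : PMF (Run S Y k r) :=
  (PMF.uniformOfFintype (Fin k → ZMod 2)).bind fun m =>
  (prodPMF fun _ : Fin (k + r) => PS).bind fun s =>
  (prodPMF fun _ : Fin r => PQ).bind fun q =>
  (PMF.uniformOfFintype (GL (Fin (k + r)) (ZMod 2))).bind fun H =>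
  (prodPMF fun i => PY (s i) (encode τ pe H q m s i)).map fun y =>
    { message := m, state := s, parityBias := q, matrix := H,
      codeword := encode τ pe H q m s, output := y }

/-- The probability that the decoded message differs from the message. -/
def errorProb (τ : TieBreak) (PS : PMF S) (PY : S → ZMod 2 → PMF Y) (pe : S → I) (pd : Y → I)
    (PQ : PMF I) (k r : ℕ) : ℝ≥0∞ :=
  (runLaw τ PS PY pe PQ k r).toOuterMeasure
    {ω | decode τ pd ω.matrix ω.parityBias ω.output ≠ ω.message}

open Classical in
/-- The empirical joint distribution of the pairs `(s_i, x_i)`. -/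
def empirical {n : ℕ} (s : Fin n → S) (x : Fin n → ZMod 2) (a : S) (b : ZMod 2) : ℝ :=
  ((Finset.univ.filter fun i => s i = a ∧ x i = b).card : ℝ) / n

/-- The probability that the empirical distribution of `(s_i, x_i)` is at least `ε` away
from `P_S P_{X|S}` at some pair. -/
def deviationProb (τ : TieBreak) (PS : PMF S) (PY : S → ZMod 2 → PMF Y) (pe : S → I)
    (PQ : PMF I) (W : S → PMF (ZMod 2)) (ε : ℝ) (k r : ℕ) : ℝ≥0∞ :=
  (runLaw τ PS PY pe PQ k r).toOuterMeasure
    {ω | ∃ (a : S) (b : ZMod 2),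
      ε ≤ |empirical ω.state ω.codeword a b - (PS a * W a b).toReal|}

/-! ### The optimization problem of the encoder and the condition for the decoder -/

/-- The objective `E[H_b(X, p_e(S))] + (1 - R) E[H_b(V, Q)]`. -/
def encCost (R : ℝ) (PS : PMF S) (pe : S → I) (PQ : PMF I) (W : S → PMF (ZMod 2))
    (U : I → PMF (ZMod 2)) : ℝ≥0∞ :=
  expCrossEntropy PS W pe + ENNReal.ofReal (1 - R) * expCrossEntropy PQ U id

/-- The constraint `H(X|S) + (1 - R) H(V|Q) ≥ 1`. -/
def EncFeasible (R : ℝ) (PS : PMF S) (PQ : PMF I) (W : S → PMF (ZMod 2))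
    (U : I → PMF (ZMod 2)) : Prop :=
  1 ≤ condEntropy PS W + ENNReal.ofReal (1 - R) * condEntropy PQ U

/-- `(P_{X|S}, P_{V|Q}) = (W, U)` is a minimizer of the objective subject to the constraint. -/
def IsMinimizer (R : ℝ) (PS : PMF S) (pe : S → I) (PQ : PMF I) (W : S → PMF (ZMod 2))
    (U : I → PMF (ZMod 2)) : Prop :=
  EncFeasible R PS PQ W U ∧
    ∀ W' U', EncFeasible R PS PQ W' U' → encCost R PS pe PQ W U ≤ encCost R PS pe PQ W' U'

/-- `(W, U)` is the unique minimizer; conditional distributions are identified when they agree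
at all values of the conditioning variable that have positive probability. -/
def IsUniqueMinimizer (R : ℝ) (PS : PMF S) (pe : S → I) (PQ : PMF I) (W : S → PMF (ZMod 2))
    (U : I → PMF (ZMod 2)) : Prop :=
  IsMinimizer R PS pe PQ W U ∧
    ∀ W' U', IsMinimizer R PS pe PQ W' U' →
      (∀ a ∈ PS.support, W' a = W a) ∧ (∀ t ∈ PQ.support, U' t = U t)

/-- The joint law of `(X, Y)` when `S ∼ P_S`, `X|S ∼ W` and `Y|(S,X) ∼ P_{Y|S,X}`. -/
def lawXY (PS : PMF S) (W : S → PMF (ZMod 2)) (PY : S → ZMod 2 → PMF Y) : PMF (ZMod 2 × Y) :=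
  PS.bind fun a => (W a).bind fun b => (PY a b).map fun y => (b, y)

/-- The strict decoder inequality: whenever `H(X̃|Y) + (1 - R) H(Ṽ|Q) ≥ 1 - R`,
`E[H_b(X̃, p_d(Y))] + (1-R) E[H_b(Ṽ, Q)] > E[H_b(X, p_d(Y))] + (1-R) E[H_b(V, Q)]`. -/
def DecoderInequality (R : ℝ) (PS : PMF S) (PY : S → ZMod 2 → PMF Y) (pd : Y → I) (PQ : PMF I)
    (W : S → PMF (ZMod 2)) (U : I → PMF (ZMod 2)) : Prop :=
  ∀ (W' : Y → PMF (ZMod 2)) (U' : I → PMF (ZMod 2)),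
    ENNReal.ofReal (1 - R) ≤
        condEntropy ((lawXY PS W PY).map Prod.snd) W' + ENNReal.ofReal (1 - R) * condEntropy PQ U' →
      expect (lawXY PS W PY) (fun z => crossEntropy (bit z.1) (pd z.2)) +
          ENNReal.ofReal (1 - R) * expCrossEntropy PQ U id <
        expCrossEntropy ((lawXY PS W PY).map Prod.snd) W' pd +
          ENNReal.ofReal (1 - R) * expCrossEntropy PQ U' id

/-! ### Nondegeneracy for biases equal to `0` or `1` (automatic for biases in `(0,1)`) -/

/-- Either no codeword bit is forced by the state, or the bits that are forced neither by the state
nor by the parity biases leave room in the entropy constraint: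
`P(0 < p_e(S) < 1) + (1 - R) P(0 < Q < 1) > 1`. -/
def EncNondegenerate (R : ℝ) (PS : PMF S) (pe : S → I) (PQ : PMF I) : Prop :=
  (∀ a ∈ PS.support, pe a ∈ Set.Ioo (0 : I) 1) ∨
    1 < PS.toOuterMeasure {a | pe a ∈ Set.Ioo (0 : I) 1} +
      ENNReal.ofReal (1 - R) * PQ.toOuterMeasure (Set.Ioo (0 : I) 1)

/-- The decoder never gives weight zero to an input bit `b` with output `y` that can occur
together: `H_b(b, p_d(y)) < ∞` if `P_S(a) > 0`, `H_b(b, p_e(a)) < ∞` and `P_{Y|S,X}(y|a,b) > 0`. -/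
def DecNondegenerate (PS : PMF S) (PY : S → ZMod 2 → PMF Y) (pe : S → I) (pd : Y → I) : Prop :=
  ∀ a ∈ PS.support, ∀ b : ZMod 2, crossEntropy (bit b) (pe a) ≠ ⊤ →
    ∀ y ∈ (PY a b).support, crossEntropy (bit b) (pd y) ≠ ⊤

end

end WPC

open scoped ENNReal Matrix unitInterval Topology

namespace WPC

noncomputable section

section

/-! ### Letter counts and the averaging bound on the size of a set of binary vectors -/

/-! Read a codeword `x` and its `r = n - k` parity bits `v` as one vector `z = (x, v)`, each
position labelled by a letter: a state or an output for `x`, a parity bias for `v`. Encoder and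
decoder then maximize the same kind of product, `letterWeight`, the encoder over the `z` with `H x =
(m, v)` (`Linked`), the decoder with the message bits left free. Log-weights are linear in the type
of `z`, the frequency of ones at each letter, and sets of vectors cut out by linear conditions on
the type have exponential size given by an entropy (`exists_card_le`, `exists_le_card`).

For `m ≠ 0` and `x ≠ 0` a given `z` is linked with probability `1 / (2^n - 1)`, and distinct vectors
are almost pairwise independent. Hence sets with exponentially more than `2^n` members are hit by
most matrices and sets with exponentially fewer are missed; this is the origin of the constraint
`H(X|S) + (1 - R) H(V|Q) ≥ 1`. If the constraint has slack somewhere, mixing makes it strict at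
almost no extra cost, so some codeword has nearly minimal cost. By uniqueness and compactness the
equally cheap vectors of another type are exponentially fewer than `2^n` and are missed, so the
selected codeword has the type of the minimizer (`exists_encoderGood`). This gives the claim on the
empirical distribution. Without slack, all parity bits are forced and only one type is feasible
(`eq_of_all_parity_forced`).

Chebyshev's inequality carries the type through the channel (`exists_outputTypical`). The decoder
inequality says that at most `exp (n ((1 - R) log 2 - γ))` vectors weigh as much as `z`
(`exists_decoder_gap`), and a competitor `x' ≠ 0, x` has prescribed parity bits with probability
about `2^(-r)`. Since `z` and `y` depend on `H`, the union bound also runs over all typical `z`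
(`uniform_bind_le`). Their number is about `2^n`, because the entropy constraint is tight at a
unique minimizer (`ent_eq_log_two`), and it cancels the probability that `z` is linked. The
competitor `x' = 0` has zero parity bits for every `H` and is beaten by weight, thanks to the
symmetry of `Q` (`linCost_decParam_lt_zero`). -/

/-- The probability of `b` under the Bernoulli distribution with parameter `θ`. -/
def bitProb (θ : ℝ) (b : ZMod 2) : ℝ := if b = 1 then θ else 1 - θ

@[simp] theorem bitProb_one (θ : ℝ) : bitProb θ 1 = θ := by simp [bitProb]

@[simp] theorem bitProb_zero (θ : ℝ) : bitProb θ 0 = 1 - θ := by simp [bitProb]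

theorem bitProb_nonneg {θ : ℝ} (h : θ ∈ Set.Icc (0 : ℝ) 1) (b : ZMod 2) : 0 ≤ bitProb θ b := by
  unfold bitProb
  split_ifs
  · exact h.1
  · linarith [h.2]

theorem zmod_two_cases (b : ZMod 2) : b = 0 ∨ b = 1 := by
  revert b; decide

theorem sum_zmod_two {M : Type*} [AddCommMonoid M] (f : ZMod 2 → M) :
    ∑ b, f b = f 0 + f 1 := Fin.sum_univ_two f

theorem sum_bitProb (θ : ℝ) : ∑ b, bitProb θ b = 1 := by
  rw [sum_zmod_two]; simp

variable {ι T : Type*} [Fintype ι]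

/-- The number of positions that carry the letter `t`. -/
def letterCount [DecidableEq T] (l : ι → T) (t : T) : ℕ :=
  (Finset.univ.filter fun i => l i = t).card

/-- The number of positions that carry the letter `t` and where `z` is `1`. -/
def onesCount [DecidableEq T] (l : ι → T) (t : T) (z : ι → ZMod 2) : ℕ :=
  (Finset.univ.filter fun i => l i = t ∧ z i = 1).card

theorem onesCount_le [DecidableEq T] (l : ι → T) (t : T) (z : ι → ZMod 2) :
    onesCount l t z ≤ letterCount l t :=
  Finset.card_le_card fun i => by simp +contextual

theorem sum_comp_letter [Fintype T] [DecidableEq T] (l : ι → T) (f : T → ℝ) :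
    ∑ i, f (l i) = ∑ t, (letterCount l t : ℝ) * f t := by
  rw [← Finset.sum_fiberwise Finset.univ l]
  refine Finset.sum_congr rfl fun t _ => ?_
  rw [Finset.sum_congr rfl (g := fun _ => f t) (by simp +contextual)]
  simp [letterCount]

theorem sum_comp_letter_bit [Fintype T] [DecidableEq T] (l : ι → T) (z : ι → ZMod 2)
    (f : T → ZMod 2 → ℝ) :
    ∑ i, f (l i) (z i) = ∑ t, ((onesCount l t z : ℝ) * f t 1 +
      ((letterCount l t : ℝ) - onesCount l t z) * f t 0) := by
  have h : ∀ i, f (l i) (z i) = f (l i) 0 + if z i = 1 then f (l i) 1 - f (l i) 0 else 0 := by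
    intro i
    rcases zmod_two_cases (z i) with h | h <;> simp [h]
  simp_rw [h]
  rw [Finset.sum_add_distrib, sum_comp_letter l fun t => f t 0, ← Finset.sum_fiberwise Finset.univ l
    (fun i => if z i = 1 then f (l i) 1 - f (l i) 0 else 0), ← Finset.sum_add_distrib]
  refine Finset.sum_congr rfl fun t _ => ?_
  rw [Finset.sum_congr rfl (g := fun i => if z i = 1 then f t 1 - f t 0 else 0)
    (by simp +contextual), ← Finset.sum_filter, Finset.filter_filter]
  simp only [Finset.sum_const, nsmul_eq_mul, onesCount]
  ring

/-- The weight of `z` for the biases `p (l i)`. -/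
def letterWeight (p : T → I) (l : ι → T) (z : ι → ZMod 2) : ℝ :=
  ∏ i, bitProb (p (l i)) (z i)

/-- The Bernoulli parameters that only charge bits of positive bias. -/
def compatible (p : T → I) : Set (T → ℝ) :=
  {w | ∀ t, w t ∈ Set.Icc (0 : ℝ) 1 ∧ (p t = 0 → w t = 0) ∧ (p t = 1 → w t = 1)}

/-- The weighted sum of the binary entropies, in nats. -/
def ent [Fintype T] (ν w : T → ℝ) : ℝ := ∑ t, ν t * Real.binEntropy (w t)

/-- The expected value of `c` when the letters have weight `ν` and the bits have parameters `w`. -/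
def linCost [Fintype T] (c : T → ZMod 2 → ℝ) (ν w : T → ℝ) : ℝ :=
  ∑ t, ν t * (w t * c t 1 + (1 - w t) * c t 0)

theorem sum_prod_bitProb [DecidableEq ι] (θ : ι → ℝ) :
    ∑ z : ι → ZMod 2, ∏ i, bitProb (θ i) (z i) = 1 := by
  have := Finset.prod_univ_sum (fun _ : ι => (Finset.univ : Finset (ZMod 2)))
    (fun i b => bitProb (θ i) b)
  rw [Fintype.piFinset_univ] at this
  rw [← this]
  simp [sum_bitProb]

/-- The averaged type `w` of a set `A` of vectors of positive weight bounds the size of `A`. -/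
theorem exists_average [Fintype T] [DecidableEq T] (p : T → I) (l : ι → T)
    (A : Finset (ι → ZMod 2)) (hne : A.Nonempty)
    (hA : ∀ z ∈ A, letterWeight p l z ≠ 0) :
    ∃ w ∈ compatible p,
      (∀ t, (A.card : ℝ) * (letterCount l t * w t) = ∑ z ∈ A, (onesCount l t z : ℝ)) ∧
      Real.log A.card ≤ ∑ t, (letterCount l t : ℝ) * Real.binEntropy (w t) := by
  classical
  have hA0 : (0 : ℝ) < A.card := by exact_mod_cast hne.card_pos
  -- A letter that does not occur gets the value `p t`, which keeps `w` compatible; its count is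
  -- `0`, so the value has no further effect.
  set w : T → ℝ := fun t => if letterCount l t = 0 then (p t : ℝ) else
    (∑ z ∈ A, (onesCount l t z : ℝ)) / (A.card * letterCount l t) with hw
  have hbit : ∀ z ∈ A, ∀ i, bitProb (p (l i)) (z i) ≠ 0 := fun z hz i =>
    Finset.prod_ne_zero_iff.1 (hA z hz) i (Finset.mem_univ i)
  have havg : ∀ t, (A.card : ℝ) * (letterCount l t * w t) = ∑ z ∈ A, (onesCount l t z : ℝ) := by
    intro t
    by_cases h : letterCount l t = 0
    · have : ∀ z, onesCount l t z = 0 := fun z => Nat.le_zero.1 (h ▸ onesCount_le l t z)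
      simp [h, this]
    · have h' : (letterCount l t : ℝ) ≠ 0 := by exact_mod_cast h
      simp only [hw, h, if_false]
      field_simp
  have hsum_le : ∀ t, ∑ z ∈ A, (onesCount l t z : ℝ) ≤ A.card * letterCount l t := by
    intro t
    calc ∑ z ∈ A, (onesCount l t z : ℝ) ≤ ∑ z ∈ A, (letterCount l t : ℝ) :=
          Finset.sum_le_sum fun z _ => by exact_mod_cast onesCount_le l t z
      _ = _ := by simp
  have hsum_nn : ∀ t, 0 ≤ ∑ z ∈ A, (onesCount l t z : ℝ) := fun t =>
    Finset.sum_nonneg fun z _ => Nat.cast_nonneg _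
  have hcompat : w ∈ compatible p := by
    intro t
    by_cases h : letterCount l t = 0
    · simp only [hw, h, if_true]
      refine ⟨(p t).2, fun h => by simp [h], fun h => by simp [h]⟩
    · have h' : (0 : ℝ) < letterCount l t := by exact_mod_cast Nat.pos_of_ne_zero h
      simp only [hw, h, if_false]
      refine ⟨⟨div_nonneg (hsum_nn t) (by positivity),
        div_le_one_of_le₀ (hsum_le t) (by positivity)⟩,
        fun hp => ?_, fun hp => ?_⟩
      · rw [Finset.sum_eq_zero, zero_div]
        intro z hz
        rw [onesCount, Finset.card_eq_zero.2, Nat.cast_zero]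
        refine Finset.filter_eq_empty_iff.2 fun i _ hi => hbit z hz i ?_
        rw [hi.1, hi.2, hp]; simp
      · rw [div_eq_one_iff_eq (by positivity)]
        calc ∑ z ∈ A, (onesCount l t z : ℝ) = ∑ z ∈ A, (letterCount l t : ℝ) := by
              refine Finset.sum_congr rfl fun z hz => ?_
              rw [onesCount, letterCount]
              congr 2
              ext i
              simp only [Finset.mem_filter, Finset.mem_univ, true_and, and_iff_left_iff_imp]
              intro hi
              rcases zmod_two_cases (z i) with h0 | h0
              · exact absurd (by rw [hi, h0, hp]; simp) (hbit z hz i)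
              · exact h0
          _ = _ := by simp
  refine ⟨w, hcompat, havg, ?_⟩
  -- Each bit that occurs in some `z ∈ A` is charged by the average, to which `z` itself
  -- contributes; so all logarithms below are of positive numbers.
  have hpos : ∀ z ∈ A, ∀ i, 0 < bitProb (w (l i)) (z i) := by
    intro z hz i
    have hl : letterCount l (l i) ≠ 0 :=
      (Finset.card_pos.2 ⟨i, by simp⟩).ne'
    have h' : (0 : ℝ) < letterCount l (l i) := by exact_mod_cast Nat.pos_of_ne_zero hl
    have h1 := havg (l i)
    rcases zmod_two_cases (z i) with h0 | h0
    · rw [h0, bitProb_zero, sub_pos]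
      have : ∑ z ∈ A, (onesCount l (l i) z : ℝ) < A.card * letterCount l (l i) := by
        calc ∑ z ∈ A, (onesCount l (l i) z : ℝ) < ∑ z ∈ A, (letterCount l (l i) : ℝ) := by
              refine Finset.sum_lt_sum (fun z _ => by exact_mod_cast onesCount_le l _ z)
                ⟨z, hz, ?_⟩
              have : onesCount l (l i) z < letterCount l (l i) := by
                refine Finset.card_lt_card ?_
                rw [Finset.ssubset_iff]
                refine ⟨i, by simp [h0], fun j => ?_⟩
                simp only [Finset.mem_insert, Finset.mem_filter, Finset.mem_univ, true_and]
                rintro (rfl | h)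
                · rfl
                · exact h.1
              exact_mod_cast this
          _ = _ := by simp
      rw [← h1] at this
      by_contra hcon
      push Not at hcon
      have : (letterCount l (l i) : ℝ) * 1 ≤ letterCount l (l i) * w (l i) :=
        mul_le_mul_of_nonneg_left hcon h'.le
      nlinarith
    · rw [h0, bitProb_one]
      have : 0 < ∑ z ∈ A, (onesCount l (l i) z : ℝ) := by
        refine Finset.sum_pos' (fun _ _ => Nat.cast_nonneg _) ⟨z, hz, ?_⟩
        exact_mod_cast Finset.card_pos.2 ⟨i, by simp [h0]⟩
      rw [← h1] at this
      exact pos_of_mul_pos_right (pos_of_mul_pos_right this hA0.le) h'.le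
  -- Gibbs' inequality for the uniform law on `A` against the product measure `M`: the sum of `log
  -- (|A| M z)` over `A` is at most that of `|A| M z - 1`, hence at most `0`. As `log M` is linear
  -- in the counts, the mean of `-log M` over `A` is exactly the entropy sum.
  set M : (ι → ZMod 2) → ℝ := fun z => ∏ i, bitProb (w (l i)) (z i) with hM
  have hMpos : ∀ z ∈ A, 0 < M z := fun z hz => Finset.prod_pos fun i _ => hpos z hz i
  have hMsum : ∑ z ∈ A, M z ≤ 1 := by
    rw [← sum_prod_bitProb fun i => w (l i)]
    exact Finset.sum_le_sum_of_subset_of_nonneg (Finset.subset_univ A)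
      fun z _ _ => Finset.prod_nonneg fun i _ => bitProb_nonneg (hcompat (l i)).1 _
  have hlog : ∀ z ∈ A, Real.log A.card + Real.log (M z) ≤ A.card * M z - 1 := fun z hz => by
    rw [← Real.log_mul hA0.ne' (hMpos z hz).ne']
    exact Real.log_le_sub_one_of_pos (mul_pos hA0 (hMpos z hz))
  have h1 := Finset.sum_le_sum hlog
  rw [Finset.sum_add_distrib, Finset.sum_sub_distrib, ← Finset.mul_sum] at h1
  simp only [Finset.sum_const, nsmul_eq_mul, mul_one] at h1
  have h2 : ∑ z ∈ A, Real.log (M z) =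
      -(A.card * ∑ t, (letterCount l t : ℝ) * Real.binEntropy (w t)) := by
    calc ∑ z ∈ A, Real.log (M z)
        = ∑ z ∈ A, ∑ t, ((onesCount l t z : ℝ) * Real.log (w t) +
            ((letterCount l t : ℝ) - onesCount l t z) * Real.log (1 - w t)) := by
          refine Finset.sum_congr rfl fun z hz => ?_
          rw [hM, Real.log_prod fun i _ => (hpos z hz i).ne',
            sum_comp_letter_bit l z fun t b => Real.log (bitProb (w t) b)]
          simp
      _ = ∑ t, ((∑ z ∈ A, (onesCount l t z : ℝ)) * Real.log (w t) +
            (A.card * (letterCount l t : ℝ) - ∑ z ∈ A, (onesCount l t z : ℝ)) *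
              Real.log (1 - w t)) := by
          rw [Finset.sum_comm]
          refine Finset.sum_congr rfl fun t _ => ?_
          rw [Finset.sum_add_distrib, Finset.sum_mul, ← Finset.sum_mul _ _ (Real.log (1 - w t)),
            Finset.sum_sub_distrib]
          simp
      _ = _ := by
          rw [Finset.mul_sum, ← Finset.sum_neg_distrib]
          refine Finset.sum_congr rfl fun t _ => ?_
          rw [← havg, Real.binEntropy, Real.log_inv, Real.log_inv]
          ring
  rw [h2] at h1
  have h3 : (A.card : ℝ) * Real.log A.card ≤
      A.card * ∑ t, (letterCount l t : ℝ) * Real.binEntropy (w t) := by nlinarith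
  exact le_of_mul_le_mul_left h3 hA0

/-! ### Compactness: from strict entropy inequalities to exponential gaps -/

theorem isCompact_compatible (p : T → I) : IsCompact (compatible p) := by
  have : compatible p = Set.univ.pi fun t =>
      Set.Icc (0 : ℝ) 1 ∩ ({w | p t = 0 → w = 0} ∩ {w | p t = 1 → w = 1}) := by
    ext w; simp [compatible, Set.mem_pi]
  rw [this]
  refine isCompact_univ_pi fun t => isCompact_Icc.inter_right (IsClosed.inter ?_ ?_)
  · by_cases h : p t = 0
    · simp [h]
    · simp [h]
  · by_cases h : p t = 1
    · simp [h]
    · simp [h]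

theorem continuous_ent [Fintype T] : Continuous fun x : (T → ℝ) × (T → ℝ) => ent x.1 x.2 := by
  unfold ent; fun_prop

theorem continuous_linCost [Fintype T] (c : T → ZMod 2 → ℝ) :
    Continuous fun x : (T → ℝ) × (T → ℝ) => linCost c x.1 x.2 := by
  unfold linCost; fun_prop

/-- If the linear constraints force the entropy below `E` at the weights `μ`, they do so uniformly
in a neighbourhood. -/
theorem exists_entropy_gap [Fintype T] {J : Type*} [Fintype J] (p : T → I) (μ : T → ℝ)
    (a : J → T → ZMod 2 → ℝ) (b : J → ℝ) (E : ℝ)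
    (h : ∀ w ∈ compatible p, (∀ j, linCost (a j) μ w ≤ b j) → ent μ w < E) :
    ∃ δ > 0, ∀ ν : T → ℝ, (∀ t, |ν t - μ t| ≤ δ) → ∀ w ∈ compatible p,
      (∀ j, linCost (a j) ν w ≤ b j + δ) → ent ν w ≤ E - δ := by
  -- A continuous penalty that vanishes exactly when `ν = μ`, all constraints hold and the entropy
  -- is at least `E`. The hypothesis excludes this, so `ψ` is bounded below by a positive constant
  -- on a compact set.
  set ψ : (T → ℝ) × (T → ℝ) → ℝ := fun x =>
    ‖x.1 - μ‖ + ∑ j, max 0 (linCost (a j) x.1 x.2 - b j) + max 0 (E - ent x.1 x.2) with hψ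
  have hψc : Continuous ψ := by
    have h1 := continuous_ent (T := T)
    have h2 := fun j => continuous_linCost (a j)
    refine ((by fun_prop : Continuous fun x : (T → ℝ) × (T → ℝ) => ‖x.1 - μ‖).add
      (continuous_finsetSum _ fun j _ => ?_)).add ?_
    · exact continuous_const.max ((h2 j).sub continuous_const)
    · exact continuous_const.max (continuous_const.sub h1)
  have hnn : ∀ x : (T → ℝ) × (T → ℝ), 0 ≤ ∑ j, max 0 (linCost (a j) x.1 x.2 - b j) := fun x =>
    Finset.sum_nonneg fun j _ => le_max_left _ _
  have hpos : ∀ x ∈ Metric.closedBall μ 1 ×ˢ compatible p, 0 < ψ x := by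
    rintro ⟨ν, w⟩ ⟨-, hw⟩
    have e1 := norm_nonneg (ν - μ)
    have e2 := hnn (ν, w)
    have e3 := le_max_left 0 (E - ent ν w)
    by_contra hcon
    push Not at hcon
    simp only [hψ] at hcon e2
    have f1 : ‖ν - μ‖ = 0 := by linarith
    have f2 : ∑ j, max 0 (linCost (a j) ν w - b j) = 0 := by linarith
    have f3 : max 0 (E - ent ν w) = 0 := by linarith
    rw [norm_sub_eq_zero_iff] at f1
    subst f1
    rw [Finset.sum_eq_zero_iff_of_nonneg fun j _ => le_max_left _ _] at f2
    have := h w hw fun j => by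
      have := f2 j (Finset.mem_univ j)
      have := le_max_right 0 (linCost (a j) ν w - b j)
      linarith
    have := le_max_right 0 (E - ent ν w)
    linarith
  have hcpt : IsCompact (Metric.closedBall μ 1 ×ˢ compatible p) :=
    (isCompact_closedBall μ 1).prod (isCompact_compatible p)
  obtain ⟨ψ₀, hψ₀, hmin⟩ := hcpt.exists_forall_le' hψc.continuousOn hpos
  -- A violation at level `δ` bounds each of the `|J| + 2` terms of `ψ` by `δ`; the `3` makes the
  -- contradiction strict, and the `1` keeps `ν` in the ball.
  refine ⟨min 1 (ψ₀ / (Fintype.card J + 3)), by positivity, fun ν hν w hw hj => ?_⟩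
  set δ := min 1 (ψ₀ / (Fintype.card J + 3)) with hδ
  have hδ0 : 0 < δ := by positivity
  have hδ1 : δ * (Fintype.card J + 3) ≤ ψ₀ := by
    rw [← le_div_iff₀ (by positivity)]; exact min_le_right _ _
  by_contra hcon
  push Not at hcon
  have g1 : ‖ν - μ‖ ≤ δ := (pi_norm_le_iff_of_nonneg hδ0.le).2 fun t => by
    simpa using hν t
  have g2 : ∑ j, max 0 (linCost (a j) ν w - b j) ≤ Fintype.card J * δ := by
    calc ∑ j, max 0 (linCost (a j) ν w - b j) ≤ ∑ _j : J, δ :=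
          Finset.sum_le_sum fun j _ => max_le hδ0.le (by linarith [hj j])
      _ = _ := by simp
  have g3 : max 0 (E - ent ν w) ≤ δ := max_le hδ0.le (by linarith)
  have := hmin (ν, w) ⟨by
    rw [Metric.mem_closedBall, dist_eq_norm]; exact g1.trans (min_le_left _ _), hw⟩
  simp only [hψ] at this
  nlinarith

/-- A set of vectors that obey linear constraints is exponentially small compared with `exp (N E)`
if the constraints force the entropy below `E`. -/
theorem exists_card_le [Fintype T] [DecidableEq T] {J : Type*} [Fintype J] (p : T → I) (μ : T → ℝ)
    (a : J → T → ZMod 2 → ℝ) (b : J → ℝ) (E : ℝ)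
    (h : ∀ w ∈ compatible p, (∀ j, linCost (a j) μ w ≤ b j) → ent μ w < E) :
    ∃ δ > 0, ∀ {ι : Type} [Fintype ι] (l : ι → T) (N : ℕ), 0 < N →
      (∀ t, |(letterCount l t : ℝ) / N - μ t| ≤ δ) → ∀ A : Finset (ι → ZMod 2),
      (∀ z ∈ A, letterWeight p l z ≠ 0) →
      (∀ z ∈ A, ∀ j, ∑ i, a j (l i) (z i) ≤ N * (b j + δ)) →
      (A.card : ℝ) ≤ Real.exp (N * (E - δ)) := by
  obtain ⟨δ, hδ, hgap⟩ := exists_entropy_gap p μ a b E h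
  refine ⟨δ, hδ, fun {ι} _ l N hN hl A hA hj => ?_⟩
  rcases A.eq_empty_or_nonempty with rfl | hne
  · simpa using (Real.exp_pos _).le
  have hN' : (0 : ℝ) < N := by exact_mod_cast hN
  have hA0 : (0 : ℝ) < A.card := by exact_mod_cast hne.card_pos
  obtain ⟨w, hw, havg, hlog⟩ := exists_average p l A hne hA
  -- Costs are linear in the counts of ones, so the averaged type inherits the linear constraints of
  -- the members of `A`.
  have hgap' := hgap _ hl w hw fun j => by
    have h1 := Finset.sum_le_sum fun z hz => hj z hz j
    simp_rw [sum_comp_letter_bit] at h1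
    rw [Finset.sum_comm] at h1
    have h2 : ∀ t, ∑ z ∈ A, ((onesCount l t z : ℝ) * a j t 1 +
        ((letterCount l t : ℝ) - onesCount l t z) * a j t 0) =
        A.card * N * ((letterCount l t : ℝ) / N * (w t * a j t 1 + (1 - w t) * a j t 0)) := by
      intro t
      rw [Finset.sum_add_distrib, ← Finset.sum_mul, ← Finset.sum_mul, Finset.sum_sub_distrib,
        ← havg]
      simp only [Finset.sum_const, nsmul_eq_mul]
      field_simp
    rw [Finset.sum_congr rfl fun t _ => h2 t, ← Finset.mul_sum] at h1
    simp only [Finset.sum_const, nsmul_eq_mul, ← mul_assoc] at h1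
    exact le_of_mul_le_mul_left (by simpa only [linCost] using h1) (mul_pos hA0 hN')
  rw [← Real.log_le_iff_le_exp hA0]
  refine hlog.trans ?_
  calc ∑ t, (letterCount l t : ℝ) * Real.binEntropy (w t)
      = N * ent (fun t => (letterCount l t : ℝ) / N) w := by
        rw [ent, Finset.mul_sum]
        refine Finset.sum_congr rfl fun t _ => ?_
        field_simp
    _ ≤ _ := mul_le_mul_of_nonneg_left hgap' hN'.le

end

section

/-! ### Uniform invertible matrices over `𝔽₂` -/

/-- Invertible matrices act transitively on linearly independent families. -/
theorem exists_mulVec_eq {n d : ℕ} {v w : Fin d → Fin n → ZMod 2}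
    (hv : LinearIndependent (ZMod 2) v) (hw : LinearIndependent (ZMod 2) w) :
    ∃ G : GL (Fin n) (ZMod 2), ∀ j, G.1 *ᵥ v j = w j := by
  let f := hv.linearCombinationEquiv.symm ≪≫ₗ hw.linearCombinationEquiv
  -- An isomorphism between the two spans extends to an automorphism of the whole space.
  obtain ⟨g, hg⟩ := Submodule.exists_linearEquiv_restrict_eq f
  refine ⟨⟨LinearMap.toMatrix' g.toLinearMap, LinearMap.toMatrix' g.symm.toLinearMap,
    ?_, ?_⟩, fun j => ?_⟩
  · rw [← LinearMap.toMatrix'_comp]; simp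
  · rw [← LinearMap.toMatrix'_comp]; simp
  · have h1 : (hv.linearCombinationEquiv (Finsupp.single j 1) : Fin n → ZMod 2) = v j := by simp
    have h2 : (hw.linearCombinationEquiv (Finsupp.single j 1) : Fin n → ZMod 2) = w j := by simp
    have h3 := hg (hv.linearCombinationEquiv (Finsupp.single j 1))
    rw [h1] at h3
    change LinearMap.toMatrix' g.toLinearMap *ᵥ v j = w j
    rw [← Matrix.toLin'_apply, Matrix.toLin'_toMatrix']
    change g (v j) = w j
    rw [← h3, ← h2]
    simp [f]

/-- Over `𝔽₂` the only combination with both coefficients nonzero is `x + y`, which vanishes only if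
`x = y`. -/
theorem linearIndependent_pair_zmod_two {V : Type*} [AddCommGroup V] [Module (ZMod 2) V]
    {x y : V} (hx : x ≠ 0) (hy : y ≠ 0) (hxy : x ≠ y) :
    LinearIndependent (ZMod 2) ![x, y] := by
  rw [LinearIndependent.pair_iff]
  intro s t h
  rcases zmod_two_cases s with rfl | rfl <;> rcases zmod_two_cases t with rfl | rfl
  · simp
  · simp [hy] at h
  · simp [hx] at h
  · refine absurd ?_ hxy
    have h' : x = -y := by simpa [add_eq_zero_iff_eq_neg] using h
    have h2 : y + y = 0 := by
      rw [← two_smul (ZMod 2) y, show (2 : ZMod 2) = 0 from rfl, zero_smul]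
    rw [h', ← sub_eq_zero, ← neg_add', h2, neg_zero]

/-- All fibres of a map on a finite group that is compatible with a transitive action have
the same size. -/
theorem card_fiber_mul_card {G β : Type*} [Group G] [Fintype G] [DecidableEq β] (B : Finset β)
    (f : G → β) (hf : ∀ g, f g ∈ B)
    (htrans : ∀ b ∈ B, ∀ b' ∈ B, ∃ a : G, ∀ g, f g = b → f (a * g) = b') {b : β} (hb : b ∈ B) :
    (Finset.univ.filter fun g => f g = b).card * B.card = Fintype.card G := by
  have hle : ∀ b ∈ B, ∀ b' ∈ B, (Finset.univ.filter fun g => f g = b).card ≤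
      (Finset.univ.filter fun g => f g = b').card := by
    intro b hb b' hb'
    obtain ⟨a, ha⟩ := htrans b hb b' hb'
    refine Finset.card_le_card_of_injOn (fun g => a * g) (fun g hg => ?_)
      (mul_right_injective a).injOn
    simpa using ha g (by simpa using hg)
  rw [← Finset.card_univ, Finset.card_eq_sum_card_fiberwise (s := Finset.univ) (f := f) (t := B)
      (fun g _ => hf g),
    Finset.sum_congr rfl (g := fun _ => (Finset.univ.filter fun g => f g = b).card)
      (fun b' hb' => le_antisymm (hle _ hb' _ hb) (hle _ hb _ hb')), Finset.sum_const,
    smul_eq_mul, mul_comm]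

theorem GL_mulVec_injective {n : ℕ} (H : GL (Fin n) (ZMod 2)) :
    Function.Injective fun x : Fin n → ZMod 2 => H.1 *ᵥ x :=
  Matrix.mulVec_injective_of_isUnit H.isUnit

theorem GL_mulVec_ne_zero {n : ℕ} (H : GL (Fin n) (ZMod 2)) {x : Fin n → ZMod 2} (hx : x ≠ 0) :
    H.1 *ᵥ x ≠ 0 := fun h =>
  hx (GL_mulVec_injective H (by simpa using h))

/-- Invertible matrices act transitively on the `2^n - 1` nonzero vectors, so all fibres have equal
size. -/
theorem card_mulVec_eq {n : ℕ} {x u : Fin n → ZMod 2} (hx : x ≠ 0) (hu : u ≠ 0) :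
    (Finset.univ.filter fun H : GL (Fin n) (ZMod 2) => H.1 *ᵥ x = u).card * (2 ^ n - 1) =
      Fintype.card (GL (Fin n) (ZMod 2)) := by
  have h := card_fiber_mul_card (Finset.univ.erase (0 : Fin n → ZMod 2))
    (fun H : GL (Fin n) (ZMod 2) => H.1 *ᵥ x)
    (fun H => by simpa using GL_mulVec_ne_zero H hx) (fun b hb b' hb' => ?_) (b := u) (by simpa)
  · rw [← h, Finset.card_erase_of_mem (Finset.mem_univ _)]
    simp
  · obtain ⟨G, hG⟩ := exists_mulVec_eq (d := 1) (v := fun _ => b) (w := fun _ => b')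
      (by simpa using hb) (by simpa using hb')
    refine ⟨G, fun H hH => ?_⟩
    rw [← hG 0, ← hH, Units.val_mul, Matrix.mulVec_mulVec]

/-- Distinct nonzero vectors over `𝔽₂` are linearly independent, so the action is also transitive on
the `(2^n - 1)(2^n - 2)` ordered pairs of them. -/
theorem card_mulVec_pair_eq {n : ℕ} {x x' u u' : Fin n → ZMod 2} (hx : x ≠ 0) (hx' : x' ≠ 0)
    (hxx : x ≠ x') (hu : u ≠ 0) (hu' : u' ≠ 0) (huu : u ≠ u') :
    (Finset.univ.filter fun H : GL (Fin n) (ZMod 2) => H.1 *ᵥ x = u ∧ H.1 *ᵥ x' = u').card *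
      ((2 ^ n - 1) * (2 ^ n - 2)) = Fintype.card (GL (Fin n) (ZMod 2)) := by
  have h := card_fiber_mul_card (Finset.univ.erase (0 : Fin n → ZMod 2)).offDiag
    (fun H : GL (Fin n) (ZMod 2) => (H.1 *ᵥ x, H.1 *ᵥ x'))
    (fun H => by
      simpa using ⟨GL_mulVec_ne_zero H hx, GL_mulVec_ne_zero H hx',
        (GL_mulVec_injective H).ne hxx⟩) (fun b hb b' hb' => ?_) (b := (u, u'))
    (by simpa using ⟨hu, hu', huu⟩)
  · rw [← h, Finset.offDiag_card, Finset.card_erase_of_mem (Finset.mem_univ _)]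
    simp only [Prod.mk.injEq, Finset.card_univ, Fintype.card_pi, ZMod.card, Finset.prod_const,
      Fintype.card_fin, ← Nat.mul_sub_one]
    congr 2
  · obtain ⟨b1, b2⟩ := b
    obtain ⟨c1, c2⟩ := b'
    simp only [Finset.mem_offDiag, Finset.mem_erase, Finset.mem_univ, and_true] at hb hb'
    obtain ⟨G, hG⟩ := exists_mulVec_eq (linearIndependent_pair_zmod_two hb.1 hb.2.1 hb.2.2)
      (linearIndependent_pair_zmod_two hb'.1 hb'.2.1 hb'.2.2)
    refine ⟨G, fun H hH => ?_⟩
    have h0 := hG 0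
    have h1 := hG 1
    simp only [Prod.mk.injEq] at hH
    simp only [Matrix.cons_val_zero, Matrix.cons_val_one] at h0 h1
    simp only [Prod.mk.injEq, Units.val_mul]
    rw [← h0, ← h1, ← hH.1, ← hH.2, Matrix.mulVec_mulVec, Matrix.mulVec_mulVec]
    exact ⟨rfl, rfl⟩

variable {k r : ℕ}

/-- The vector `z = (x, v)` is a codeword with message `m` and parity bits `v`. -/
def Linked (H : GL (Fin (k + r)) (ZMod 2)) (m : Fin k → ZMod 2)
    (z : Fin (k + r) ⊕ Fin r → ZMod 2) : Prop :=
  H.1 *ᵥ (z ∘ Sum.inl) = Fin.append m (z ∘ Sum.inr)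

instance (H : GL (Fin (k + r)) (ZMod 2)) (m : Fin k → ZMod 2) :
    DecidablePred (Linked H m) := fun _ => inferInstanceAs (Decidable (_ = _))

theorem append_ne_zero {m : Fin k → ZMod 2} (hm : m ≠ 0) (v : Fin r → ZMod 2) :
    Fin.append m v ≠ 0 := fun h => hm <| funext fun i => by
  simpa using congrFun h (Fin.castAdd r i)

theorem append_left_injective (m : Fin k → ZMod 2) :
    Function.Injective fun v : Fin r → ZMod 2 => Fin.append m v := fun v v' h => funext fun i => by
  simpa using congrFun h (Fin.natAdd k i)

theorem Linked.inl_ne_zero {H : GL (Fin (k + r)) (ZMod 2)} {m : Fin k → ZMod 2} (hm : m ≠ 0)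
    {z : Fin (k + r) ⊕ Fin r → ZMod 2} (h : Linked H m z) : z ∘ Sum.inl ≠ 0 := fun h0 =>
  append_ne_zero hm (z ∘ Sum.inr) (by rw [← h, h0, Matrix.mulVec_zero])

theorem card_linked_le {m : Fin k → ZMod 2} (hm : m ≠ 0) (z : Fin (k + r) ⊕ Fin r → ZMod 2) :
    (Finset.univ.filter fun H => Linked H m z).card * (2 ^ (k + r) - 1) ≤
      Fintype.card (GL (Fin (k + r)) (ZMod 2)) := by
  by_cases hz : z ∘ Sum.inl = 0
  · rw [Finset.filter_eq_empty_iff.2 fun H _ h => h.inl_ne_zero hm hz]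
    simp
  · exact (card_mulVec_eq hz (append_ne_zero hm _)).le

/-- First moment bound: a small set is rarely hit. -/
theorem card_exists_linked_le {m : Fin k → ZMod 2} (hm : m ≠ 0)
    (A : Finset (Fin (k + r) ⊕ Fin r → ZMod 2)) :
    (Finset.univ.filter fun H => ∃ z ∈ A, Linked H m z).card * (2 ^ (k + r) - 1) ≤
      A.card * Fintype.card (GL (Fin (k + r)) (ZMod 2)) := by
  calc _ ≤ (∑ z ∈ A, (Finset.univ.filter fun H => Linked H m z).card) * (2 ^ (k + r) - 1) := by
        refine Nat.mul_le_mul_right _ (le_trans (Finset.card_le_card ?_) Finset.card_biUnion_le)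
        intro H
        simp
    _ ≤ _ := by
        rw [Finset.sum_mul]
        exact (Finset.sum_le_sum fun z _ => card_linked_le hm z).trans (by simp)

/-- Two different vectors that share the codeword or the parity bits cannot both be linked, because
`H` is an injective function. For all other pairs the exact pair count applies. -/
theorem card_linked_pair_le {m : Fin k → ZMod 2} (hm : m ≠ 0)
    {z z' : Fin (k + r) ⊕ Fin r → ZMod 2} (hz : z ∘ Sum.inl ≠ 0) (hz' : z' ∘ Sum.inl ≠ 0)
    (hne : z ≠ z') :
    (Finset.univ.filter fun H => Linked H m z ∧ Linked H m z').card *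
      ((2 ^ (k + r) - 1) * (2 ^ (k + r) - 2)) ≤ Fintype.card (GL (Fin (k + r)) (ZMod 2)) := by
  by_cases hx : z ∘ Sum.inl = z' ∘ Sum.inl
  · rw [Finset.filter_eq_empty_iff.2]
    · simp
    · rintro H - ⟨h, h'⟩
      refine hne (funext (Sum.rec (congrFun hx) (congrFun (append_left_injective m ?_))))
      change Fin.append m (z ∘ Sum.inr) = Fin.append m (z' ∘ Sum.inr)
      rw [← h, ← h', hx]
  by_cases hv : z ∘ Sum.inr = z' ∘ Sum.inr
  · rw [Finset.filter_eq_empty_iff.2]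
    · simp
    · rintro H - ⟨h, h'⟩
      refine hx (GL_mulVec_injective H ?_)
      change H.1 *ᵥ _ = H.1 *ᵥ _
      rw [h, h', hv]
  exact (card_mulVec_pair_eq hz hz' hx (append_ne_zero hm _) (append_ne_zero hm _)
    ((append_left_injective m).ne hv)).le

/-- Second moment bound: a large set is hit by most matrices. -/
theorem card_not_exists_linked_le {m : Fin k → ZMod 2} (hm : m ≠ 0) (hn : 2 ≤ k + r)
    (A : Finset (Fin (k + r) ⊕ Fin r → ZMod 2)) (hA : ∀ z ∈ A, z ∘ Sum.inl ≠ 0)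
    (hne : A.Nonempty) :
    ((Finset.univ.filter fun H => ¬ ∃ z ∈ A, Linked H m z).card : ℝ) ≤
      Fintype.card (GL (Fin (k + r)) (ZMod 2)) *
        ((2 ^ (k + r) - 1) / A.card + 1 / (2 ^ (k + r) - 2)) := by
  classical
  set g : ℝ := (Fintype.card (GL (Fin (k + r)) (ZMod 2)) : ℝ) with hg
  set M : ℝ := 2 ^ (k + r) - 1 with hM
  have hpow : (4 : ℝ) ≤ 2 ^ (k + r) := by
    calc (4 : ℝ) = 2 ^ 2 := by norm_num
      _ ≤ _ := pow_le_pow_right₀ (by norm_num) hn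
  have hpowN : 4 ≤ 2 ^ (k + r) := by exact_mod_cast hpow
  have hM3 : 3 ≤ M := by rw [hM]; linarith
  have hA0 : (0 : ℝ) < A.card := by exact_mod_cast hne.card_pos
  have hg0 : 0 ≤ g := Nat.cast_nonneg _
  -- `X H` counts the linked members of `A`. Its mean is `e = |A| / M`, and Chebyshev's inequality
  -- bounds the number of `H` with `X H = 0`.
  set X : GL (Fin (k + r)) (ZMod 2) → ℝ := fun H => ∑ z ∈ A, if Linked H m z then 1 else 0 with hX
  have hone : ∀ z ∈ A, ∑ H, (if Linked H m z then (1 : ℝ) else 0) = g / M := by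
    intro z hz
    rw [eq_div_iff (by linarith), ← Finset.sum_filter, Finset.sum_const, nsmul_eq_mul, mul_one, hg,
      ← card_mulVec_eq (hA z hz) (append_ne_zero hm (z ∘ Sum.inr)), hM]
    push_cast [Nat.cast_sub (show 1 ≤ 2 ^ (k + r) by omega)]
    rfl
  have htwo : ∀ z ∈ A, ∀ z' ∈ A, z ≠ z' → ∑ H, (if Linked H m z then (1 : ℝ) else 0) *
      (if Linked H m z' then 1 else 0) ≤ g / (M * (M - 1)) := by
    intro z hz z' hz' hzz
    rw [le_div_iff₀ (by nlinarith)]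
    have h := card_linked_pair_le hm (hA z hz) (hA z' hz') hzz
    have h' : (((Finset.univ.filter fun H => Linked H m z ∧ Linked H m z').card *
      ((2 ^ (k + r) - 1) * (2 ^ (k + r) - 2)) : ℕ) : ℝ) ≤ g := Nat.cast_le.2 h
    push_cast [Nat.cast_sub (show 1 ≤ 2 ^ (k + r) by omega),
      Nat.cast_sub (show 2 ≤ 2 ^ (k + r) by omega)] at h'
    simp only [mul_ite, mul_one, mul_zero, ← ite_and]
    rw [← Finset.sum_filter, Finset.sum_const, nsmul_eq_mul, mul_one]
    have hM' : M - 1 = 2 ^ (k + r) - 2 := by rw [hM]; ring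
    rw [hM', Finset.filter_congr fun H _ => and_comm]
    exact h'
  have hEX : ∑ H, X H = A.card * (g / M) := by
    simp only [hX]
    rw [Finset.sum_comm, Finset.sum_congr rfl hone]
    simp
  have hEX2 : ∑ H, X H ^ 2 ≤ A.card * (g / M) + A.card ^ 2 * (g / (M * (M - 1))) := by
    have : ∀ H, X H ^ 2 = ∑ z ∈ A, ∑ z' ∈ A, (if Linked H m z then (1 : ℝ) else 0) *
      (if Linked H m z' then 1 else 0) := fun H => by rw [sq, hX, Finset.sum_mul_sum]
    simp_rw [this]
    rw [Finset.sum_comm]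
    have hbd : ∀ z ∈ A, ∑ H, ∑ z' ∈ A, (if Linked H m z then (1 : ℝ) else 0) *
        (if Linked H m z' then 1 else 0) ≤ g / M + A.card * (g / (M * (M - 1))) := by
      intro z hz
      rw [Finset.sum_comm, ← Finset.add_sum_erase _ _ hz]
      refine add_le_add ?_ ?_
      · rw [← hone z hz]
        refine Finset.sum_le_sum fun H _ => ?_
        split_ifs <;> simp
      · calc _ ≤ ∑ _z' ∈ A.erase z, g / (M * (M - 1)) := Finset.sum_le_sum fun z' hz' =>
              htwo z hz z' (Finset.mem_of_mem_erase hz') (Finset.ne_of_mem_erase hz').symm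
          _ ≤ ∑ _z' ∈ A, g / (M * (M - 1)) :=
              Finset.sum_le_sum_of_subset_of_nonneg (Finset.erase_subset _ _)
                fun _ _ _ => div_nonneg hg0 (by nlinarith)
          _ = _ := by simp
    refine (Finset.sum_le_sum hbd).trans (le_of_eq ?_)
    rw [Finset.sum_const, nsmul_eq_mul]; ring
  set e : ℝ := A.card / M with he
  have he0 : 0 < e := div_pos hA0 (by linarith)
  have hcheb : ((Finset.univ.filter fun H => ¬ ∃ z ∈ A, Linked H m z).card : ℝ) * e ^ 2 ≤
      ∑ H, (X H - e) ^ 2 := by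
    rw [← nsmul_eq_mul, ← Finset.sum_const]
    refine (Finset.sum_le_sum fun H hH => ?_).trans (Finset.sum_le_sum_of_subset_of_nonneg
      (Finset.subset_univ _) fun _ _ _ => sq_nonneg _)
    have : X H = 0 := Finset.sum_eq_zero fun z hz => if_neg fun h =>
      (Finset.mem_filter.1 hH).2 ⟨z, hz, h⟩
    rw [this]; simp
  have hvar : ∑ H, (X H - e) ^ 2 = ∑ H, X H ^ 2 - g * e ^ 2 := by
    have : ∀ H, (X H - e) ^ 2 = X H ^ 2 - 2 * e * X H + e ^ 2 := fun H => by ring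
    simp_rw [this]
    rw [Finset.sum_add_distrib, Finset.sum_sub_distrib, ← Finset.mul_sum, hEX]
    simp only [Finset.sum_const, nsmul_eq_mul, Finset.card_univ]
    rw [← hg, he]; ring
  have hM0 : M ≠ 0 := by linarith
  have hM1 : M - 1 ≠ 0 := by linarith
  -- The variance is at most `e + e² / (M - 1)`: the diagonal, plus the excess of the pair
  -- probability `1 / (M (M - 1))` over `1 / M²`.
  have hfin : ((Finset.univ.filter fun H => ¬ ∃ z ∈ A, Linked H m z).card : ℝ) * e ^ 2 ≤
      g * (M / A.card + 1 / (M - 1)) * e ^ 2 := by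
    refine hcheb.trans ?_
    rw [hvar]
    refine (sub_le_sub_right hEX2 _).trans (le_of_eq ?_)
    rw [he]
    field_simp
    ring
  have := le_of_mul_le_mul_right hfin (by positivity)
  rwa [show M - 1 = 2 ^ (k + r) - 2 by rw [hM]; ring] at this

/-- The parity bits of the codeword `x`. -/
def parityBits (H : GL (Fin (k + r)) (ZMod 2)) (x : Fin (k + r) → ZMod 2) : Fin r → ZMod 2 :=
  fun j => (H.1 *ᵥ x) (Fin.natAdd k j)

/-- The decoder does not know the message bits of the competitor `x`, so the event splits over their
`2^k` values, each of which is impossible or has the probability of a pair. -/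
theorem card_linked_and_parityBits_le {m : Fin k → ZMod 2} (hm : m ≠ 0)
    (z : Fin (k + r) ⊕ Fin r → ZMod 2) {x : Fin (k + r) → ZMod 2} (hx : x ≠ 0)
    (hxz : x ≠ z ∘ Sum.inl) (v : Fin r → ZMod 2) :
    (Finset.univ.filter fun H => Linked H m z ∧ parityBits H x = v).card *
      ((2 ^ (k + r) - 1) * (2 ^ (k + r) - 2)) ≤
      2 ^ k * Fintype.card (GL (Fin (k + r)) (ZMod 2)) := by
  classical
  by_cases hz : z ∘ Sum.inl = 0
  · rw [Finset.filter_eq_empty_iff.2 fun H _ h => h.1.inl_ne_zero hm hz]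
    simp
  have hsub : (Finset.univ.filter fun H => Linked H m z ∧ parityBits H x = v) ⊆
      (Finset.univ : Finset (Fin k → ZMod 2)).biUnion fun a => Finset.univ.filter fun H =>
        H.1 *ᵥ (z ∘ Sum.inl) = Fin.append m (z ∘ Sum.inr) ∧ H.1 *ᵥ x = Fin.append a v := by
    intro H hH
    simp only [Finset.mem_filter, Finset.mem_univ, true_and] at hH
    simp only [Finset.mem_biUnion, Finset.mem_filter, Finset.mem_univ, true_and]
    refine ⟨fun i => (H.1 *ᵥ x) (Fin.castAdd r i), hH.1, ?_⟩
    rw [← hH.2]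
    exact (Fin.append_castAdd_natAdd).symm
  calc _ ≤ (∑ a : Fin k → ZMod 2, (Finset.univ.filter fun H : GL (Fin (k + r)) (ZMod 2) =>
        H.1 *ᵥ (z ∘ Sum.inl) = Fin.append m (z ∘ Sum.inr) ∧ H.1 *ᵥ x = Fin.append a v).card) *
          ((2 ^ (k + r) - 1) * (2 ^ (k + r) - 2)) :=
        Nat.mul_le_mul_right _ ((Finset.card_le_card hsub).trans Finset.card_biUnion_le)
    _ ≤ ∑ _a : Fin k → ZMod 2, Fintype.card (GL (Fin (k + r)) (ZMod 2)) := by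
        rw [Finset.sum_mul]
        refine Finset.sum_le_sum fun a _ => ?_
        by_cases h : Fin.append a v = 0 ∨ Fin.append m (z ∘ Sum.inr) = Fin.append a v
        · rw [Finset.filter_eq_empty_iff.2]
          · simp
          · rintro H - ⟨h1, h2⟩
            rcases h with h | h
            · exact GL_mulVec_ne_zero H hx (h2.trans h)
            · exact hxz (GL_mulVec_injective H (h2.trans (h.symm.trans h1.symm)))
        · push Not at h
          exact (card_mulVec_pair_eq hz hx hxz.symm (append_ne_zero hm _) h.1 h.2).le
    _ = _ := by simp

end

section

/-! ### Chebyshev's inequality for independent bits -/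

/-- A bit, seen as a real number. -/
def bitVal (b : ZMod 2) : ℝ := if b = 1 then 1 else 0

@[simp] theorem bitVal_one : bitVal 1 = 1 := by simp [bitVal]

@[simp] theorem bitVal_zero : bitVal 0 = 0 := by simp [bitVal]

section

variable {ι : Type*} [Fintype ι] [DecidableEq ι]

theorem sum_prod_zmod_two (g : ι → ZMod 2 → ℝ) :
    ∑ z : ι → ZMod 2, ∏ i, g i (z i) = ∏ i, (g i 0 + g i 1) := by
  have := Finset.prod_univ_sum (fun _ : ι => (Finset.univ : Finset (ZMod 2))) g
  rw [Fintype.piFinset_univ] at this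
  rw [← this]
  simp_rw [sum_zmod_two]

/-- The sum factors over the positions, and a centred bit has mean zero; only the variance on the
diagonal survives. -/
theorem sum_prod_bitProb_mul (θ : ι → ℝ) (i j : ι) :
    ∑ z : ι → ZMod 2, (∏ l, bitProb (θ l) (z l)) *
      ((bitVal (z i) - θ i) * (bitVal (z j) - θ j)) =
      if i = j then θ i * (1 - θ i) else 0 := by
  have h : ∀ z : ι → ZMod 2, (∏ l, bitProb (θ l) (z l)) *
      ((bitVal (z i) - θ i) * (bitVal (z j) - θ j)) =
      ∏ l, (bitProb (θ l) (z l) * ((if l = i then bitVal (z l) - θ l else 1) *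
        (if l = j then bitVal (z l) - θ l else 1))) := by
    intro z
    rw [Finset.prod_mul_distrib, Finset.prod_mul_distrib, Finset.prod_ite_eq', Finset.prod_ite_eq']
    simp
  simp_rw [h]
  rw [sum_prod_zmod_two fun l b => bitProb (θ l) b * ((if l = i then bitVal b - θ l else 1) *
        (if l = j then bitVal b - θ l else 1))]
  split_ifs with hij
  · subst hij
    rw [Finset.prod_eq_single i]
    · simp only [if_true, bitProb_zero, bitProb_one, bitVal_zero, bitVal_one]; ring
    · intro l _ hl; simp [hl]
    · simp
  · refine Finset.prod_eq_zero (Finset.mem_univ i) ?_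
    simp only [if_true, if_neg hij, bitProb_zero, bitProb_one, bitVal_zero, bitVal_one]; ring

theorem sum_prod_bitProb_sq (θ : ι → ℝ) (J : Finset ι) :
    ∑ z : ι → ZMod 2, (∏ l, bitProb (θ l) (z l)) * (∑ i ∈ J, (bitVal (z i) - θ i)) ^ 2 =
      ∑ i ∈ J, θ i * (1 - θ i) := by
  simp_rw [sq, Finset.sum_mul_sum, Finset.mul_sum]
  rw [Finset.sum_comm]
  refine Finset.sum_congr rfl fun i hi => ?_
  rw [Finset.sum_comm]
  simp_rw [sum_prod_bitProb_mul]
  simp [hi]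

theorem sum_prod_bitProb_deviation_le (θ : ι → ℝ) (hθ : ∀ i, θ i ∈ Set.Icc (0 : ℝ) 1)
    (J : Finset ι) {c : ℝ} (hc : 0 < c) :
    ∑ z : ι → ZMod 2 with c ≤ |∑ i ∈ J, (bitVal (z i) - θ i)|, ∏ i, bitProb (θ i) (z i) ≤
      J.card / c ^ 2 := by
  have hnn : ∀ z : ι → ZMod 2, 0 ≤ ∏ i, bitProb (θ i) (z i) := fun z =>
    Finset.prod_nonneg fun i _ => bitProb_nonneg (hθ i) _
  rw [le_div_iff₀ (by positivity), Finset.sum_mul]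
  calc _ ≤ ∑ z : ι → ZMod 2 with c ≤ |∑ i ∈ J, (bitVal (z i) - θ i)|,
        (∏ i, bitProb (θ i) (z i)) * (∑ i ∈ J, (bitVal (z i) - θ i)) ^ 2 := by
        refine Finset.sum_le_sum fun z hz => mul_le_mul_of_nonneg_left ?_ (hnn z)
        rw [← sq_abs (∑ i ∈ J, _)]
        exact pow_le_pow_left₀ hc.le (Finset.mem_filter.1 hz).2 2
    _ ≤ ∑ z : ι → ZMod 2,
        (∏ i, bitProb (θ i) (z i)) * (∑ i ∈ J, (bitVal (z i) - θ i)) ^ 2 :=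
        Finset.sum_le_sum_of_subset_of_nonneg (Finset.subset_univ _)
          fun z _ _ => mul_nonneg (hnn z) (sq_nonneg _)
    _ = ∑ i ∈ J, θ i * (1 - θ i) := sum_prod_bitProb_sq θ J
    _ ≤ ∑ _i ∈ J, (1 : ℝ) := Finset.sum_le_sum fun i _ => by
        nlinarith [(hθ i).1, (hθ i).2]
    _ = _ := by simp

end

/-! ### Discrete distributions -/

theorem prodPMF_map {α β : Type*} {n : ℕ} (P : Fin n → PMF α) (g : Fin n → α → β) :
    (prodPMF P).map (fun a i => g i (a i)) = prodPMF fun i => (P i).map (g i) := by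
  induction n with
  | zero =>
    simp only [prodPMF, PMF.pure_map]
    congr 1
    exact Subsingleton.elim _ _
  | succ n ih =>
    simp only [prodPMF]
    rw [PMF.map_bind, PMF.bind_map]
    congr 1
    funext a
    rw [PMF.map_comp, Function.comp_apply, ← ih, PMF.map_comp]
    congr 1
    funext f i
    refine Fin.cases ?_ (fun i => ?_) i <;> simp

theorem sum_pmf_toReal {α : Type*} [Fintype α] (P : PMF α) : ∑ a, (P a).toReal = 1 := by
  rw [← ENNReal.toReal_sum fun a _ => P.apply_ne_top a, ← tsum_fintype (L := .unconditional _),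
    P.tsum_coe, ENNReal.toReal_one]

theorem pmf_toReal_mem_Icc {α : Type*} (P : PMF α) (a : α) :
    (P a).toReal ∈ Set.Icc (0 : ℝ) 1 :=
  ⟨ENNReal.toReal_nonneg,
    ENNReal.toReal_le_of_le_ofReal zero_le_one (by simpa using P.coe_le_one a)⟩

theorem pmf_bit_toReal (P : PMF (ZMod 2)) (b : ZMod 2) :
    (P b).toReal = bitProb (P 1).toReal b := by
  have h := sum_pmf_toReal P
  rw [sum_zmod_two] at h
  rcases zmod_two_cases b with rfl | rfl
  · rw [bitProb_zero]; linarith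
  · simp

/-- Chebyshev's inequality for the number of independent events that occur. -/
theorem prodPMF_deviation_le {α : Type*} {n : ℕ} (P : Fin n → PMF α) (B : Fin n → α → Prop)
    [∀ i, DecidablePred (B i)] {c : ℝ} (hc : 0 < c) :
    (prodPMF P).toOuterMeasure {a | c ≤ |((Finset.univ.filter fun i => B i (a i)).card : ℝ) -
      ∑ i, ((P i).toOuterMeasure {a | B i a}).toReal|} ≤ ENNReal.ofReal (n / c ^ 2) := by
  classical
  -- Only the indicators of the events matter, so the law is pushed forward to independent bits.
  set g : Fin n → α → ZMod 2 := fun i a => if B i a then 1 else 0 with hg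
  set θ : Fin n → ℝ := fun i => (((P i).map (g i)) 1).toReal with hθ
  have hθP : ∀ i, θ i = ((P i).toOuterMeasure {a | B i a}).toReal := by
    intro i
    simp only [hθ]
    rw [← PMF.toOuterMeasure_apply_singleton, PMF.toOuterMeasure_map_apply]
    congr 2
    ext a
    simp [hg]
  have hset : {a : Fin n → α | c ≤ |((Finset.univ.filter fun i => B i (a i)).card : ℝ) -
      ∑ i, ((P i).toOuterMeasure {a | B i a}).toReal|} = (fun (a : Fin n → α) i => g i (a i)) ⁻¹'
        {z | c ≤ |∑ i, (bitVal (z i) - θ i)|} := by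
    ext a
    simp only [Set.mem_ofPred_eq, Set.mem_preimage, Finset.sum_sub_distrib, ← hθP]
    have : ∑ i, bitVal (g i (a i)) = ((Finset.univ.filter fun i => B i (a i)).card : ℝ) := by
      rw [Finset.card_filter]
      push_cast
      refine Finset.sum_congr rfl fun i _ => ?_
      simp only [hg]
      split_ifs <;> simp
    rw [this]
  rw [hset, ← PMF.toOuterMeasure_map_apply, prodPMF_map, PMF.toOuterMeasure_apply_fintype]
  have hle := sum_prod_bitProb_deviation_le θ (fun i => pmf_toReal_mem_Icc _ _) Finset.univ hc
  rw [Finset.card_univ, Fintype.card_fin] at hle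
  refine le_trans (le_of_eq ?_) (ENNReal.ofReal_le_ofReal hle)
  rw [ENNReal.ofReal_sum_of_nonneg
    fun z _ => Finset.prod_nonneg fun i _ => bitProb_nonneg (pmf_toReal_mem_Icc _ _) _,
    Finset.sum_filter]
  refine Finset.sum_congr rfl fun z _ => ?_
  rw [Set.indicator_apply]
  simp only [Set.mem_ofPred_eq]
  split_ifs
  · rw [prodPMF_apply, ENNReal.ofReal_prod_of_nonneg
      fun i _ => bitProb_nonneg (pmf_toReal_mem_Icc _ _) _]
    refine Finset.prod_congr rfl fun i _ => ?_
    rw [← pmf_bit_toReal, ENNReal.ofReal_toReal (PMF.apply_ne_top _ _)]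
  · rfl

/-- Conditioning on the first stage: the second probability is bounded by `1` on `B` and by `η`
elsewhere. -/
theorem toOuterMeasure_bind_le {α β : Type*} (p : PMF α) (f : α → PMF β) (s : Set β) (B : Set α)
    (η : ℝ≥0∞) (h : ∀ a ∈ p.support, a ∉ B → (f a).toOuterMeasure s ≤ η) :
    (p.bind f).toOuterMeasure s ≤ p.toOuterMeasure B + η := by
  rw [PMF.toOuterMeasure_bind_apply, PMF.toOuterMeasure_apply]
  calc ∑' a, p a * (f a).toOuterMeasure s ≤ ∑' a, (B.indicator p a + p a * η) := by
        refine ENNReal.tsum_le_tsum fun a => ?_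
        by_cases ha : a ∈ B
        · rw [Set.indicator_of_mem ha]
          refine le_add_right (mul_le_of_le_one_right' ?_)
          exact (PMF.toOuterMeasure_mono _ (Set.subset_univ _)).trans
            ((PMF.toOuterMeasure_apply_eq_one_iff _ _).2 (Set.subset_univ _)).le
        · rw [Set.indicator_of_notMem ha, zero_add]
          by_cases hp : a ∈ p.support
          · gcongr
            exact h a hp ha
          · rw [PMF.mem_support_iff, not_not] at hp
            simp [hp]
    _ = _ := by rw [ENNReal.tsum_add, ENNReal.tsum_mul_right, p.tsum_coe, one_mul]

theorem toOuterMeasure_uniform_le {α : Type*} [Fintype α] [Nonempty α] (s : Set α)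
    [DecidablePred (· ∈ s)] {η : ℝ}
    (h : ((Finset.univ.filter (· ∈ s)).card : ℝ) ≤ Fintype.card α * η) :
    (PMF.uniformOfFintype α).toOuterMeasure s ≤ ENNReal.ofReal η := by
  have hc : (0 : ℝ) < Fintype.card α := by exact_mod_cast Fintype.card_pos
  rw [PMF.toOuterMeasure_uniformOfFintype_apply, Fintype.card_subtype,
    ← ENNReal.ofReal_natCast, ← ENNReal.ofReal_natCast, ← ENNReal.ofReal_div_of_pos hc]
  refine ENNReal.ofReal_le_ofReal ?_
  rw [div_le_iff₀ hc, mul_comm]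
  exact h

end

section

/-! ### The encoder's optimization problem in terms of letters -/

variable {T : Type*}

/-- The cost `-log` of a bit, in nats. -/
def natCost (p : T → I) (t : T) (b : ZMod 2) : ℝ := -Real.log (bitProb (p t) b)

theorem letterWeight_nonneg {ι : Type*} [Fintype ι] (p : T → I) (l : ι → T) (z : ι → ZMod 2) :
    0 ≤ letterWeight p l z :=
  Finset.prod_nonneg fun i _ => bitProb_nonneg (p (l i)).2 _

theorem log_letterWeight {ι : Type*} [Fintype ι] {p : T → I} {l : ι → T} {z : ι → ZMod 2}
    (h : letterWeight p l z ≠ 0) :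
    Real.log (letterWeight p l z) = -∑ i, natCost p (l i) (z i) := by
  rw [letterWeight, Real.log_prod fun i hi => Finset.prod_ne_zero_iff.1 h i hi,
    ← Finset.sum_neg_distrib]
  simp [natCost]

/-- An impossible bit has `natCost` equal to `-log 0 = 0`, so the cost is minus the log-weight only
at positive weight. Positivity is therefore transferred together with the comparison of costs. -/
theorem sum_natCost_le {ι : Type*} [Fintype ι] {p : T → I} {l : ι → T} {z z' : ι → ZMod 2}
    (h : letterWeight p l z ≠ 0) (hle : letterWeight p l z ≤ letterWeight p l z') :
    letterWeight p l z' ≠ 0 ∧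
      ∑ i, natCost p (l i) (z' i) ≤ ∑ i, natCost p (l i) (z i) := by
  have h0 : 0 < letterWeight p l z := lt_of_le_of_ne (letterWeight_nonneg p l z) h.symm
  have h1 : letterWeight p l z' ≠ 0 := (h0.trans_le hle).ne'
  refine ⟨h1, ?_⟩
  have := Real.log_le_log h0 hle
  rw [log_letterWeight h, log_letterWeight h1] at this
  linarith

theorem exists_pos_forall_le {J : Type*} [Finite J] (f : J → ℝ) (hf : ∀ j, 0 < f j) :
    ∃ δ > 0, ∀ j, δ ≤ f j := by
  rcases isEmpty_or_nonempty J with h | h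
  · exact ⟨1, one_pos, fun j => h.elim j⟩
  · obtain ⟨j, hj⟩ := Finite.exists_min f
    exact ⟨f j, hf j, hj⟩

theorem bitProb_ne_zero_of_compatible {p : T → I} {w : T → ℝ} (hw : w ∈ compatible p) {t : T}
    {b : ZMod 2} (h : bitProb (w t) b ≠ 0) : bitProb (p t) b ≠ 0 := by
  intro h0
  rcases zmod_two_cases b with rfl | rfl
  · rw [bitProb_zero] at h h0
    have : p t = 1 := Subtype.ext (by rw [Set.Icc.coe_one]; linarith)
    exact h (by rw [(hw t).2.2 this, sub_self])
  · rw [bitProb_one] at h h0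
    exact h ((hw t).2.1 (Subtype.ext (by simpa using h0)))

section

variable [Fintype T]

/-- This is why a vector of type `(μ, w)` has probability about `exp (-N * ent μ w)` under the
product law with parameters `w`. -/
theorem linCost_log_bitProb (μ w : T → ℝ) :
    linCost (fun t b => Real.log (bitProb (w t) b)) μ w = -ent μ w := by
  unfold linCost ent
  rw [← Finset.sum_neg_distrib]
  refine Finset.sum_congr rfl fun t _ => ?_
  rw [Real.binEntropy, Real.log_inv, Real.log_inv]
  simp only [bitProb_one, bitProb_zero]
  ring

theorem linCost_update [DecidableEq T] (c : T → ZMod 2 → ℝ) (μ w : T → ℝ) (t : T) (x : ℝ) :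
    linCost c μ (Function.update w t x) =
      linCost c μ w + (x - w t) * (μ t * (c t 1 - c t 0)) := by
  unfold linCost
  rw [← Finset.add_sum_erase _ _ (Finset.mem_univ t),
    ← Finset.add_sum_erase _ (fun t => μ t * (w t * c t 1 + (1 - w t) * c t 0))
      (Finset.mem_univ t),
    Finset.sum_congr rfl (g := fun t => μ t * (w t * c t 1 + (1 - w t) * c t 0))
      fun s hs => by rw [Function.update_of_ne (Finset.ne_of_mem_erase hs)]]
  rw [Function.update_self]
  ring

/-- The entropy constraint is tight at a unique minimizer of a linear objective. -/
theorem ent_eq_log_two {p : T → I} {μ w₀ : T → ℝ} {c : T → ZMod 2 → ℝ}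
    (hw₀ : w₀ ∈ compatible p) (hfeas : Real.log 2 ≤ ent μ w₀)
    (huniq : ∀ w ∈ compatible p, Real.log 2 ≤ ent μ w → linCost c μ w ≤ linCost c μ w₀ → w = w₀) :
    ent μ w₀ = Real.log 2 := by
  classical
  by_contra hne
  have hlt : Real.log 2 < ent μ w₀ := lt_of_le_of_ne hfeas (Ne.symm hne)
  have hpos : 0 < ent μ w₀ := (Real.log_pos one_lt_two).trans hlt
  -- Positive entropy yields a coordinate inside `(0, 1)`. If the entropy constraint were slack,
  -- this coordinate could move a little both ways; the cost is affine in it, so one direction does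
  -- not raise the cost, against uniqueness.
  obtain ⟨t, -, ht⟩ : ∃ t ∈ Finset.univ, μ t * Real.binEntropy (w₀ t) ≠ 0 :=
    Finset.exists_ne_zero_of_sum_ne_zero hpos.ne'
  have hb : Real.binEntropy (w₀ t) ≠ 0 := right_ne_zero_of_mul ht
  rw [Ne, Real.binEntropy_eq_zero, not_or] at hb
  have ht0 : 0 < w₀ t := lt_of_le_of_ne (hw₀ t).1.1 (Ne.symm hb.1)
  have ht1 : w₀ t < 1 := lt_of_le_of_ne (hw₀ t).1.2 hb.2
  have hcont : Continuous fun x : ℝ => ent μ (Function.update w₀ t x) := by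
    have h := continuous_ent (T := T)
    exact h.comp (continuous_const.prodMk (continuous_const.update t continuous_id))
  have hev : ∀ᶠ x in 𝓝 (w₀ t), Real.log 2 < ent μ (Function.update w₀ t x) :=
    hcont.continuousAt.eventually_const_lt (by simpa using hlt)
  have hev' : ∀ᶠ x in 𝓝 (w₀ t), 0 < x ∧ x < 1 :=
    (eventually_gt_nhds ht0).and (eventually_lt_nhds ht1)
  obtain ⟨ε, hε, hball⟩ := Metric.eventually_nhds_iff.1 (hev.and hev')
  have key : ∀ x, dist x (w₀ t) < ε → x ≠ w₀ t →
      ¬ (x - w₀ t) * (μ t * (c t 1 - c t 0)) ≤ 0 := by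
    intro x hx hxne hle
    obtain ⟨h1, h2, h3⟩ := hball hx
    have hcomp : Function.update w₀ t x ∈ compatible p := by
      intro s
      by_cases hs : s = t
      · subst hs
        rw [Function.update_self]
        exact ⟨⟨h2.le, h3.le⟩, fun hp => absurd ((hw₀ s).2.1 hp) hb.1,
          fun hp => absurd ((hw₀ s).2.2 hp) hb.2⟩
      · rw [Function.update_of_ne hs]
        exact hw₀ s
    have := huniq _ hcomp h1.le (by rw [linCost_update]; linarith)
    exact hxne (by simpa using congrFun this t)
  rcases le_total (μ t * (c t 1 - c t 0)) 0 with hd | hd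
  · refine key (w₀ t + ε / 2) (by simp [abs_of_pos hε]; linarith) (by linarith) ?_
    exact mul_nonpos_of_nonneg_of_nonpos (by linarith) hd
  · refine key (w₀ t - ε / 2) (by simp [abs_of_pos hε]; linarith) (by linarith) ?_
    exact mul_nonpos_of_nonpos_of_nonneg (by linarith) hd

theorem linCost_mix (c : T → ZMod 2 → ℝ) (μ w u : T → ℝ) (a : ℝ) :
    linCost c μ (fun t => (1 - a) * w t + a * u t) =
      linCost c μ w + a * (linCost c μ u - linCost c μ w) := by
  unfold linCost
  rw [← Finset.sum_sub_distrib, Finset.mul_sum, ← Finset.sum_add_distrib]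
  exact Finset.sum_congr rfl fun t _ => by ring

/-- A feasible point with slack makes the entropy constraint strict at arbitrarily small cost. -/
theorem exists_strictly_feasible {p : T → I} {μ w₀ u : T → ℝ} (c : T → ZMod 2 → ℝ)
    (hμ : ∀ t, 0 ≤ μ t) (hw₀ : w₀ ∈ compatible p) (hfeas : Real.log 2 ≤ ent μ w₀)
    (hu : u ∈ compatible p) (hu2 : Real.log 2 < ent μ u) {δ : ℝ} (hδ : 0 < δ) :
    ∃ w ∈ compatible p, Real.log 2 < ent μ w ∧ linCost c μ w < linCost c μ w₀ + δ := by
  set D := linCost c μ u - linCost c μ w₀ with hD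
  -- The weight of `u` in the mixture: the cost is linear and changes by `a * D < δ`, while
  -- concavity of the entropy puts the mixture strictly above `log 2`.
  set a : ℝ := min (1 / 2) (δ / (2 * (|D| + 1))) with ha
  have ha0 : 0 < a := by positivity
  have ha1 : a ≤ 1 / 2 := min_le_left _ _
  have haD : a * D < δ := by
    have h1 : a * (2 * (|D| + 1)) ≤ δ := by
      rw [← le_div_iff₀ (by positivity)]; exact min_le_right _ _
    nlinarith [le_abs_self D, abs_nonneg D]
  refine ⟨fun t => (1 - a) * w₀ t + a * u t,
    fun t => ⟨⟨?_, ?_⟩, fun hp => ?_, fun hp => ?_⟩, ?_, ?_⟩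
  · nlinarith [(hw₀ t).1.1, (hu t).1.1]
  · nlinarith [(hw₀ t).1.2, (hu t).1.2]
  · simp [(hw₀ t).2.1 hp, (hu t).2.1 hp]
  · simp [(hw₀ t).2.2 hp, (hu t).2.2 hp]
  · have : (1 - a) * ent μ w₀ + a * ent μ u ≤ ent μ fun t => (1 - a) * w₀ t + a * u t := by
      unfold ent
      rw [Finset.mul_sum, Finset.mul_sum, ← Finset.sum_add_distrib]
      refine Finset.sum_le_sum fun t _ => ?_
      have := Real.strictConcave_binEntropy.concaveOn.2 (hw₀ t).1 (hu t).1
        (by linarith : 0 ≤ 1 - a) ha0.le (by ring)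
      simp only [smul_eq_mul] at this
      nlinarith [hμ t, mul_le_mul_of_nonneg_left this (hμ t)]
    nlinarith
  · rw [linCost_mix]
    linarith

end

/-! ### Counting vectors by their type -/

section

variable [Fintype T] [DecidableEq T]

/-- The cost of a vector whose type is close to `(μ, w)`. -/
theorem abs_sum_sub_linCost_le {ι : Type*} [Fintype ι] (c : T → ZMod 2 → ℝ) {μ w : T → ℝ}
    {l : ι → T} {z : ι → ZMod 2} {N : ℕ} (hN : 0 < N) {κ : ℝ}
    (h1 : ∀ t, |(letterCount l t : ℝ) / N - μ t| ≤ κ)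
    (h2 : ∀ t, |(onesCount l t z : ℝ) / N - μ t * w t| ≤ κ) :
    |∑ i, c (l i) (z i) - N * linCost c μ w| ≤ N * (κ * ∑ t, (|c t 1| + 2 * |c t 0|)) := by
  have hN' : (0 : ℝ) < N := by exact_mod_cast hN
  rw [sum_comp_letter_bit, linCost, Finset.mul_sum, ← Finset.sum_sub_distrib, Finset.mul_sum,
    Finset.mul_sum]
  refine (Finset.abs_sum_le_sum_abs _ _).trans (Finset.sum_le_sum fun t _ => ?_)
  have : (onesCount l t z : ℝ) * c t 1 + ((letterCount l t : ℝ) - onesCount l t z) * c t 0 -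
      N * (μ t * (w t * c t 1 + (1 - w t) * c t 0)) =
      N * (((onesCount l t z : ℝ) / N - μ t * w t) * c t 1 +
        (((letterCount l t : ℝ) / N - μ t) - ((onesCount l t z : ℝ) / N - μ t * w t)) * c t 0) := by
    field_simp
    ring
  rw [this, abs_mul, abs_of_pos hN']
  refine mul_le_mul_of_nonneg_left ?_ hN'.le
  refine (abs_add_le _ _).trans ?_
  rw [abs_mul, abs_mul, mul_add]
  refine add_le_add (mul_le_mul_of_nonneg_right (h2 t) (abs_nonneg _)) ?_
  rw [← mul_assoc]
  refine mul_le_mul_of_nonneg_right ((abs_sub _ _).trans ?_) (abs_nonneg _)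
  linarith [h1 t, h2 t]

/-- There are at least `exp (N E) / 2` vectors of positive weight and cost at most `N C`, if some
parameters have entropy more than `E` and cost less than `C`. -/
theorem exists_le_card {p : T → I} {μ w : T → ℝ} (c : T → ZMod 2 → ℝ) (hw : w ∈ compatible p)
    {E C : ℝ} (hE : E < ent μ w) (hC : linCost c μ w < C) :
    ∃ δ > 0, ∃ N₀ : ℕ, ∀ {ι : Type} [Fintype ι] [DecidableEq ι] (l : ι → T) (N : ℕ), N₀ ≤ N →
      Fintype.card ι ≤ 2 * N → (∀ t, |(letterCount l t : ℝ) / N - μ t| ≤ δ) →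
      Real.exp (N * E) / 2 ≤ ((Finset.univ.filter fun z : ι → ZMod 2 =>
        letterWeight p l z ≠ 0 ∧ ∑ i, c (l i) (z i) ≤ N * C).card : ℝ) := by
  set c' : T → ZMod 2 → ℝ := fun t b => Real.log (bitProb (w t) b) with hc'
  set B : ℝ := ∑ t, (|c t 1| + 2 * |c t 0|) with hB
  set B' : ℝ := ∑ t, (|c' t 1| + 2 * |c' t 0|) with hB'
  have hB0 : 0 ≤ B := by positivity
  have hB0' : 0 ≤ B' := by positivity
  -- The tolerance on types keeps both linear functionals, the cost `c` and the log-probability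
  -- `c'`, within their margins.
  obtain ⟨κ, hκ, hκB, hκB'⟩ : ∃ κ > 0, κ * B ≤ C - linCost c μ w ∧ κ * B' ≤ ent μ w - E := by
    refine ⟨min ((C - linCost c μ w) / (B + 1)) ((ent μ w - E) / (B' + 1)),
      lt_min (div_pos (by linarith) (by linarith)) (div_pos (by linarith) (by linarith)), ?_, ?_⟩
    · refine (mul_le_mul_of_nonneg_right (min_le_left _ _) hB0).trans ?_
      rw [div_mul_eq_mul_div, div_le_iff₀ (by linarith)]
      exact mul_le_mul_of_nonneg_left (by linarith) (by linarith)
    · refine (mul_le_mul_of_nonneg_right (min_le_right _ _) hB0').trans ?_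
      rw [div_mul_eq_mul_div, div_le_iff₀ (by linarith)]
      exact mul_le_mul_of_nonneg_left (by linarith) (by linarith)
  -- Chebyshev's inequality gives mass at most `8 / (N κ²)` to a deviation at one letter, since
  -- there are at most `2 N` positions; the bound on `N` brings the sum over the letters to at most
  -- `1 / 2`.
  obtain ⟨N₀, hN₀⟩ := exists_nat_gt (16 * Fintype.card T / κ ^ 2)
  refine ⟨κ / 2, by positivity, N₀ + 1, fun {ι} _ _ l N hN hcard hl => ?_⟩
  have hN' : (0 : ℝ) < N := by exact_mod_cast (show 0 < N by omega)
  have hNN : (N₀ : ℝ) ≤ N := by exact_mod_cast (show N₀ ≤ N by omega)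
  set M : (ι → ZMod 2) → ℝ := fun z => ∏ i, bitProb (w (l i)) (z i) with hM
  have hMnn : ∀ z, 0 ≤ M z := fun z => Finset.prod_nonneg fun i _ => bitProb_nonneg (hw _).1 _
  set J : T → Finset ι := fun t => Finset.univ.filter fun i => l i = t with hJ
  have hones : ∀ t (z : ι → ZMod 2), ∑ i ∈ J t, (bitVal (z i) - w (l i)) =
      onesCount l t z - letterCount l t * w t := by
    intro t z
    rw [Finset.sum_sub_distrib]
    congr 1
    · simp only [bitVal, hJ]
      rw [Finset.sum_boole, Finset.filter_filter, onesCount]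
    · rw [Finset.sum_congr rfl (g := fun _ => w t) fun i hi => by
        rw [(Finset.mem_filter.1 hi).2]]
      simp [hJ, letterCount]
  set bad : T → Finset (ι → ZMod 2) := fun t => Finset.univ.filter fun z =>
    N * (κ / 2) ≤ |∑ i ∈ J t, (bitVal (z i) - w (l i))| with hbad
  have hbadM : ∀ t, ∑ z ∈ bad t, M z ≤ 8 / (N * κ ^ 2) := by
    intro t
    refine (sum_prod_bitProb_deviation_le (fun i => w (l i)) (fun i => (hw _).1) (J t)
      (c := N * (κ / 2)) (by positivity)).trans ?_
    have : ((J t).card : ℝ) ≤ 2 * N := by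
      exact_mod_cast (Finset.card_le_univ _).trans hcard
    rw [div_le_div_iff₀ (by positivity) (by positivity)]
    nlinarith [mul_le_mul_of_nonneg_right this (by positivity : (0 : ℝ) ≤ N * κ ^ 2)]
  set good : Finset (ι → ZMod 2) := Finset.univ.filter fun z => ∀ t, z ∉ bad t with hgood
  have hgoodM : 1 / 2 ≤ ∑ z ∈ good, M z := by
    have htot : ∑ z, M z = 1 := sum_prod_bitProb fun i => w (l i)
    have hsplit := Finset.sum_filter_add_sum_filter_not Finset.univ (fun z => ∀ t, z ∉ bad t) M
    have hrest : ∑ z : ι → ZMod 2 with ¬ ∀ t, z ∉ bad t, M z ≤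
        Fintype.card T * (8 / (N * κ ^ 2)) := by
      calc _ ≤ ∑ z : ι → ZMod 2 with ¬ ∀ t, z ∉ bad t, ∑ t, if z ∈ bad t then M z else 0 := by
            refine Finset.sum_le_sum fun z hz => ?_
            obtain ⟨t, ht⟩ := not_forall.1 (Finset.mem_filter.1 hz).2
            rw [not_not] at ht
            refine le_trans (by rw [if_pos ht]) (Finset.single_le_sum
              (f := fun t => if z ∈ bad t then M z else 0) (fun t _ => ?_) (Finset.mem_univ t))
            split_ifs <;> simp [hMnn z]
        _ ≤ ∑ z, ∑ t, if z ∈ bad t then M z else 0 :=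
            Finset.sum_le_sum_of_subset_of_nonneg (Finset.filter_subset _ _) fun z _ _ =>
              Finset.sum_nonneg fun t _ => by split_ifs <;> simp [hMnn z]
        _ = ∑ t, ∑ z ∈ bad t, M z := by
            rw [Finset.sum_comm]
            simp
        _ ≤ ∑ _t : T, 8 / (N * κ ^ 2) := Finset.sum_le_sum fun t _ => hbadM t
        _ = _ := by simp
    have : (Fintype.card T : ℝ) * (8 / (N * κ ^ 2)) ≤ 1 / 2 := by
      have h1 := hN₀.le.trans hNN
      rw [div_le_iff₀ (by positivity)] at h1
      rw [mul_div_assoc', div_le_div_iff₀ (by positivity) (by positivity)]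
      linarith
    linarith
  have htype : ∀ z ∈ good, ∀ t, |(onesCount l t z : ℝ) / N - μ t * w t| ≤ κ := by
    intro z hz t
    have h1 := (Finset.mem_filter.1 hz).2 t
    simp only [hbad, Finset.mem_filter, Finset.mem_univ, true_and, not_le, hones] at h1
    have h2 : |(onesCount l t z : ℝ) / N - letterCount l t / N * w t| ≤ κ / 2 := by
      rw [show (onesCount l t z : ℝ) / N - letterCount l t / N * w t =
        (onesCount l t z - letterCount l t * w t) / N by ring, abs_div, abs_of_pos hN',
        div_le_iff₀ hN']
      linarith
    have h3 : |(letterCount l t : ℝ) / N * w t - μ t * w t| ≤ κ / 2 := by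
      rw [← sub_mul, abs_mul, abs_of_nonneg (hw t).1.1]
      exact (mul_le_of_le_one_right (abs_nonneg _) (hw t).1.2).trans (hl t)
    calc _ ≤ _ := abs_sub_le _ ((letterCount l t : ℝ) / N * w t) _
      _ ≤ _ := by linarith
  have hl' : ∀ t, |(letterCount l t : ℝ) / N - μ t| ≤ κ := fun t => (hl t).trans (by linarith)
  have hmem : ∀ z ∈ good, M z ≠ 0 → letterWeight p l z ≠ 0 ∧ ∑ i, c (l i) (z i) ≤ N * C := by
    intro z hz hMz
    refine ⟨Finset.prod_ne_zero_iff.2 fun i hi =>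
      bitProb_ne_zero_of_compatible hw (Finset.prod_ne_zero_iff.1 hMz i hi), ?_⟩
    have := (abs_le.1 (abs_sum_sub_linCost_le c (by omega : 0 < N) hl' (htype z hz))).2
    nlinarith
  -- Each typical vector has mass at most `exp (-N E)`, so it takes at least `exp (N E) / 2` of them
  -- to carry mass `1 / 2`. Those of mass zero, whose weight may vanish, are dropped in `hsum`.
  have hMle : ∀ z ∈ good, M z ≤ Real.exp (-(N * E)) := by
    intro z hz
    by_cases hMz : M z = 0
    · rw [hMz]; exact (Real.exp_pos _).le
    rw [← Real.log_le_iff_le_exp (lt_of_le_of_ne (hMnn z) (Ne.symm hMz)), hM,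
      Real.log_prod fun i hi => Finset.prod_ne_zero_iff.1 hMz i hi]
    have := (abs_le.1 (abs_sum_sub_linCost_le c' (by omega : 0 < N) hl' (htype z hz))).2
    rw [hc', linCost_log_bitProb] at this
    nlinarith
  have hsum : ∑ z ∈ good, M z ≤ ((Finset.univ.filter fun z : ι → ZMod 2 =>
        letterWeight p l z ≠ 0 ∧ ∑ i, c (l i) (z i) ≤ N * C).card : ℝ) * Real.exp (-(N * E)) := by
    rw [← nsmul_eq_mul, ← Finset.sum_const]
    calc ∑ z ∈ good, M z = ∑ z ∈ good with M z ≠ 0, M z := (Finset.sum_filter_ne_zero _).symm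
      _ ≤ ∑ z ∈ good with M z ≠ 0, Real.exp (-(N * E)) :=
          Finset.sum_le_sum fun z hz => hMle z (Finset.mem_filter.1 hz).1
      _ ≤ _ := Finset.sum_le_sum_of_subset_of_nonneg (fun z hz => by
            rw [Finset.mem_filter] at hz ⊢
            exact ⟨Finset.mem_univ _, hmem z hz.1 hz.2⟩) fun _ _ _ => (Real.exp_pos _).le
  have := hgoodM.trans hsum
  rw [Real.exp_neg, ← div_eq_mul_inv, le_div_iff₀ (Real.exp_pos _)] at this
  linarith

/-- The number of vectors whose type is close to `(μ, w₀)`. -/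
theorem exists_card_type_le {p : T → I} {μ w₀ : T → ℝ} (hμ : ∀ t, 0 < μ t) {E : ℝ}
    (hE : ent μ w₀ < E) :
    ∃ δ > 0, ∀ {ι : Type} [Fintype ι] (l : ι → T) (N : ℕ), 0 < N →
      (∀ t, |(letterCount l t : ℝ) / N - μ t| ≤ δ) → ∀ A : Finset (ι → ZMod 2),
      (∀ z ∈ A, letterWeight p l z ≠ 0) →
      (∀ z ∈ A, ∀ t, |(onesCount l t z : ℝ) / N - μ t * w₀ t| ≤ δ) →
      (A.card : ℝ) ≤ Real.exp (N * E) := by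
  -- Two linear constraints of opposite sign per letter fix `μ t * w t`, and hence `w t` because `μ
  -- t > 0`.
  set a : T × Bool → T → ZMod 2 → ℝ := fun j t b =>
    (if t = j.1 then bitVal b else 0) * (if j.2 then 1 else -1) with ha
  have hlin : ∀ j w, linCost (a j) μ w = μ j.1 * w j.1 * (if j.2 then 1 else -1) := by
    intro j w
    rw [linCost, Finset.sum_eq_single j.1]
    · simp [ha]
    · intro t _ ht; simp [ha, ht]
    · simp
  have hsum : ∀ {ι : Type} [Fintype ι] (l : ι → T) (z : ι → ZMod 2) j, ∑ i, a j (l i) (z i) =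
      onesCount l j.1 z * (if j.2 then 1 else -1) := by
    intro ι _ l z j
    rw [sum_comp_letter_bit, Finset.sum_eq_single j.1]
    · simp [ha]
    · intro t _ ht; simp [ha, ht]
    · simp
  obtain ⟨δ, hδ, h⟩ := exists_card_le p μ a (fun j => linCost (a j) μ w₀) E (fun w _ hj => by
    have : w = w₀ := by
      funext t
      have h1 := hj (t, true)
      have h2 := hj (t, false)
      rw [hlin, hlin] at h1 h2
      simp only [if_true, Bool.false_eq_true, if_false] at h1 h2
      exact mul_left_cancel₀ (hμ t).ne' (by linarith)
    rwa [this])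
  refine ⟨δ, hδ, fun {ι} _ l N hN hl A hA ht => ?_⟩
  have hN' : (0 : ℝ) < N := by exact_mod_cast hN
  refine (h l N hN hl A hA fun z hz j => ?_).trans (Real.exp_le_exp.2 (by nlinarith))
  have h1 := abs_le.1 (ht z hz j.1)
  have h2 : (onesCount l j.1 z : ℝ) = N * (onesCount l j.1 z / N) := by field_simp
  rw [hsum, hlin, h2, mul_assoc]
  refine mul_le_mul_of_nonneg_left ?_ hN'.le
  split_ifs <;> linarith

/-- The vectors that satisfy a cost constraint and whose type is far from the unique minimizer
are exponentially few. -/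
theorem exists_card_atypical_le {p : T → I} {μ w₀ : T → ℝ} {c : T → ZMod 2 → ℝ} {C E : ℝ}
    (huniq : ∀ w ∈ compatible p, E ≤ ent μ w → linCost c μ w ≤ C → w = w₀)
    {ε : ℝ} (hε : 0 < ε) :
    ∃ δ > 0, ∀ {ι : Type} [Fintype ι] (l : ι → T) (N : ℕ), 0 < N →
      (∀ t, |(letterCount l t : ℝ) / N - μ t| ≤ δ) → ∀ A : Finset (ι → ZMod 2),
      (∀ z ∈ A, letterWeight p l z ≠ 0) →
      (∀ z ∈ A, ∑ i, c (l i) (z i) ≤ N * (C + δ)) →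
      (∀ z ∈ A, ∃ t, ε ≤ |(onesCount l t z : ℝ) / N - μ t * w₀ t|) →
      (A.card : ℝ) ≤ 2 * Fintype.card T * Real.exp (N * (E - δ)) := by
  classical
  -- Opposite deviations could cancel in the average. The set is therefore split by letter and by
  -- sign into `2 |T|` pieces; on each one the deviation is a linear constraint and survives
  -- averaging.
  set sg : Bool → ℝ := fun s => if s then -1 else 1 with hsg
  set a : T × Bool → Bool → T → ZMod 2 → ℝ := fun j i => if i then c else fun t b =>
    (if t = j.1 then bitVal b else 0) * sg j.2 with ha
  set b : T × Bool → Bool → ℝ := fun j i => if i then C else μ j.1 * w₀ j.1 * sg j.2 - ε with hb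
  have hlin : ∀ j w, linCost (a j false) μ w = μ j.1 * w j.1 * sg j.2 := by
    intro j w
    rw [linCost, Finset.sum_eq_single j.1]
    · simp [ha]; ring
    · intro t _ ht; simp [ha, ht]
    · simp
  have hsum : ∀ {ι : Type} [Fintype ι] (l : ι → T) (z : ι → ZMod 2) j,
      ∑ i, a j false (l i) (z i) = onesCount l j.1 z * sg j.2 := by
    intro ι _ l z j
    rw [sum_comp_letter_bit, Finset.sum_eq_single j.1]
    · simp [ha]
    · intro t _ ht; simp [ha, ht]
    · simp
  have key := fun j => exists_card_le p μ (a j) (b j) E (fun w hw hj => by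
    by_contra hcon
    push Not at hcon
    have h1 := huniq w hw hcon (hj true)
    have h2 := hj false
    rw [hlin, h1] at h2
    simp only [hb, Bool.false_eq_true, if_false] at h2
    linarith)
  choose d hd hkey using key
  obtain ⟨δ, hδ, hδd⟩ := exists_pos_forall_le d hd
  refine ⟨δ, hδ, fun {ι} _ l N hN hl A hA hc ht => ?_⟩
  have hN' : (0 : ℝ) < N := by exact_mod_cast hN
  set A' : T × Bool → Finset (ι → ZMod 2) := fun j => A.filter fun z =>
    (onesCount l j.1 z : ℝ) * sg j.2 ≤ N * b j false with hA'
  have hsub : A ⊆ Finset.univ.biUnion A' := by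
    intro z hz
    obtain ⟨t, ht⟩ := ht z hz
    have h2 : (onesCount l t z : ℝ) = N * (onesCount l t z / N) := by field_simp
    simp only [Finset.mem_biUnion, Finset.mem_univ, true_and, hA', Finset.mem_filter]
    rcases le_abs'.1 ht with h | h
    · refine ⟨(t, false), hz, ?_⟩
      rw [h2, mul_assoc]
      refine mul_le_mul_of_nonneg_left ?_ hN'.le
      simp only [hsg, hb, Bool.false_eq_true, if_false]
      linarith
    · refine ⟨(t, true), hz, ?_⟩
      rw [h2, mul_assoc]
      refine mul_le_mul_of_nonneg_left ?_ hN'.le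
      simp only [hsg, hb, Bool.false_eq_true, if_false, if_true]
      linarith
  have hcard : ∀ j, ((A' j).card : ℝ) ≤ Real.exp (N * (E - δ)) := by
    intro j
    refine (hkey j l N hN (fun t => (hl t).trans (hδd j)) (A' j)
      (fun z hz => hA z (Finset.mem_filter.1 hz).1) (fun z hz i => ?_)).trans
      (Real.exp_le_exp.2 (mul_le_mul_of_nonneg_left (by linarith [hδd j]) hN'.le))
    cases i
    · rw [hsum]
      refine (Finset.mem_filter.1 hz).2.trans (mul_le_mul_of_nonneg_left ?_ hN'.le)
      linarith [hd j]
    · refine (hc z (Finset.mem_filter.1 hz).1).trans (mul_le_mul_of_nonneg_left ?_ hN'.le)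
      simp only [hb, if_true]
      linarith [hδd j]
  calc (A.card : ℝ) ≤ ∑ j, ((A' j).card : ℝ) := by
        exact_mod_cast (Finset.card_le_card hsub).trans Finset.card_biUnion_le
    _ ≤ ∑ _j : T × Bool, Real.exp (N * (E - δ)) := Finset.sum_le_sum fun j _ => hcard j
    _ = _ := by
        rw [Finset.sum_const, nsmul_eq_mul, Finset.card_univ, Fintype.card_prod, Fintype.card_bool]
        push_cast
        ring

end

end

section

/-! ### The encoder finds a typical codeword -/

theorem exists_nat_mul_exp_neg_le (C : ℝ) {δ η : ℝ} (hδ : 0 < δ) (hη : 0 < η) :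
    ∃ N₀ : ℕ, ∀ N : ℕ, N₀ ≤ N → C * Real.exp (-(N * δ)) ≤ η := by
  have h : Filter.Tendsto (fun N : ℕ => C * Real.exp (-(N * δ))) Filter.atTop (𝓝 (C * 0)) := by
    refine (Real.tendsto_exp_neg_atTop_nhds_zero.comp ?_).const_mul C
    exact tendsto_natCast_atTop_atTop.atTop_mul_const hδ
  rw [mul_zero] at h
  exact Filter.eventually_atTop.1 (h.eventually_le_const hη)

theorem exp_nat_mul_log_two (N : ℕ) : Real.exp (N * Real.log 2) = 2 ^ N := by
  rw [← Real.log_pow, Real.exp_log (by positivity)]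

section

variable {T : Type*} [Fintype T] [DecidableEq T]

/-- Vectors with zero codeword are never linked to a nonzero message and must be removed before the
second moment bound; they are few enough to be negligible. -/
theorem card_inl_eq_zero_le (k r : ℕ) :
    (Finset.univ.filter fun z : Fin (k + r) ⊕ Fin r → ZMod 2 => z ∘ Sum.inl = 0).card ≤
      2 ^ (k + r) := by
  calc _ ≤ (Finset.univ : Finset (Fin r → ZMod 2)).card := by
        refine Finset.card_le_card_of_injOn (fun z => z ∘ Sum.inr) (fun _ _ => Finset.mem_univ _) ?_
        intro z hz z' hz' h
        simp only [Finset.coe_filter, Finset.mem_univ, true_and, Set.mem_ofPred_eq] at hz hz'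
        exact funext (Sum.rec (congrFun (hz.trans hz'.symm)) (congrFun h))
    _ = 2 ^ r := by simp
    _ ≤ _ := Nat.pow_le_pow_right (by norm_num) (by omega)

/-- If the entropy constraint has slack, most matrices have a codeword of nearly minimal cost. -/
theorem exists_cheap_linked {p : T → I} {μ w₀ u : T → ℝ} (c : T → ZMod 2 → ℝ)
    (hμ : ∀ t, 0 ≤ μ t) (hw₀ : w₀ ∈ compatible p) (hfeas : Real.log 2 ≤ ent μ w₀)
    (hu : u ∈ compatible p) (hu2 : Real.log 2 < ent μ u) {δ₀ η : ℝ} (hδ₀ : 0 < δ₀) (hη : 0 < η) :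
    ∃ δ > 0, ∃ N₀ : ℕ, ∀ (k r : ℕ) (l : Fin (k + r) ⊕ Fin r → T), N₀ ≤ k + r →
      (∀ t, |(letterCount l t : ℝ) / (k + r : ℕ) - μ t| ≤ δ) → ∀ m : Fin k → ZMod 2, m ≠ 0 →
      ((Finset.univ.filter fun H => ¬ ∃ z, Linked H m z ∧ letterWeight p l z ≠ 0 ∧
        ∑ i, c (l i) (z i) ≤ (k + r : ℕ) * (linCost c μ w₀ + δ₀)).card : ℝ) ≤
        Fintype.card (GL (Fin (k + r)) (ZMod 2)) * η := by
  obtain ⟨w, hw, hwE, hwC⟩ := exists_strictly_feasible c hμ hw₀ hfeas hu hu2 hδ₀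
  -- Half of the entropy excess leaves at least `2^N * exp (N γ) / 2` cheap vectors.
  set γ := (ent μ w - Real.log 2) / 2 with hγ
  have hγ0 : 0 < γ := by rw [hγ]; linarith
  obtain ⟨δ, hδ, N₁, hN₁⟩ := exists_le_card c hw (E := Real.log 2 + γ) (by rw [hγ]; linarith) hwC
  -- `N₂` ensures `exp (N γ) / 2 ≥ 2 / η + 1`, so that `2^N * (2 / η)` vectors remain after at most
  -- `2^N` are removed; `N₃` ensures `1 / (2^N - 2) ≤ η / 2`.
  obtain ⟨N₂, hN₂⟩ := exists_nat_mul_exp_neg_le (2 * (2 / η + 1)) hγ0 one_pos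
  obtain ⟨N₃, hN₃⟩ := pow_unbounded_of_one_lt (2 / η + 2) (one_lt_two (α := ℝ))
  refine ⟨δ, hδ, max (max N₁ N₂) (max N₃ 2), fun k r l hN hl m hm => ?_⟩
  simp only [max_le_iff] at hN
  obtain ⟨⟨hk1, hk2⟩, hk3, hk4⟩ := hN
  set A := Finset.univ.filter fun z : Fin (k + r) ⊕ Fin r → ZMod 2 =>
    letterWeight p l z ≠ 0 ∧ ∑ i, c (l i) (z i) ≤ (k + r : ℕ) * (linCost c μ w₀ + δ₀) with hA
  have hAcard : Real.exp ((k + r : ℕ) * (Real.log 2 + γ)) / 2 ≤ (A.card : ℝ) :=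
    hN₁ l (k + r) hk1 (by simp; omega) hl
  set A' := A.filter fun z => z ∘ Sum.inl ≠ 0 with hA'
  have hsplit : (A.card : ℝ) ≤ A'.card + 2 ^ (k + r) := by
    have h1 := Finset.card_filter_add_card_filter_not (s := A) (fun z => z ∘ Sum.inl = 0)
    have h2 : (A.filter fun z => z ∘ Sum.inl = 0).card ≤ 2 ^ (k + r) :=
      (Finset.card_le_card (Finset.filter_subset_filter _ (Finset.subset_univ _))).trans
        (card_inl_eq_zero_le k r)
    have : A.card ≤ A'.card + 2 ^ (k + r) := by simp only [hA', Ne]; omega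
    exact_mod_cast this
  have hpow : (0 : ℝ) < 2 ^ (k + r) := by positivity
  have hexp : 2 * (2 / η + 1) ≤ Real.exp ((k + r : ℕ) * γ) := by
    have := hN₂ (k + r) hk2
    rwa [Real.exp_neg, ← div_eq_mul_inv, div_le_one (Real.exp_pos _)] at this
  have hA'card : 2 ^ (k + r) * (2 / η) ≤ (A'.card : ℝ) := by
    rw [mul_add, Real.exp_add, exp_nat_mul_log_two] at hAcard
    have : 2 ^ (k + r) * (2 * (2 / η + 1)) ≤ 2 ^ (k + r) * Real.exp ((k + r : ℕ) * γ) :=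
      mul_le_mul_of_nonneg_left hexp hpow.le
    linarith
  have hA'pos : (0 : ℝ) < A'.card := lt_of_lt_of_le (by positivity) hA'card
  have h2N : 2 / η + 2 ≤ 2 ^ (k + r) := hN₃.le.trans (pow_le_pow_right₀ one_le_two hk3)
  have hsecond := card_not_exists_linked_le hm hk4 A' (fun z hz => (Finset.mem_filter.1 hz).2)
    (Finset.card_pos.1 (by exact_mod_cast hA'pos))
  refine le_trans ?_ (hsecond.trans (mul_le_mul_of_nonneg_left ?_ (Nat.cast_nonneg _)))
  · refine Nat.cast_le.2 (Finset.card_le_card fun H hH => ?_)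
    rw [Finset.mem_filter] at hH ⊢
    refine ⟨hH.1, fun ⟨z, hz, hlz⟩ => hH.2 ⟨z, hlz, ?_⟩⟩
    exact (Finset.mem_filter.1 (Finset.mem_filter.1 hz).1).2
  · have h1 : ((2 : ℝ) ^ (k + r) - 1) / A'.card ≤ η / 2 := by
      rw [div_le_iff₀ hA'pos]
      have : η / 2 * (2 ^ (k + r) * (2 / η)) ≤ η / 2 * A'.card :=
        mul_le_mul_of_nonneg_left hA'card (by positivity)
      have h3 : η / 2 * (2 ^ (k + r) * (2 / η)) = 2 ^ (k + r) := by field_simp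
      linarith
    have h2 : 1 / ((2 : ℝ) ^ (k + r) - 2) ≤ η / 2 := by
      rw [div_le_iff₀ (by linarith [show 0 < 2 / η by positivity])]
      have : η / 2 * (2 / η) ≤ η / 2 * (2 ^ (k + r) - 2) :=
        mul_le_mul_of_nonneg_left (by linarith) (by positivity)
      have h3 : η / 2 * (2 / η) = 1 := by field_simp
      linarith
    linarith

/-- For the matrix `H` there is a codeword with message `m` of positive weight, and every such
codeword of maximal weight has a type close to `(μ, w₀)`. -/
def EncoderGood (p : T → I) (μ w₀ : T → ℝ) (ε : ℝ) {k r : ℕ} (l : Fin (k + r) ⊕ Fin r → T)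
    (m : Fin k → ZMod 2) (H : GL (Fin (k + r)) (ZMod 2)) : Prop :=
  (∃ z, Linked H m z ∧ letterWeight p l z ≠ 0) ∧
    ∀ z, Linked H m z → (∀ z', Linked H m z' → letterWeight p l z' ≤ letterWeight p l z) →
      ∀ t, |(onesCount l t z : ℝ) / (k + r : ℕ) - μ t * w₀ t| < ε

-- The maximizer is at least as cheap as any codeword of positive weight, and the cheap atypical
-- vectors are too few to be linked. The cost `c` need not be the log-weight: it is enough that it
-- does not increase when the weight grows. It is `natCost` in general and zero when only one type
-- is feasible. `Q` restricts the labellings for which cheap codewords are known to exist.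
open Classical in
theorem encoderGood_of_cheap {p : T → I} {μ w₀ : T → ℝ} {c : T → ZMod 2 → ℝ}
    (huniq : ∀ w ∈ compatible p, Real.log 2 ≤ ent μ w → linCost c μ w ≤ linCost c μ w₀ → w = w₀)
    (hmono : ∀ {k r : ℕ} (l : Fin (k + r) ⊕ Fin r → T) (z z'), letterWeight p l z ≠ 0 →
      letterWeight p l z ≤ letterWeight p l z' → ∑ i, c (l i) (z' i) ≤ ∑ i, c (l i) (z i))
    (Q : ∀ {k r : ℕ}, (Fin (k + r) ⊕ Fin r → T) → Prop)
    (hcheap : ∀ δ₀ > 0, ∀ η > 0, ∃ δ > 0, ∃ N₀ : ℕ, ∀ (k r : ℕ) (l : Fin (k + r) ⊕ Fin r → T),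
      Q l → N₀ ≤ k + r → (∀ t, |(letterCount l t : ℝ) / (k + r : ℕ) - μ t| ≤ δ) →
      ∀ m : Fin k → ZMod 2, m ≠ 0 →
      ((Finset.univ.filter fun H => ¬ ∃ z, Linked H m z ∧ letterWeight p l z ≠ 0 ∧
        ∑ i, c (l i) (z i) ≤ (k + r : ℕ) * (linCost c μ w₀ + δ₀)).card : ℝ) ≤
        Fintype.card (GL (Fin (k + r)) (ZMod 2)) * η)
    {ε η : ℝ} (hε : 0 < ε) (hη : 0 < η) :
    ∃ δ > 0, ∃ N₀ : ℕ, ∀ (k r : ℕ) (l : Fin (k + r) ⊕ Fin r → T), Q l → N₀ ≤ k + r →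
      (∀ t, |(letterCount l t : ℝ) / (k + r : ℕ) - μ t| ≤ δ) → ∀ m : Fin k → ZMod 2, m ≠ 0 →
      ((Finset.univ.filter fun H => ¬ EncoderGood p μ w₀ ε l m H).card : ℝ) ≤
        Fintype.card (GL (Fin (k + r)) (ZMod 2)) * η := by
  obtain ⟨δ₁, hδ₁, hcard⟩ := exists_card_atypical_le huniq hε
  obtain ⟨δ₂, hδ₂, N₂, hex⟩ := hcheap δ₁ hδ₁ (η / 2) (by positivity)
  -- There are at most `2 |T| 2^N exp (-N δ₁)` atypical vectors, to be compared with `2^N - 1 ≥ 2^N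
  -- / 2`; hence the factor `4`.
  obtain ⟨N₃, hN₃⟩ := exists_nat_mul_exp_neg_le (4 * Fintype.card T) hδ₁ (half_pos hη)
  refine ⟨min δ₁ δ₂, lt_min hδ₁ hδ₂, max N₂ (max N₃ 1), fun k r l hQ hN hl m hm => ?_⟩
  simp only [max_le_iff] at hN
  obtain ⟨hk2, hk3, hk1⟩ := hN
  set g : ℝ := (Fintype.card (GL (Fin (k + r)) (ZMod 2)) : ℝ) with hg
  have hg0 : 0 ≤ g := Nat.cast_nonneg _
  set A := Finset.univ.filter fun z : Fin (k + r) ⊕ Fin r → ZMod 2 =>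
    letterWeight p l z ≠ 0 ∧ ∑ i, c (l i) (z i) ≤ (k + r : ℕ) * (linCost c μ w₀ + δ₁) ∧
      ∃ t, ε ≤ |(onesCount l t z : ℝ) / (k + r : ℕ) - μ t * w₀ t| with hA
  have hAc : (A.card : ℝ) ≤ 2 * Fintype.card T * Real.exp ((k + r : ℕ) * (Real.log 2 - δ₁)) :=
    hcard l (k + r) hk1 (fun t => (hl t).trans (min_le_left _ _)) A
      (fun z hz => (Finset.mem_filter.1 hz).2.1) (fun z hz => (Finset.mem_filter.1 hz).2.2.1)
      (fun z hz => (Finset.mem_filter.1 hz).2.2.2)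
  have h1 := hex k r l hQ hk2 (fun t => (hl t).trans (min_le_right _ _)) m hm
  have h2 : ((Finset.univ.filter fun H => ∃ z ∈ A, Linked H m z).card : ℝ) ≤ g * (η / 2) := by
    have hpowN : 2 ≤ 2 ^ (k + r) := by
      calc 2 = 2 ^ 1 := by norm_num
        _ ≤ _ := Nat.pow_le_pow_right (by norm_num) hk1
    have hpow : (2 : ℝ) ≤ 2 ^ (k + r) := by exact_mod_cast hpowN
    have h3 : ((Finset.univ.filter fun H => ∃ z ∈ A, Linked H m z).card : ℝ) * (2 ^ (k + r) - 1) ≤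
        A.card * g := by
      have := Nat.cast_le (α := ℝ).2 (card_exists_linked_le hm A)
      push_cast [Nat.cast_sub (show 1 ≤ 2 ^ (k + r) by omega)] at this
      exact this
    have h4 : (A.card : ℝ) ≤ (2 ^ (k + r) - 1) * (η / 2) := by
      have h5 := hN₃ (k + r) hk3
      rw [mul_sub, Real.exp_sub, exp_nat_mul_log_two] at hAc
      rw [Real.exp_neg, ← div_eq_mul_inv] at h5
      calc (A.card : ℝ) ≤ 2 * Fintype.card T * (2 ^ (k + r) / Real.exp ((k + r : ℕ) * δ₁)) := hAc
        _ = 2 ^ (k + r) / 2 * (4 * Fintype.card T / Real.exp ((k + r : ℕ) * δ₁)) := by ring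
        _ ≤ 2 ^ (k + r) / 2 * (η / 2) := mul_le_mul_of_nonneg_left h5 (by positivity)
        _ ≤ _ := mul_le_mul_of_nonneg_right (by linarith) (by positivity)
    have h5 : ((Finset.univ.filter fun H => ∃ z ∈ A, Linked H m z).card : ℝ) * (2 ^ (k + r) - 1) ≤
        g * (η / 2) * (2 ^ (k + r) - 1) := by
      refine h3.trans ((mul_le_mul_of_nonneg_right h4 hg0).trans (le_of_eq (by ring)))
    exact le_of_mul_le_mul_right h5 (by linarith)
  have hsub : (Finset.univ.filter fun H => ¬ EncoderGood p μ w₀ ε l m H) ⊆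
      (Finset.univ.filter fun H => ¬ ∃ z, Linked H m z ∧ letterWeight p l z ≠ 0 ∧
        ∑ i, c (l i) (z i) ≤ (k + r : ℕ) * (linCost c μ w₀ + δ₁)) ∪
      (Finset.univ.filter fun H => ∃ z ∈ A, Linked H m z) := by
    intro H hH
    rw [Finset.mem_union, Finset.mem_filter, Finset.mem_filter]
    by_contra hcon
    simp only [Finset.mem_univ, true_and, not_or, not_not] at hcon
    obtain ⟨⟨z₀, hz₀, hw, hc⟩, hno⟩ := hcon
    refine (Finset.mem_filter.1 hH).2 ⟨⟨z₀, hz₀, hw⟩, fun z hz hmax t => ?_⟩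
    by_contra ht
    rw [not_lt] at ht
    have hle := hmax z₀ hz₀
    refine hno ⟨z, Finset.mem_filter.2 ⟨Finset.mem_univ _, (sum_natCost_le hw hle).1,
      (hmono l z₀ z hw hle).trans hc, t, ht⟩, hz⟩
  have h3 : ((Finset.univ.filter fun H => ¬ EncoderGood p μ w₀ ε l m H).card : ℝ) ≤
      ((Finset.univ.filter fun H => ¬ ∃ z, Linked H m z ∧ letterWeight p l z ≠ 0 ∧
        ∑ i, c (l i) (z i) ≤ (k + r : ℕ) * (linCost c μ w₀ + δ₁)).card : ℝ) +
      ((Finset.univ.filter fun H => ∃ z ∈ A, Linked H m z).card : ℝ) := by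
    exact_mod_cast (Finset.card_le_card hsub).trans (Finset.card_union_le _ _)
  have h1' : ((Finset.univ.filter fun H => ¬ ∃ z, Linked H m z ∧ letterWeight p l z ≠ 0 ∧
        ∑ i, c (l i) (z i) ≤ (k + r : ℕ) * (linCost c μ w₀ + δ₁)).card : ℝ) ≤ g * (η / 2) := by
    convert h1 using 3
  linarith

end

/-- Forced parity bits carry no entropy and the codeword letters have total mass `1`, so entropy
`log 2` is reached only if all codeword bits are uniform. -/
theorem eq_of_all_parity_forced {A B : Type*} [Fintype A] [Fintype B] {p : A ⊕ B → I}
    {μ w w' : A ⊕ B → ℝ} (hμ : ∀ t, 0 < μ t) (hsum : ∑ a, μ (Sum.inl a) = 1)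
    (hB : ∀ b, p (Sum.inr b) = 0 ∨ p (Sum.inr b) = 1)
    (hw : w ∈ compatible p) (hw2 : Real.log 2 ≤ ent μ w)
    (hw' : w' ∈ compatible p) (hw2' : Real.log 2 ≤ ent μ w') : w = w' := by
  have key : ∀ w ∈ compatible p, Real.log 2 ≤ ent μ w → ∀ a, w (Sum.inl a) = 2⁻¹ := by
    intro w hw hw2 a
    rw [← Real.binEntropy_eq_log_two]
    by_contra hne
    have h0 : ∀ b, Real.binEntropy (w (Sum.inr b)) = 0 := by
      intro b
      rcases hB b with h | h
      · rw [(hw _).2.1 h, Real.binEntropy_zero]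
      · rw [(hw _).2.2 h, Real.binEntropy_one]
    have : ent μ w < Real.log 2 := by
      unfold ent
      rw [Fintype.sum_sum_type]
      simp only [h0, mul_zero, Finset.sum_const_zero, add_zero]
      calc ∑ a, μ (Sum.inl a) * Real.binEntropy (w (Sum.inl a))
          < ∑ a, μ (Sum.inl a) * Real.log 2 :=
            Finset.sum_lt_sum (fun a _ => mul_le_mul_of_nonneg_left Real.binEntropy_le_log_two
              (hμ _).le) ⟨a, Finset.mem_univ a, mul_lt_mul_of_pos_left
                (lt_of_le_of_ne Real.binEntropy_le_log_two hne) (hμ _)⟩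
        _ = _ := by rw [← Finset.sum_mul, hsum, one_mul]
    linarith
  funext t
  rcases t with a | b
  · rw [key w hw hw2, key w' hw' hw2']
  · rcases hB b with h | h
    · rw [(hw _).2.1 h, (hw' _).2.1 h]
    · rw [(hw _).2.2 h, (hw' _).2.2 h]

open Classical in
/-- The encoder selects a typical codeword with high probability. -/
theorem exists_encoderGood {A B : Type*} [Fintype A] [Fintype B] [DecidableEq A] [DecidableEq B]
    {p : A ⊕ B → I}
    {μ w₀ : A ⊕ B → ℝ} (hμ : ∀ t, 0 < μ t) (hw₀ : w₀ ∈ compatible p)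
    (hfeas : Real.log 2 ≤ ent μ w₀)
    (huniq : ∀ w ∈ compatible p, Real.log 2 ≤ ent μ w →
      linCost (natCost p) μ w ≤ linCost (natCost p) μ w₀ → w = w₀)
    (hslack : (∃ u ∈ compatible p, Real.log 2 < ent μ u) ∨
      ((∀ a, p (Sum.inl a) ≠ 0 ∧ p (Sum.inl a) ≠ 1) ∧
        (∀ b, p (Sum.inr b) = 0 ∨ p (Sum.inr b) = 1) ∧ ∑ a, μ (Sum.inl a) = 1))
    {ε η : ℝ} (hε : 0 < ε) (hη : 0 < η) :
    ∃ δ > 0, ∃ N₀ : ℕ, ∀ (k r : ℕ) (s : Fin (k + r) → A) (q : Fin r → B), N₀ ≤ k + r →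
      (∀ t, |(letterCount (Sum.map s q) t : ℝ) / (k + r : ℕ) - μ t| ≤ δ) →
      ∀ m : Fin k → ZMod 2, m ≠ 0 →
      ((Finset.univ.filter fun H => ¬ EncoderGood p μ w₀ ε (Sum.map s q) m H).card : ℝ) ≤
        Fintype.card (GL (Fin (k + r)) (ZMod 2)) * η := by
  rcases hslack with ⟨u, hu, hu2⟩ | ⟨hA, hB, hsum⟩
  · obtain ⟨δ, hδ, N₀, h⟩ := encoderGood_of_cheap huniq
      (fun l z z' h h' => (sum_natCost_le h h').2) (fun _ => True) (fun δ₀ hδ₀ η hη => by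
        obtain ⟨δ, hδ, N₀, h⟩ := exists_cheap_linked (natCost p) (fun t => (hμ t).le) hw₀ hfeas hu
          hu2 hδ₀ hη
        refine ⟨δ, hδ, N₀, fun k r l _ hN hl m hm => ?_⟩
        convert h k r l hN hl m hm using 3) hε hη
    exact ⟨δ, hδ, N₀, fun k r s q hN hl m hm => h k r _ trivial hN hl m hm⟩
  -- There is no slack for a second moment argument, but none is needed: for every `H`, the forced
  -- parity bits `v` and `x = H⁻¹ (m, v)` have positive weight, as no bit of `x` is forced. The zero
  -- cost suffices because a single type is feasible.
  · obtain ⟨δ, hδ, N₀, h⟩ := encoderGood_of_cheap (p := p) (μ := μ) (w₀ := w₀)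
      (c := fun _ _ => 0) (fun w hw hw2 _ => eq_of_all_parity_forced hμ hsum hB hw hw2 hw₀ hfeas)
      (fun l z z' _ _ => by simp)
      (fun {k r} l => ∃ (s : Fin (k + r) → A) (q : Fin r → B), l = Sum.map s q)
      (fun δ₀ hδ₀ η hη => by
        refine ⟨1, one_pos, 0, ?_⟩
        rintro k r l ⟨s, q, rfl⟩ - - m -
        rw [Finset.filter_eq_empty_iff.2, Finset.card_empty, Nat.cast_zero]
        · positivity
        rintro H -
        rw [not_not]
        set v : Fin r → ZMod 2 := fun j => if p (Sum.inr (q j)) = 1 then 1 else 0 with hv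
        refine ⟨Sum.elim ((H⁻¹).1 *ᵥ Fin.append m v) v, ?_, ?_, ?_⟩
        · rw [Linked, Sum.elim_comp_inl, Sum.elim_comp_inr, Matrix.mulVec_mulVec, ← Units.val_mul,
            mul_inv_cancel, Units.val_one, Matrix.one_mulVec]
        · refine Finset.prod_ne_zero_iff.2 ?_
          rintro (i | j) -
          · simp only [Sum.map_inl, Sum.elim_inl]
            unfold bitProb
            split_ifs
            · exact fun h => (hA (s i)).1 (Subtype.ext h)
            · exact fun h => (hA (s i)).2 (Subtype.ext (sub_eq_zero.1 h).symm)
          · simp only [Sum.map_inr, Sum.elim_inr, hv]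
            rcases hB (q j) with h | h <;> simp [h]
        · simp only [Finset.sum_const_zero]
          have : linCost (fun _ _ => 0) μ w₀ = 0 := by simp [linCost]
          rw [this]
          positivity)
      hε hη
    exact ⟨δ, hδ, N₀, fun k r s q hN hl m hm => h k r _ ⟨s, q, rfl⟩ hN hl m hm⟩

end

section

/-! ### The decoder's competitors -/

/-- Under the decoder inequality, few vectors beat a vector of type close to `(μ, w₀)`, and the zero
vector does not. -/
theorem exists_decoder_gap {T : Type*} [Fintype T] [DecidableEq T] {p : T → I} {μ w₀ : T → ℝ}
    {E : ℝ} (hdec : ∀ w ∈ compatible p, E ≤ ent μ w →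
      linCost (natCost p) μ w₀ < linCost (natCost p) μ w)
    (hzero : (∀ t, 0 < μ t → p t ≠ 1) →
      linCost (natCost p) μ w₀ < linCost (natCost p) μ 0) :
    ∃ γ > 0, ∃ δ > 0, ∀ {ι : Type} [Fintype ι] [DecidableEq ι] (l : ι → T) (N : ℕ), 0 < N →
      (∀ t, |(letterCount l t : ℝ) / N - μ t| ≤ δ) → ∀ z : ι → ZMod 2, letterWeight p l z ≠ 0 →
      (∀ t, |(onesCount l t z : ℝ) / N - μ t * w₀ t| ≤ δ) →
      ((Finset.univ.filter fun z' => letterWeight p l z ≤ letterWeight p l z').card : ℝ) ≤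
        Real.exp (N * (E - γ)) ∧ letterWeight p l 0 < letterWeight p l z := by
  set c := natCost p with hc
  set B : ℝ := ∑ t, (|c t 1| + 2 * |c t 0|) with hB
  have hB0 : 0 ≤ B := by positivity
  obtain ⟨δ₁, hδ₁, hcard⟩ := exists_card_le p μ (fun _ : Unit => c) (fun _ => linCost c μ w₀) E
    (fun w hw hj => by
      by_contra hcon
      push Not at hcon
      linarith [hdec w hw hcon, hj ()])
  -- Half of each positive mass: within this tolerance a letter of positive mass does occur in `l`.
  obtain ⟨δ₂, hδ₂, hδ₂t⟩ := exists_pos_forall_le (fun t => if 0 < μ t then μ t / 2 else 1)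
    (fun t => by split_ifs with h <;> [exact half_pos h; exact one_pos])
  -- The default `1` plays no role: if the inequality fails, `hzero` yields a letter of positive
  -- mass and bias `1`, and the zero vector has weight `0`.
  set d₀ : ℝ := if linCost c μ w₀ < linCost c μ 0 then linCost c μ 0 - linCost c μ w₀ else 1
    with hd₀
  have hd₀0 : 0 < d₀ := by
    rw [hd₀]
    split_ifs with h
    · linarith
    · exact one_pos
  -- The last bound has `d₀ / 2` because the cost error `N κ B` occurs twice, for `z` and for the
  -- zero vector.
  obtain ⟨κ, hκ, hκ1, hκ2, hκ3, hκ4⟩ : ∃ κ > 0, κ ≤ δ₁ ∧ κ ≤ δ₂ ∧ κ * B ≤ δ₁ ∧ κ * B < d₀ / 2 := by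
    refine ⟨min (min δ₁ δ₂) (min (δ₁ / (B + 1)) (d₀ / 4 / (B + 1))), by positivity,
      (min_le_left _ _).trans (min_le_left _ _), (min_le_left _ _).trans (min_le_right _ _), ?_, ?_⟩
    · refine (mul_le_mul_of_nonneg_right ((min_le_right _ _).trans (min_le_left _ _)) hB0).trans ?_
      rw [div_mul_eq_mul_div, div_le_iff₀ (by linarith)]
      exact mul_le_mul_of_nonneg_left (by linarith) hδ₁.le
    · refine (mul_le_mul_of_nonneg_right
        ((min_le_right _ _).trans (min_le_right _ _)) hB0).trans_lt ?_
      rw [div_mul_eq_mul_div, div_lt_iff₀ (by linarith)]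
      nlinarith
  refine ⟨δ₁, hδ₁, κ, hκ, fun {ι} _ _ l N hN hl z hz ht => ?_⟩
  have hN' : (0 : ℝ) < N := by exact_mod_cast hN
  have hcost := (abs_le.1 (abs_sum_sub_linCost_le c hN hl ht)).2
  refine ⟨hcard l N hN (fun t => (hl t).trans hκ1) _ (fun z' hz' => ?_) (fun z' hz' _ => ?_), ?_⟩
  · exact (sum_natCost_le hz (Finset.mem_filter.1 hz').2).1
  · have := (sum_natCost_le hz (Finset.mem_filter.1 hz').2).2
    rw [← hc] at this
    nlinarith
  · by_contra hcon
    push Not at hcon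
    obtain ⟨h0, hle⟩ := sum_natCost_le hz hcon
    have hp : ∀ t, 0 < μ t → p t ≠ 1 := by
      intro t hμt hpt
      have h1 := hδ₂t t
      rw [if_pos hμt] at h1
      have h2 : 0 < (letterCount l t : ℝ) / N := by linarith [(abs_le.1 (hl t)).1]
      have h3 : 0 < letterCount l t := by
        have := pos_of_mul_pos_left (h2.trans_eq (div_eq_mul_inv _ _)) (by positivity)
        exact_mod_cast this
      obtain ⟨i, hi⟩ := Finset.card_pos.1 h3
      refine Finset.prod_ne_zero_iff.1 h0 i (Finset.mem_univ i) ?_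
      rw [(Finset.mem_filter.1 hi).2, hpt]
      simp
    have hlt := hzero hp
    rw [hd₀, if_pos hlt] at hκ4
    have h0' := (abs_le.1 (abs_sum_sub_linCost_le c (μ := μ) (w := 0) (z := 0) hN hl
      (fun t => by simpa [onesCount] using hκ.le))).1
    rw [← hc] at hle
    nlinarith

open Classical in
/-- Union bound over the competitors in `D`. -/
theorem card_linked_and_exists_le {k r : ℕ} {m : Fin k → ZMod 2} (hm : m ≠ 0)
    (z : Fin (k + r) ⊕ Fin r → ZMod 2) (D : Finset (Fin (k + r) ⊕ Fin r → ZMod 2)) :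
    (Finset.univ.filter fun H => Linked H m z ∧ ∃ x, x ≠ 0 ∧ x ≠ z ∘ Sum.inl ∧
      Sum.elim x (parityBits H x) ∈ D).card * ((2 ^ (k + r) - 1) * (2 ^ (k + r) - 2)) ≤
      D.card * (2 ^ k * Fintype.card (GL (Fin (k + r)) (ZMod 2))) := by
  set D' := D.filter fun z' => z' ∘ Sum.inl ≠ 0 ∧ z' ∘ Sum.inl ≠ z ∘ Sum.inl with hD'
  have hsub : (Finset.univ.filter fun H => Linked H m z ∧ ∃ x, x ≠ 0 ∧ x ≠ z ∘ Sum.inl ∧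
      Sum.elim x (parityBits H x) ∈ D) ⊆ D'.biUnion fun z' => Finset.univ.filter fun H =>
        Linked H m z ∧ parityBits H (z' ∘ Sum.inl) = z' ∘ Sum.inr := by
    intro H hH
    obtain ⟨hl, x, hx, hxz, hxD⟩ := (Finset.mem_filter.1 hH).2
    refine Finset.mem_biUnion.2 ⟨_, Finset.mem_filter.2 ⟨hxD, ?_⟩,
      Finset.mem_filter.2 ⟨Finset.mem_univ _, hl, ?_⟩⟩
    · simpa using ⟨hx, hxz⟩
    · simp
  calc _ ≤ (∑ z' ∈ D', (Finset.univ.filter fun H =>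
        Linked H m z ∧ parityBits H (z' ∘ Sum.inl) = z' ∘ Sum.inr).card) *
          ((2 ^ (k + r) - 1) * (2 ^ (k + r) - 2)) :=
        Nat.mul_le_mul_right _ ((Finset.card_le_card hsub).trans Finset.card_biUnion_le)
    _ ≤ ∑ _z' ∈ D', 2 ^ k * Fintype.card (GL (Fin (k + r)) (ZMod 2)) := by
        rw [Finset.sum_mul]
        refine Finset.sum_le_sum fun z' hz' => ?_
        have h := (Finset.mem_filter.1 hz').2
        convert card_linked_and_parityBits_le hm z h.1 h.2 (z' ∘ Sum.inr) using 3
    _ ≤ _ := by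
        rw [Finset.sum_const, smul_eq_mul]
        exact Nat.mul_le_mul_right _ (Finset.card_le_card (Finset.filter_subset _ _))

open Classical in
/-- A union bound over the possible values of `z g` for a uniform random `g`. -/
theorem uniform_bind_le {G Z O Ω : Type*} [Fintype G] [Nonempty G] (F : G → PMF Ω) (s : Set Ω)
    (bad : Set G) (z : G → Z) (typ : Finset Z) (P : Z → PMF O) (K : G → Z → Set O)
    {η : ℝ≥0∞} {β : ℝ}
    (hF : ∀ g ∉ bad, z g ∈ typ ∧ (F g).toOuterMeasure s ≤ η + (P (z g)).toOuterMeasure (K g (z g)))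
    (hK : ∀ a ∈ typ, ∀ y, ((Finset.univ.filter fun g => y ∈ K g a).card : ℝ) ≤
      Fintype.card G * β) :
    ((PMF.uniformOfFintype G).bind F).toOuterMeasure s ≤
      (PMF.uniformOfFintype G).toOuterMeasure bad + η + typ.card * ENNReal.ofReal β := by
  set u := PMF.uniformOfFintype G with hu
  -- Summing over all `a ∈ typ` removes the dependence of `z g` on `g`. The law `P a` of `y` is then
  -- independent of `g`, so the sums can be exchanged and the `g` counted for fixed `a` and `y`.
  have h1 : ∀ g, u g * (F g).toOuterMeasure s ≤ bad.indicator u g + u g * η +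
      ∑ a ∈ typ, ∑' y, P a y * (if y ∈ K g a then u g else 0) := by
    intro g
    by_cases hg : g ∈ bad
    · rw [Set.indicator_of_mem hg, add_assoc]
      refine le_add_right (mul_le_of_le_one_right' ?_)
      exact (PMF.toOuterMeasure_mono _ (Set.subset_univ _)).trans
        ((PMF.toOuterMeasure_apply_eq_one_iff _ _).2 (Set.subset_univ _)).le
    · rw [Set.indicator_of_notMem hg, zero_add]
      obtain ⟨hz, hle⟩ := hF g hg
      refine (mul_le_mul_right hle _).trans ?_
      rw [mul_add]
      gcongr
      refine le_trans ?_ (Finset.single_le_sum (f := fun a =>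
        ∑' y, P a y * (if y ∈ K g a then u g else 0)) (fun _ _ => zero_le) hz)
      rw [PMF.toOuterMeasure_apply, ← ENNReal.tsum_mul_left]
      refine ENNReal.tsum_le_tsum fun y => ?_
      rw [Set.indicator_apply]
      split_ifs
      · rw [mul_comm]
      · simp
  have h2 : ∀ a ∈ typ, ∑' g, ∑' y, P a y * (if y ∈ K g a then u g else 0) ≤ ENNReal.ofReal β := by
    intro a ha
    rw [ENNReal.tsum_comm]
    calc _ ≤ ∑' y, P a y * ENNReal.ofReal β := by
          refine ENNReal.tsum_le_tsum fun y => ?_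
          rw [ENNReal.tsum_mul_left]
          gcongr
          have := toOuterMeasure_uniform_le {g | y ∈ K g a} (hK a ha y)
          rw [PMF.toOuterMeasure_apply] at this
          refine le_trans (le_of_eq (tsum_congr fun g => ?_)) this
          rw [Set.indicator_apply]
          rfl
      _ = _ := by rw [ENNReal.tsum_mul_right, (P a).tsum_coe, one_mul]
  rw [PMF.toOuterMeasure_bind_apply]
  refine (ENNReal.tsum_le_tsum h1).trans ?_
  rw [ENNReal.tsum_add, ENNReal.tsum_add, ENNReal.tsum_mul_right, u.tsum_coe, one_mul,
    ← PMF.toOuterMeasure_apply, Summable.tsum_finsetSum fun _ _ => ENNReal.summable]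
  gcongr
  calc _ ≤ ∑ _a ∈ typ, ENNReal.ofReal β := Finset.sum_le_sum h2
    _ = _ := by simp

/-! ### Typical channel outputs -/

/-- A function of state and input, extended by zero to the parity letters. -/
def stateCost {A B : Type*} (g : A → ZMod 2 → ℝ) : A ⊕ B → ZMod 2 → ℝ := Sum.elim g fun _ _ => 0

/-- Given a typical pair of states and inputs, the number of positions where the output satisfies
a condition that depends on the input is close to its expectation. -/
theorem exists_channel_typical {A B Y : Type*} [Fintype A] [Fintype B] [DecidableEq A]
    [DecidableEq B]
    (μ w₀ : A ⊕ B → ℝ) (PY : A → ZMod 2 → PMF Y) (V : Y → ZMod 2 → Prop)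
    [∀ y b, Decidable (V y b)] {δ η : ℝ}
    (hδ : 0 < δ) (hη : 0 < η) :
    ∃ ε > 0, ∃ N₀ : ℕ, ∀ (k r : ℕ) (s : Fin (k + r) → A) (q : Fin r → B)
      (z : Fin (k + r) ⊕ Fin r → ZMod 2), N₀ ≤ k + r →
      (∀ t, |(letterCount (Sum.map s q) t : ℝ) / (k + r : ℕ) - μ t| ≤ ε) →
      (∀ t, |(onesCount (Sum.map s q) t z : ℝ) / (k + r : ℕ) - μ t * w₀ t| ≤ ε) →
      (prodPMF fun i => PY (s i) (z (Sum.inl i))).toOuterMeasure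
        {y | δ ≤ |((Finset.univ.filter fun i => V (y i) (z (Sum.inl i))).card : ℝ) / (k + r : ℕ) -
          linCost (stateCost fun a b => ((PY a b).toOuterMeasure {y | V y b}).toReal) μ w₀|} ≤
        ENNReal.ofReal η := by
  set c : A ⊕ B → ZMod 2 → ℝ :=
    stateCost fun a b => ((PY a b).toOuterMeasure {y | V y b}).toReal with hc
  set C : ℝ := ∑ t, (|c t 1| + 2 * |c t 0|) with hC
  have hC0 : 0 ≤ C := by positivity
  -- Half of `δ` absorbs the error of the mean, and the other half enters Chebyshev's bound `n / (n
  -- δ / 2)² = 4 / (n δ²)`.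
  obtain ⟨N₀, hN₀⟩ := exists_nat_gt (4 / (δ ^ 2 * η))
  refine ⟨δ / 2 / (C + 1), by positivity, N₀ + 1, fun k r s q z hN hl hz => ?_⟩
  have hN' : (0 : ℝ) < (k + r : ℕ) := by exact_mod_cast (show 0 < k + r by omega)
  have hNN : (N₀ : ℝ) ≤ (k + r : ℕ) := by exact_mod_cast (show N₀ ≤ k + r by omega)
  have h1 := abs_sum_sub_linCost_le c (by omega : 0 < k + r) hl hz
  have hmean : ∑ i, c (Sum.map s q i) (z i) = ∑ i : Fin (k + r),
      ((PY (s i) (z (Sum.inl i))).toOuterMeasure {y | V y (z (Sum.inl i))}).toReal := by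
    rw [Fintype.sum_sum_type]
    simp [hc, stateCost]
  rw [hmean] at h1
  have h2 : δ / 2 / (C + 1) * C ≤ δ / 2 := by
    rw [div_mul_eq_mul_div, div_le_iff₀ (by linarith)]
    exact mul_le_mul_of_nonneg_left (by linarith) (by positivity)
  have h3 := prodPMF_deviation_le (fun i => PY (s i) (z (Sum.inl i)))
    (fun i y => V y (z (Sum.inl i))) (c := (k + r : ℕ) * (δ / 2)) (by positivity)
  refine le_trans (PMF.toOuterMeasure_mono _ ?_) (h3.trans (ENNReal.ofReal_le_ofReal ?_))
  · rintro y ⟨hy, -⟩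
    simp only [Set.mem_ofPred_eq] at hy ⊢
    set n : ℝ := ((Finset.univ.filter fun i => V (y i) (z (Sum.inl i))).card : ℝ)
    set M := ∑ i : Fin (k + r),
      ((PY (s i) (z (Sum.inl i))).toOuterMeasure {y | V y (z (Sum.inl i))}).toReal
    have h4 : (k + r : ℕ) * δ ≤ |n - (k + r : ℕ) * linCost c μ w₀| := by
      rw [show n - (k + r : ℕ) * linCost c μ w₀ =
        (k + r : ℕ) * (n / (k + r : ℕ) - linCost c μ w₀) by field_simp, abs_mul, abs_of_pos hN']
      exact mul_le_mul_of_nonneg_left hy hN'.le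
    have h5 := abs_sub_le n M ((k + r : ℕ) * linCost c μ w₀)
    nlinarith [mul_le_mul_of_nonneg_left h2 hN'.le]
  · have h4 := hN₀.le.trans hNN
    rw [div_le_iff₀ (by positivity)] at h4
    rw [div_le_iff₀ (by positivity)]
    nlinarith

end

section

/-! ### The code in terms of letter weights -/

section

variable {A B : Type*} [DecidableEq A] [DecidableEq B] {n r : ℕ}

theorem letterCount_map_inl (s : Fin n → A) (q : Fin r → B) (a : A) :
    letterCount (Sum.map s q) (Sum.inl a) = (Finset.univ.filter fun i => s i = a).card := by
  rw [letterCount, Finset.card_filter, Finset.card_filter, Fintype.sum_sum_type]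
  simp [-Finset.sum_boole]

theorem letterCount_map_inr (s : Fin n → A) (q : Fin r → B) (b : B) :
    letterCount (Sum.map s q) (Sum.inr b) = (Finset.univ.filter fun j => q j = b).card := by
  rw [letterCount, Finset.card_filter, Finset.card_filter, Fintype.sum_sum_type]
  simp [-Finset.sum_boole]

theorem onesCount_map_inl (s : Fin n → A) (q : Fin r → B) (a : A) (z : Fin n ⊕ Fin r → ZMod 2) :
    onesCount (Sum.map s q) (Sum.inl a) z =
      (Finset.univ.filter fun i => s i = a ∧ z (Sum.inl i) = 1).card := by
  rw [onesCount, Finset.card_filter, Finset.card_filter, Fintype.sum_sum_type]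
  simp [-Finset.sum_boole]

theorem onesCount_map_inr (s : Fin n → A) (q : Fin r → B) (b : B) (z : Fin n ⊕ Fin r → ZMod 2) :
    onesCount (Sum.map s q) (Sum.inr b) z =
      (Finset.univ.filter fun j => q j = b ∧ z (Sum.inr j) = 1).card := by
  rw [onesCount, Finset.card_filter, Finset.card_filter, Fintype.sum_sum_type]
  simp [-Finset.sum_boole]

end

section

variable {k r : ℕ}

/-- The codeword `x` together with its parity bits. -/
def withParity (H : GL (Fin (k + r)) (ZMod 2)) (x : Fin (k + r) → ZMod 2) :
    Fin (k + r) ⊕ Fin r → ZMod 2 := Sum.elim x (parityBits H x)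

/-- The factor of the message bits is an indicator for the encoder, whose biases there are bits, and
a constant for the decoder, whose biases are `half`. What remains to be maximized is `letterWeight`
in both cases. -/
theorem weight_mul_weight_append {T : Type*} (p : T → I) (l : Fin (k + r) ⊕ Fin r → T)
    (a : Fin k → I) (H : GL (Fin (k + r)) (ZMod 2)) (x : Fin (k + r) → ZMod 2) :
    weight (fun i => p (l (Sum.inl i))) x *
      weight (Fin.append a fun j => p (l (Sum.inr j)))
        (x ᵥ* (H : Matrix (Fin (k + r)) (Fin (k + r)) (ZMod 2))ᵀ) =
      (∏ i, bitProb (a i) ((H.1 *ᵥ x) (Fin.castAdd r i))) * letterWeight p l (withParity H x) := by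
  rw [Matrix.vecMul_transpose]
  unfold weight letterWeight withParity parityBits
  rw [Fintype.prod_sum_type, Fin.prod_univ_add fun i => if (H.1 *ᵥ x) i = 1 then _ else _]
  simp only [Fin.append_left, Fin.append_right, Sum.elim_inl, Sum.elim_inr]
  unfold bitProb
  ring

theorem prod_bitProb_bit (m u : Fin k → ZMod 2) :
    ∏ i, bitProb (bit (m i)) (u i) = if u = m then 1 else 0 := by
  split_ifs with h
  · subst h
    refine Finset.prod_eq_one fun i _ => ?_
    rcases zmod_two_cases (u i) with h | h <;> simp [h, bit]
  · obtain ⟨i, hi⟩ := Function.ne_iff.1 h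
    refine Finset.prod_eq_zero (Finset.mem_univ i) ?_
    rcases zmod_two_cases (u i) with h | h <;> rcases zmod_two_cases (m i) with h' | h' <;>
      simp [h, h', bit] at hi ⊢

theorem query_spec (τ : TieBreak) {n : ℕ} (H : GL (Fin n) (ZMod 2)) (p q : Fin n → I)
    (x : Fin n → ZMod 2) :
    weight p x * weight q (x ᵥ* (H : Matrix (Fin n) (Fin n) (ZMod 2))ᵀ) ≤
      weight p (query τ H p q) *
        weight q (query τ H p q ᵥ* (H : Matrix (Fin n) (Fin n) (ZMod 2))ᵀ) := by
  have hne : (maximizers H p q).Nonempty := by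
    obtain ⟨x₀, hx₀⟩ := Finite.exists_max fun x : Fin n → ZMod 2 =>
      weight p x * weight q (x ᵥ* (H : Matrix (Fin n) (Fin n) (ZMod 2))ᵀ)
    exact ⟨x₀, Finset.mem_filter.2 ⟨Finset.mem_univ _, hx₀⟩⟩
  exact (Finset.mem_filter.1 (τ.pick_mem _ hne)).2 x

theorem linked_withParity_iff {H : GL (Fin (k + r)) (ZMod 2)} {m : Fin k → ZMod 2}
    {x : Fin (k + r) → ZMod 2} :
    Linked H m (withParity H x) ↔ (fun i => (H.1 *ᵥ x) (Fin.castAdd r i)) = m := by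
  rw [Linked, withParity, Sum.elim_comp_inl, Sum.elim_comp_inr]
  constructor
  · intro h
    funext i
    rw [h, Fin.append_left]
  · rintro rfl
    exact (Fin.append_castAdd_natAdd).symm

theorem Linked.eq_withParity {H : GL (Fin (k + r)) (ZMod 2)} {m : Fin k → ZMod 2}
    {z : Fin (k + r) ⊕ Fin r → ZMod 2} (h : Linked H m z) : z = withParity H (z ∘ Sum.inl) := by
  funext i
  rcases i with i | j
  · rfl
  · simp only [withParity, Sum.elim_inr, parityBits]
    rw [h, Fin.append_right]
    rfl

theorem withParity_zero (H : GL (Fin (k + r)) (ZMod 2)) : withParity H 0 = 0 := by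
  funext i
  rcases i with i | j <;> simp [withParity, parityBits]

/-- If some codeword with message `m` has positive weight, the encoder selects one of maximal
weight. -/
theorem encode_spec (τ : TieBreak) {S T : Type*} (pe : S → I) (p : T → I)
    (l : Fin (k + r) ⊕ Fin r → T) (s : Fin (k + r) → S) (q : Fin r → I)
    (hs : ∀ i, pe (s i) = p (l (Sum.inl i))) (hq : ∀ j, q j = p (l (Sum.inr j)))
    (m : Fin k → ZMod 2) (H : GL (Fin (k + r)) (ZMod 2))
    (hex : ∃ z, Linked H m z ∧ letterWeight p l z ≠ 0) :
    Linked H m (withParity H (encode τ pe H q m s)) ∧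
      letterWeight p l (withParity H (encode τ pe H q m s)) ≠ 0 ∧
      ∀ z, Linked H m z → letterWeight p l z ≤
        letterWeight p l (withParity H (encode τ pe H q m s)) := by
  set x := encode τ pe H q m s with hx
  have key : ∀ x', (if (fun i => (H.1 *ᵥ x') (Fin.castAdd r i)) = m then (1 : ℝ) else 0) *
      letterWeight p l (withParity H x') ≤
      (if (fun i => (H.1 *ᵥ x) (Fin.castAdd r i)) = m then (1 : ℝ) else 0) *
      letterWeight p l (withParity H x) := by
    intro x'
    have := query_spec τ H (fun i => p (l (Sum.inl i)))
      (Fin.append (fun i => bit (m i)) fun j => p (l (Sum.inr j))) x'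
    rw [weight_mul_weight_append, weight_mul_weight_append,
      prod_bitProb_bit m fun i => (H.1 *ᵥ x') (Fin.castAdd r i),
      prod_bitProb_bit m fun i => (H.1 *ᵥ _) (Fin.castAdd r i)] at this
    have hx' : query τ H (fun i => p (l (Sum.inl i)))
      (Fin.append (fun i => bit (m i)) fun j => p (l (Sum.inr j))) = x := by
      simp only [hx, encode, ← hs, ← hq]
    rwa [hx'] at this
  have hmax : ∀ z, Linked H m z → letterWeight p l z ≤
      (if (fun i => (H.1 *ᵥ x) (Fin.castAdd r i)) = m then (1 : ℝ) else 0) *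
      letterWeight p l (withParity H x) := by
    intro z hz
    have h := key (z ∘ Sum.inl)
    have hz' := hz
    rw [hz.eq_withParity, linked_withParity_iff] at hz'
    rwa [if_pos hz', one_mul, ← hz.eq_withParity] at h
  obtain ⟨z₀, hz₀, hw₀⟩ := hex
  have hpos : 0 < letterWeight p l z₀ := lt_of_le_of_ne (letterWeight_nonneg p l z₀) hw₀.symm
  by_cases hm : (fun i => (H.1 *ᵥ x) (Fin.castAdd r i)) = m
  · rw [if_pos hm, one_mul] at hmax
    exact ⟨linked_withParity_iff.2 hm, (hpos.trans_le (hmax z₀ hz₀)).ne', hmax⟩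
  · rw [if_neg hm, zero_mul] at hmax
    exact absurd (hmax z₀ hz₀) (not_le.2 hpos)

/-- A decoding error is caused by another codeword of at least the same weight. -/
theorem exists_of_decode_ne (τ : TieBreak) {Y T : Type*} (pd : Y → I) (p : T → I)
    (l : Fin (k + r) ⊕ Fin r → T) (y : Fin (k + r) → Y) (q : Fin r → I)
    (hy : ∀ i, pd (y i) = p (l (Sum.inl i))) (hq : ∀ j, q j = p (l (Sum.inr j)))
    {m : Fin k → ZMod 2} {H : GL (Fin (k + r)) (ZMod 2)} {x : Fin (k + r) → ZMod 2}
    (hx : Linked H m (withParity H x)) (hne : decode τ pd H q y ≠ m) :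
    ∃ x', x' ≠ x ∧ letterWeight p l (withParity H x) ≤ letterWeight p l (withParity H x') := by
  refine ⟨query τ H (fun j => pd (y j)) (Fin.append (fun _ => half) q), ?_, ?_⟩
  · intro h
    refine hne ?_
    rw [linked_withParity_iff] at hx
    unfold decode
    rw [h, Matrix.vecMul_transpose]
    exact hx
  · have := query_spec τ H (fun i => p (l (Sum.inl i)))
      (Fin.append (fun _ => half) fun j => p (l (Sum.inr j))) x
    rw [weight_mul_weight_append, weight_mul_weight_append] at this
    have hhalf : ∀ u : Fin k → ZMod 2, ∏ i, bitProb half (u i) = (1 / 2) ^ k := by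
      intro u
      have : ∀ b, bitProb half b = 1 / 2 := by
        intro b
        rcases zmod_two_cases b with rfl | rfl
        · rw [bitProb_zero, half]; norm_num
        · rw [bitProb_one, half]
      simp [this]
    rw [hhalf fun i => (H.1 *ᵥ x) (Fin.castAdd r i),
      hhalf fun i => (H.1 *ᵥ _) (Fin.castAdd r i)] at this
    simp only [← hy, ← hq] at this
    exact le_of_mul_le_mul_left this (by positivity)

end

/-- The comparison of costs at the decoder needs positive weight of the transmitted vector; this is
the second nondegeneracy condition, applied position by position. -/
theorem letterWeight_ne_zero_of_output {A B Y : Type*} {n r : ℕ} {pE : A ⊕ B → I}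
    {pD : Y ⊕ B → I} (hB : ∀ b, pE (Sum.inr b) = pD (Sum.inr b)) (PY : A → ZMod 2 → PMF Y)
    (hnd : ∀ a b, bitProb (pE (Sum.inl a)) b ≠ 0 → ∀ y ∈ (PY a b).support,
      bitProb (pD (Sum.inl y)) b ≠ 0)
    {s : Fin n → A} {q : Fin r → B} {z : Fin n ⊕ Fin r → ZMod 2}
    (hz : letterWeight pE (Sum.map s q) z ≠ 0) {y : Fin n → Y}
    (hy : y ∈ (prodPMF fun i => PY (s i) (z (Sum.inl i))).support) :
    letterWeight pD (Sum.map y q) z ≠ 0 := by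
  have hz' := Finset.prod_ne_zero_iff.1 hz
  refine Finset.prod_ne_zero_iff.2 ?_
  rintro (i | j) -
  · refine hnd (s i) _ (hz' (Sum.inl i) (Finset.mem_univ _)) _ ?_
    rw [PMF.mem_support_iff, prodPMF_apply] at hy
    exact (PMF.mem_support_iff _ _).2 (Finset.prod_ne_zero_iff.1 hy i (Finset.mem_univ i))
  · have := hz' (Sum.inr j) (Finset.mem_univ _)
    simpa only [Sum.map_inr, hB] using this

end

section

/-! ### The letters of the encoder and of the decoder -/

variable {S Y : Type*}

/-- The biases of the encoder, at states and parity biases of positive probability. -/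
def encBias (PS : PMF S) (PQ : PMF I) (pe : S → I) : PS.support ⊕ PQ.support → I :=
  Sum.elim (fun a => pe a) fun t => t

/-- The relative frequencies of states and parity biases. -/
def encMass (R : ℝ) (PS : PMF S) (PQ : PMF I) : PS.support ⊕ PQ.support → ℝ :=
  Sum.elim (fun a => (PS a).toReal) fun t => (1 - R) * (PQ t).toReal

/-- The probabilities of `1` under `P_{X|S}` and `P_{V|Q}`. -/
def encParam (PS : PMF S) (PQ : PMF I) (W : S → PMF (ZMod 2)) (U : I → PMF (ZMod 2)) :
    PS.support ⊕ PQ.support → ℝ :=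
  Sum.elim (fun a => (W a 1).toReal) fun t => (U t 1).toReal

/-- The biases of the decoder. -/
def decBias (PQ : PMF I) (pd : Y → I) : Y ⊕ PQ.support → I := Sum.elim pd fun t => t

/-- The relative frequencies of outputs and parity biases. -/
def decMass (R : ℝ) (PS : PMF S) (PY : S → ZMod 2 → PMF Y) (PQ : PMF I) (W : S → PMF (ZMod 2)) :
    Y ⊕ PQ.support → ℝ :=
  Sum.elim (fun y => ((lawXY PS W PY).map Prod.snd y).toReal) fun t => (1 - R) * (PQ t).toReal

/-- The probabilities of `1` under `P_{X|Y}` and `P_{V|Q}`. -/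
def decParam (PS : PMF S) (PY : S → ZMod 2 → PMF Y) (PQ : PMF I) (W : S → PMF (ZMod 2))
    (U : I → PMF (ZMod 2)) : Y ⊕ PQ.support → ℝ :=
  Sum.elim (fun y => (lawXY PS W PY (1, y)).toReal / ((lawXY PS W PY).map Prod.snd y).toReal)
    fun t => (U t 1).toReal

theorem encMass_pos {R : ℝ} (hR : R < 1) (PS : PMF S) (PQ : PMF I) (t) :
    0 < encMass R PS PQ t := by
  rcases t with a | t
  · exact ENNReal.toReal_pos ((PMF.mem_support_iff _ _).1 a.2) (PS.apply_ne_top _)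
  · exact mul_pos (by linarith)
      (ENNReal.toReal_pos ((PMF.mem_support_iff _ _).1 t.2) (PQ.apply_ne_top _))

theorem expect_eq_sum {α : Type*} (P : PMF α) [Fintype P.support] (f : α → ℝ≥0∞) :
    expect P f = ∑ a : P.support, P a * f a := by
  rw [expect, ← tsum_fintype (L := .unconditional _),
    tsum_subtype_eq_of_support_subset (f := fun a => P a * f a)]
  intro a ha
  rw [Function.mem_support] at ha
  exact (PMF.mem_support_iff _ _).2 (left_ne_zero_of_mul ha)

theorem toReal_expect {α : Type*} (P : PMF α) [Fintype P.support] {f : α → ℝ≥0∞}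
    (hf : ∀ a, f a ≠ ⊤) :
    (expect P f).toReal = ∑ a : P.support, (P a).toReal * (f a).toReal := by
  rw [expect_eq_sum, ENNReal.toReal_sum
    fun (a : P.support) _ => ENNReal.mul_ne_top (P.apply_ne_top a) (hf a)]
  simp

theorem lawXY_apply (PS : PMF S) (W : S → PMF (ZMod 2)) (PY : S → ZMod 2 → PMF Y) (b : ZMod 2)
    (y : Y) : lawXY PS W PY (b, y) = expect PS fun a => W a b * PY a b y := by
  classical
  rw [lawXY, PMF.bind_apply, expect]
  refine tsum_congr fun a => ?_
  congr 1
  rw [PMF.bind_apply, tsum_eq_single b, PMF.map_apply, tsum_eq_single y]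
  · simp
  · intro y' hy'
    simp [hy'.symm]
  · intro b' hb'
    rw [PMF.map_apply, ENNReal.tsum_eq_zero.2, mul_zero]
    intro y'
    simp [hb'.symm]

theorem lawY_apply (PS : PMF S) (W : S → PMF (ZMod 2)) (PY : S → ZMod 2 → PMF Y) (y : Y) :
    (lawXY PS W PY).map Prod.snd y = expect PS fun a => W a 0 * PY a 0 y + W a 1 * PY a 1 y := by
  have h : (lawXY PS W PY).map Prod.snd = PS.bind fun a => (W a).bind fun b => PY a b := by
    rw [lawXY, PMF.map_bind]
    congr 1
    funext a
    rw [PMF.map_bind]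
    congr 1
    funext b
    rw [PMF.map_comp]
    exact PMF.map_id _
  rw [h, PMF.bind_apply, expect]
  refine tsum_congr fun a => ?_
  congr 1
  rw [PMF.bind_apply, tsum_fintype, sum_zmod_two]

theorem lawXY_toReal (PS : PMF S) [Fintype PS.support] (W : S → PMF (ZMod 2))
    (PY : S → ZMod 2 → PMF Y) (b : ZMod 2) (y : Y) :
    (lawXY PS W PY (b, y)).toReal =
      ∑ a : PS.support, (PS a).toReal * ((W a b).toReal * (PY a b y).toReal) := by
  rw [lawXY_apply, toReal_expect PS fun a => ENNReal.mul_ne_top (PMF.apply_ne_top _ _)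
    (PMF.apply_ne_top _ _)]
  simp

theorem lawY_toReal (PS : PMF S) [Fintype PS.support] (W : S → PMF (ZMod 2))
    (PY : S → ZMod 2 → PMF Y) (y : Y) :
    ((lawXY PS W PY).map Prod.snd y).toReal =
      (lawXY PS W PY (0, y)).toReal + (lawXY PS W PY (1, y)).toReal := by
  have h : ∀ a b, W a b * PY a b y ≠ ⊤ := fun a b =>
    ENNReal.mul_ne_top (PMF.apply_ne_top _ _) (PMF.apply_ne_top _ _)
  rw [lawY_apply, toReal_expect PS fun a => ENNReal.add_ne_top.2 ⟨h a 0, h a 1⟩, lawXY_toReal,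
    lawXY_toReal, ← Finset.sum_add_distrib]
  refine Finset.sum_congr rfl fun a _ => ?_
  rw [ENNReal.toReal_add (h _ _) (h _ _), ENNReal.toReal_mul, ENNReal.toReal_mul, mul_add]

/-- At an output of probability zero the quotient in `decParam` is `0` by convention, and the joint
probability vanishes as well. -/
theorem decMass_mul_decParam (R : ℝ) (PS : PMF S) [Fintype PS.support] (PY : S → ZMod 2 → PMF Y)
    (PQ : PMF I) (W : S → PMF (ZMod 2)) (U : I → PMF (ZMod 2)) (y : Y) :
    decMass R PS PY PQ W (Sum.inl y) * decParam PS PY PQ W U (Sum.inl y) =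
      (lawXY PS W PY (1, y)).toReal := by
  simp only [decMass, decParam, Sum.elim_inl]
  by_cases h : ((lawXY PS W PY).map Prod.snd y).toReal = 0
  · have h1 := lawY_toReal PS W PY y
    have h0 : 0 ≤ (lawXY PS W PY (0, y)).toReal := ENNReal.toReal_nonneg
    have h2 : 0 ≤ (lawXY PS W PY (1, y)).toReal := ENNReal.toReal_nonneg
    rw [h, zero_mul]
    linarith
  · field_simp

section

variable (R : ℝ) (PS : PMF S) (PY : S → ZMod 2 → PMF Y) (PQ : PMF I) (W : S → PMF (ZMod 2))
  (U : I → PMF (ZMod 2)) [Fintype PS.support] [Fintype PQ.support]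

theorem linCost_stateCost (g : PS.support → ZMod 2 → ℝ) :
    linCost (stateCost g) (encMass R PS PQ) (encParam PS PQ W U) =
      ∑ a : PS.support, (PS a).toReal *
        ((W a 1).toReal * g a 1 + (W a 0).toReal * g a 0) := by
  rw [linCost, Fintype.sum_sum_type]
  simp only [stateCost, encMass, encParam, Sum.elim_inl, Sum.elim_inr, mul_zero, add_zero,
    Finset.sum_const_zero]
  refine Finset.sum_congr rfl fun a _ => ?_
  rw [pmf_bit_toReal (W a) 0, bitProb_zero]

/-- Output frequencies as expectations over the letters of the encoder, the form in which
`exists_channel_typical` supplies them. -/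
theorem decMass_inl_eq (y : Y) :
    decMass R PS PY PQ W (Sum.inl y) = linCost (stateCost fun (a : PS.support) b =>
      ((PY a b).toOuterMeasure {y' | y' = y}).toReal) (encMass R PS PQ) (encParam PS PQ W U) := by
  rw [linCost_stateCost]
  simp only [decMass, Sum.elim_inl, Set.ofPred_eq_eq_singleton, PMF.toOuterMeasure_apply_singleton]
  rw [lawY_toReal, lawXY_toReal, lawXY_toReal, ← Finset.sum_add_distrib]
  exact Finset.sum_congr rfl fun a _ => by ring

theorem lawXY_one_eq (y : Y) :
    (lawXY PS W PY (1, y)).toReal = linCost (stateCost fun (a : PS.support) b =>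
      ((PY a b).toOuterMeasure {y' | y' = y ∧ b = 1}).toReal) (encMass R PS PQ)
        (encParam PS PQ W U) := by
  rw [linCost_stateCost, lawXY_toReal]
  refine Finset.sum_congr rfl fun a _ => ?_
  have h0 : {y' : Y | y' = y ∧ (0 : ZMod 2) = 1} = ∅ := by simp
  have h1 : {y' : Y | y' = y ∧ (1 : ZMod 2) = 1} = {y} := by simp
  rw [h0, h1, PMF.toOuterMeasure_apply_singleton]
  simp

end

open Classical in
/-- A typical codeword has an empirical distribution close to `P_S P_{X|S}`. -/
theorem abs_empirical_sub_lt {R : ℝ} {PS : PMF S} {PQ : PMF I} {W : S → PMF (ZMod 2)}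
    {U : I → PMF (ZMod 2)} {k r : ℕ} {s : Fin (k + r) → PS.support} {q : Fin r → PQ.support}
    {z : Fin (k + r) ⊕ Fin r → ZMod 2} {ε : ℝ} (hε : 0 < ε)
    (hl : ∀ t, |(letterCount (Sum.map s q) t : ℝ) / (k + r : ℕ) - encMass R PS PQ t| ≤ ε / 4)
    (hz : ∀ t, |(onesCount (Sum.map s q) t z : ℝ) / (k + r : ℕ) -
      encMass R PS PQ t * encParam PS PQ W U t| ≤ ε / 4) (a : S) (b : ZMod 2) :
    |empirical (fun i => (s i : S)) (z ∘ Sum.inl) a b - (PS a * W a b).toReal| < ε := by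
  by_cases ha : a ∈ PS.support
  · have h1 := abs_le.1 (hl (Sum.inl ⟨a, ha⟩))
    have h2 := abs_le.1 (hz (Sum.inl ⟨a, ha⟩))
    have hones : empirical (fun i => (s i : S)) (z ∘ Sum.inl) a 1 =
        (onesCount (Sum.map s q) (Sum.inl ⟨a, ha⟩) z : ℝ) / (k + r : ℕ) := by
      rw [onesCount_map_inl, empirical]
      congr 2
      congr 1
      ext i
      simp [Subtype.ext_iff]
    have hsum : empirical (fun i => (s i : S)) (z ∘ Sum.inl) a 0 +
        empirical (fun i => (s i : S)) (z ∘ Sum.inl) a 1 =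
        (letterCount (Sum.map s q) (Sum.inl ⟨a, ha⟩) : ℝ) / (k + r : ℕ) := by
      rw [letterCount_map_inl, empirical, empirical, ← add_div]
      congr 1
      rw [← Nat.cast_add, ← Finset.card_union_of_disjoint]
      · congr 2
        ext i
        simp only [Function.comp_apply, Finset.mem_union, Finset.mem_filter, Finset.mem_univ,
          true_and, Subtype.ext_iff]
        rcases zmod_two_cases (z (Sum.inl i)) with h | h <;> simp [h]
      · rw [Finset.disjoint_filter]
        rintro i - ⟨-, h0⟩ ⟨-, h1⟩
        rw [h0] at h1
        exact zero_ne_one h1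
    simp only [encMass, encParam, Sum.elim_inl] at h1 h2
    rw [ENNReal.toReal_mul]
    rcases zmod_two_cases b with rfl | rfl
    -- The number of zeros is the difference of two counts, each of which is off by at most `ε / 4`.
    · rw [pmf_bit_toReal, bitProb_zero, abs_lt]
      constructor <;> nlinarith
    · rw [hones, abs_lt]
      constructor <;> linarith
  · have h0 : empirical (fun i => (s i : S)) (z ∘ Sum.inl) a b = 0 := by
      rw [empirical, Finset.filter_eq_empty_iff.2, Finset.card_empty, Nat.cast_zero, zero_div]
      rintro i - ⟨h, -⟩
      exact ha (h ▸ (s i).2)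
    rw [PMF.mem_support_iff, not_not] at ha
    rw [h0, ha]
    simpa using hε

end

section

/-! ### The error probability for typical states and parity biases -/

variable {S Y : Type*}

/-- The size of the union bound: `exp (N (log 2 + γ / 4))` codewords and `exp (N (E - γ))`
competitors. -/
theorem union_bound_le {R γ : ℝ} {k r : ℕ} (h2 : 2 ≤ k + r)
    (hr : |(r : ℝ) / (k + r : ℕ) - (1 - R)| * Real.log 2 ≤ γ / 4) :
    Real.exp ((k + r : ℕ) * (Real.log 2 + γ / 4)) *
      (Real.exp ((k + r : ℕ) * ((1 - R) * Real.log 2 - γ)) * 2 ^ k /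
        ((2 ^ (k + r) - 1) * (2 ^ (k + r) - 2))) ≤ 4 * Real.exp (-((k + r : ℕ) * (γ / 2))) := by
  have hN : (0 : ℝ) < (k + r : ℕ) := by exact_mod_cast (show 0 < k + r by omega)
  have hpow : (4 : ℝ) ≤ 2 ^ (k + r) := by
    calc (4 : ℝ) = 2 ^ 2 := by norm_num
      _ ≤ _ := pow_le_pow_right₀ (by norm_num) h2
  have hlog : 0 < Real.log 2 := Real.log_pos one_lt_two
  have hden : (2 ^ (k + r) * 2 ^ (k + r) : ℝ) / 4 ≤ (2 ^ (k + r) - 1) * (2 ^ (k + r) - 2) := by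
    nlinarith
  have hden0 : (0 : ℝ) < (2 ^ (k + r) * 2 ^ (k + r) : ℝ) / 4 := by positivity
  rw [mul_div_assoc', div_le_iff₀ (hden0.trans_le hden)]
  refine le_trans ?_ (mul_le_mul_of_nonneg_left hden (by positivity))
  rw [← exp_nat_mul_log_two, ← exp_nat_mul_log_two, ← Real.exp_add, ← Real.exp_add, ← Real.exp_add]
  rw [show ∀ a b : ℝ, 4 * a * (b / 4) = a * b from fun a b => by ring, ← Real.exp_add]
  refine Real.exp_le_exp.2 ?_
  -- With `k = N - r` the powers of `2` leave the exponent `N (1 - R) log 2 - r log 2 ≤ N γ / 4`;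
  -- together with `γ / 4 - γ` per symbol this is `-γ / 2`.
  have hr' : (r : ℝ) = (k + r : ℕ) * (r / (k + r : ℕ)) := by field_simp
  have hk : (k : ℝ) = (k + r : ℕ) - r := by push_cast; ring
  have h1 : ((1 - R) - (r : ℝ) / (k + r : ℕ)) * Real.log 2 ≤ γ / 4 := by
    refine le_trans (mul_le_mul_of_nonneg_right ?_ hlog.le) hr
    rw [abs_sub_comm]
    exact le_abs_self _
  have h2 := mul_le_mul_of_nonneg_left h1 hN.le
  rw [hk]
  have h3 : (k + r : ℕ) * (((1 - R) - (r : ℝ) / (k + r : ℕ)) * Real.log 2) =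
      (k + r : ℕ) * (1 - R) * Real.log 2 - r * Real.log 2 := by
    rw [sub_mul, mul_sub, ← mul_assoc, ← mul_assoc, ← hr']
  rw [h3] at h2
  linarith

/-- The decoder sees the expected frequencies of outputs and parity biases, and of ones of `z`. -/
def OutputTypical {T Y : Type*} [DecidableEq T] [DecidableEq Y]
    (μ w : Y ⊕ T → ℝ) (δ : ℝ) {k r : ℕ} (q : Fin r → T)
    (z : Fin (k + r) ⊕ Fin r → ZMod 2) (y : Fin (k + r) → Y) : Prop :=
  (∀ t, |(letterCount (Sum.map y q) t : ℝ) / (k + r : ℕ) - μ t| ≤ δ) ∧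
    ∀ t, |(onesCount (Sum.map y q) t z : ℝ) / (k + r : ℕ) - μ t * w t| ≤ δ

open Classical in
/-- The outputs are typical with high probability, given a typical codeword. -/
theorem exists_outputTypical [Finite Y] (R : ℝ) (PS : PMF S) (PY : S → ZMod 2 → PMF Y)
    (PQ : PMF I) [Fintype PS.support] [Fintype PQ.support]
    (W : S → PMF (ZMod 2)) (U : I → PMF (ZMod 2)) {δ η : ℝ} (hδ : 0 < δ) (hη : 0 < η) :
    ∃ ε > 0, ∃ N₀ : ℕ, ∀ (k r : ℕ) (s : Fin (k + r) → PS.support) (q : Fin r → PQ.support)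
      (z : Fin (k + r) ⊕ Fin r → ZMod 2), N₀ ≤ k + r →
      (∀ t, |(letterCount (Sum.map s q) t : ℝ) / (k + r : ℕ) - encMass R PS PQ t| ≤ ε) →
      (∀ t, |(onesCount (Sum.map s q) t z : ℝ) / (k + r : ℕ) -
        encMass R PS PQ t * encParam PS PQ W U t| ≤ ε) →
      (prodPMF fun i => PY (s i) (z (Sum.inl i))).toOuterMeasure
        {y | ¬ OutputTypical (decMass R PS PY PQ W) (decParam PS PY PQ W U) δ q z y} ≤
        ENNReal.ofReal η := by
  have := Fintype.ofFinite Y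
  have hη' : 0 < η / 2 / (Fintype.card Y + 1) := by positivity
  have hch := fun y₀ : Y => exists_channel_typical (encMass R PS PQ) (encParam PS PQ W U)
    (fun (a : PS.support) => PY a) (fun y _ => y = y₀) hδ hη'
  have hch' := fun y₀ : Y => exists_channel_typical (encMass R PS PQ) (encParam PS PQ W U)
    (fun (a : PS.support) => PY a) (fun y b => y = y₀ ∧ b = 1) hδ hη'
  choose e he M h using hch
  choose e' he' M' h' using hch'
  obtain ⟨ε, hε, hεe⟩ := exists_pos_forall_le e he
  obtain ⟨ε', hε', hεe'⟩ := exists_pos_forall_le e' he'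
  -- The `δ` serves the parity letters, whose counts are the same for the encoder and the decoder.
  refine ⟨min (min ε ε') δ, by positivity, ∑ y, (M y + M' y), fun k r s q z hN hl hz => ?_⟩
  have hM : ∀ y, M y + M' y ≤ k + r := fun y =>
    (Finset.single_le_sum (f := fun y => M y + M' y) (fun _ _ => Nat.zero_le _)
      (Finset.mem_univ y)).trans hN
  have hle : ∀ y, min (min ε ε') δ ≤ e y := fun y =>
    (min_le_left _ _).trans ((min_le_left _ _).trans (hεe y))
  have hle' : ∀ y, min (min ε ε') δ ≤ e' y := fun y =>
    (min_le_left _ _).trans ((min_le_right _ _).trans (hεe' y))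
  have k1 := fun y₀ => h y₀ k r s q z (by have := hM y₀; omega) (fun t => (hl t).trans (hle y₀))
    (fun t => (hz t).trans (hle y₀))
  have k2 := fun y₀ => h' y₀ k r s q z (by have := hM y₀; omega) (fun t => (hl t).trans (hle' y₀))
    (fun t => (hz t).trans (hle' y₀))
  simp only [← decMass_inl_eq R PS PY PQ W U] at k1
  simp only [← lawXY_one_eq R PS PY PQ W U] at k2
  have hsum := add_le_add (Finset.sum_le_sum fun y₀ (_ : y₀ ∈ Finset.univ) => k1 y₀)
    (Finset.sum_le_sum fun y₀ (_ : y₀ ∈ Finset.univ) => k2 y₀)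
  refine le_trans ?_ (hsum.trans ?_)
  · refine le_trans ?_ (add_le_add (MeasureTheory.measure_iUnion_fintype_le _ _)
      (MeasureTheory.measure_iUnion_fintype_le _ _))
    refine le_trans (MeasureTheory.measure_mono ?_) (MeasureTheory.measure_union_le _ _)
    intro y hy
    by_contra hcon
    simp only [Set.mem_union, Set.mem_iUnion, Set.mem_ofPred_eq, not_or, not_exists, not_le] at hcon
    refine hy ⟨?_, ?_⟩
    · rintro (y₀ | b)
      · rw [letterCount_map_inl]
        exact (hcon.1 y₀).le
      · have h := (hl (Sum.inr b)).trans (min_le_right _ _)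
        rw [letterCount_map_inr] at h ⊢
        exact h
    · rintro (y₀ | b)
      · rw [onesCount_map_inl, decMass_mul_decParam]
        exact (hcon.2 y₀).le
      · have h := (hz (Sum.inr b)).trans (min_le_right _ _)
        rw [onesCount_map_inr] at h ⊢
        exact h
  · simp only [Finset.sum_const, nsmul_eq_mul, Finset.card_univ, ← ENNReal.ofReal_natCast]
    rw [← ENNReal.ofReal_mul (by positivity), ← ENNReal.ofReal_add (by positivity) (by positivity)]
    refine ENNReal.ofReal_le_ofReal ?_
    have : (Fintype.card Y : ℝ) * (η / 2 / (Fintype.card Y + 1)) ≤ η / 2 := by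
      rw [mul_div_assoc', div_le_iff₀ (by positivity)]
      nlinarith
    linarith

/-- The outputs `y` for which a codeword other than `0` and `z` looks at least as good as `z`. -/
def confusing {T Y : Type*} [DecidableEq T] [DecidableEq Y]
    (p : Y ⊕ T → I) (μ w : Y ⊕ T → ℝ) (δ : ℝ) {k r : ℕ} (q : Fin r → T)
    (m : Fin k → ZMod 2) (H : GL (Fin (k + r)) (ZMod 2)) (z : Fin (k + r) ⊕ Fin r → ZMod 2) :
    Set (Fin (k + r) → Y) :=
  {y | (OutputTypical μ w δ q z y ∧ letterWeight p (Sum.map y q) z ≠ 0) ∧ Linked H m z ∧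
    ∃ x, x ≠ 0 ∧ x ≠ z ∘ Sum.inl ∧
      letterWeight p (Sum.map y q) z ≤ letterWeight p (Sum.map y q) (withParity H x)}

open Classical in
/-- If the encoder selects a typical codeword, then an error or a deviation requires atypical or
confusing outputs. -/
theorem bad_event_subset {R : ℝ} {PS : PMF S} {PY : S → ZMod 2 → PMF Y}
    {pe : S → I} {pd : Y → I} {PQ : PMF I} {W : S → PMF (ZMod 2)} {U : I → PMF (ZMod 2)}
    (hnd : ∀ (a : PS.support) b, bitProb (pe a) b ≠ 0 → ∀ y ∈ (PY a b).support,
      bitProb (pd y) b ≠ 0)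
    (τ : TieBreak) {ε δ : ℝ} (hε : 0 < ε) {k r : ℕ} {s : Fin (k + r) → PS.support}
    {q : Fin r → PQ.support}
    (hl : ∀ t, |(letterCount (Sum.map s q) t : ℝ) / (k + r : ℕ) - encMass R PS PQ t| ≤ ε / 4)
    {m : Fin k → ZMod 2} {H : GL (Fin (k + r)) (ZMod 2)} {x : Fin (k + r) → ZMod 2}
    (hlink : Linked H m (withParity H x))
    (hwt : letterWeight (encBias PS PQ pe) (Sum.map s q) (withParity H x) ≠ 0)
    (htyp : ∀ t, |(onesCount (Sum.map s q) t (withParity H x) : ℝ) / (k + r : ℕ) -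
      encMass R PS PQ t * encParam PS PQ W U t| ≤ ε / 4)
    {μD wD : Y ⊕ PQ.support → ℝ}
    (hgap : ∀ (y : Fin (k + r) → Y) z, OutputTypical μD wD δ q z y →
      letterWeight (decBias PQ pd) (Sum.map y q) z ≠ 0 →
      letterWeight (decBias PQ pd) (Sum.map y q) 0 < letterWeight (decBias PQ pd) (Sum.map y q) z)
    {y : Fin (k + r) → Y} (hy : y ∈ (prodPMF fun i => PY (s i) (x i)).support)
    (hbad : decode τ pd H (fun j => (q j : I)) y ≠ m ∨ ∃ (a : S) (b : ZMod 2),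
      ε ≤ |empirical (fun i => (s i : S)) x a b - (PS a * W a b).toReal|) :
    ¬ OutputTypical μD wD δ q (withParity H x) y ∨
      y ∈ confusing (decBias PQ pd) μD wD δ q m H (withParity H x) := by
  by_cases hyy : OutputTypical μD wD δ q (withParity H x) y
  swap
  · exact Or.inl hyy
  refine Or.inr ?_
  have hwD : letterWeight (decBias PQ pd) (Sum.map y q) (withParity H x) ≠ 0 :=
    letterWeight_ne_zero_of_output (pE := encBias PS PQ pe) (pD := decBias PQ pd) (fun _ => rfl)
      (fun (a : PS.support) => PY a) (fun a b h => hnd a b h) hwt hy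
  rcases hbad with hy | ⟨a, b, hab⟩
  · obtain ⟨x', hx', hle'⟩ := exists_of_decode_ne τ pd (decBias PQ pd) (Sum.map y q) y
      (fun j => (q j : I)) (fun _ => rfl) (fun _ => rfl) hlink hy
    refine ⟨⟨hyy, hwD⟩, hlink, x', ?_, hx', hle'⟩
    -- The zero codeword has zero parity bits for every `H`, so it lies outside the random-matrix
    -- bound and is excluded by its weight.
    rintro rfl
    rw [withParity_zero] at hle'
    exact absurd hle' (not_le.2 (hgap y _ hyy hwD))
  · exact absurd hab (not_le.2 (abs_empirical_sub_lt (z := withParity H x) hε hl htyp a b))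

-- For fixed `y` and `z` the set of vectors that weigh at least as much as `z` does not depend on
-- `H`, so the union bound over the competitors applies.
open Classical in
theorem card_confusing_le {T Y : Type*} [DecidableEq T] [DecidableEq Y] {p : Y ⊕ T → I}
    {μ w : Y ⊕ T → ℝ} {δ E : ℝ} {k r : ℕ}
    (hk : 2 ≤ k + r) {q : Fin r → T} {m : Fin k → ZMod 2} (hm : m ≠ 0)
    (hgap : ∀ (y : Fin (k + r) → Y) z, OutputTypical μ w δ q z y →
      letterWeight p (Sum.map y q) z ≠ 0 →
      ((Finset.univ.filter fun z' =>
        letterWeight p (Sum.map y q) z ≤ letterWeight p (Sum.map y q) z').card : ℝ) ≤ E)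
    (hE : 0 ≤ E) (z : Fin (k + r) ⊕ Fin r → ZMod 2) (y : Fin (k + r) → Y) :
    ((Finset.univ.filter fun H => y ∈ confusing p μ w δ q m H z).card : ℝ) ≤
      Fintype.card (GL (Fin (k + r)) (ZMod 2)) *
        (E * 2 ^ k / ((2 ^ (k + r) - 1) * (2 ^ (k + r) - 2))) := by
  have hpow : (4 : ℝ) ≤ 2 ^ (k + r) := by
    calc (4 : ℝ) = 2 ^ 2 := by norm_num
      _ ≤ _ := pow_le_pow_right₀ (by norm_num) hk
  have hpowN : 4 ≤ 2 ^ (k + r) := by exact_mod_cast hpow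
  have hden : (0 : ℝ) < (2 ^ (k + r) - 1) * (2 ^ (k + r) - 2) :=
    mul_pos (by linarith) (by linarith)
  by_cases hyz : OutputTypical μ w δ q z y ∧ letterWeight p (Sum.map y q) z ≠ 0
  swap
  · rw [Finset.filter_eq_empty_iff.2 fun H _ h => hyz h.1, Finset.card_empty, Nat.cast_zero]
    positivity
  set D := Finset.univ.filter fun z' =>
    letterWeight p (Sum.map y q) z ≤ letterWeight p (Sum.map y q) z' with hD
  have hDcard : (D.card : ℝ) ≤ E := hgap y z hyz.1 hyz.2
  have h1 := Nat.cast_le (α := ℝ).2 (card_linked_and_exists_le hm z D)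
  push_cast [Nat.cast_sub (show 1 ≤ 2 ^ (k + r) by omega),
    Nat.cast_sub (show 2 ≤ 2 ^ (k + r) by omega)] at h1
  rw [mul_div_assoc', le_div_iff₀ hden]
  have hset : (Finset.univ.filter fun H => y ∈ confusing p μ w δ q m H z) =
      Finset.univ.filter fun H => Linked H m z ∧ ∃ x, x ≠ 0 ∧ x ≠ z ∘ Sum.inl ∧
        Sum.elim x (parityBits H x) ∈ D := by
    refine Finset.filter_congr fun H _ => ?_
    change (_ ∧ _) ↔ _
    rw [and_iff_right hyz]
    simp only [hD, Finset.mem_filter, Finset.mem_univ, true_and, withParity]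
  rw [hset]
  refine h1.trans ?_
  calc (D.card : ℝ) * (2 ^ k * Fintype.card (GL (Fin (k + r)) (ZMod 2)))
      ≤ E * (2 ^ k * Fintype.card (GL (Fin (k + r)) (ZMod 2))) :=
        mul_le_mul_of_nonneg_right hDcard (by positivity)
    _ = _ := by ring

open Classical in
set_option maxHeartbeats 1000000 in
/-- For typical states and parity biases and a nonzero message, a decoding error and an atypical
codeword are both unlikely. -/
theorem exists_run_bound [Finite Y] {R : ℝ} (hR1 : R < 1) {PS : PMF S} {PY : S → ZMod 2 → PMF Y}
    {pe : S → I} {pd : Y → I} {PQ : PMF I} [Fintype PS.support] [Fintype PQ.support]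
    {W : S → PMF (ZMod 2)} {U : I → PMF (ZMod 2)}
    (hw₀ : encParam PS PQ W U ∈ compatible (encBias PS PQ pe))
    (hfeas : Real.log 2 ≤ ent (encMass R PS PQ) (encParam PS PQ W U))
    (huniq : ∀ w ∈ compatible (encBias PS PQ pe), Real.log 2 ≤ ent (encMass R PS PQ) w →
      linCost (natCost (encBias PS PQ pe)) (encMass R PS PQ) w ≤
        linCost (natCost (encBias PS PQ pe)) (encMass R PS PQ) (encParam PS PQ W U) →
      w = encParam PS PQ W U)
    (hslack : (∃ u ∈ compatible (encBias PS PQ pe), Real.log 2 < ent (encMass R PS PQ) u) ∨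
      ((∀ a, encBias PS PQ pe (Sum.inl a) ≠ 0 ∧ encBias PS PQ pe (Sum.inl a) ≠ 1) ∧
        (∀ b, encBias PS PQ pe (Sum.inr b) = 0 ∨ encBias PS PQ pe (Sum.inr b) = 1) ∧
        ∑ a, encMass R PS PQ (Sum.inl a) = 1))
    (hnd : ∀ (a : PS.support) b, bitProb (pe a) b ≠ 0 → ∀ y ∈ (PY a b).support,
      bitProb (pd y) b ≠ 0)
    (hdec : ∀ [Fintype Y], ∀ w ∈ compatible (decBias PQ pd),
      (1 - R) * Real.log 2 ≤ ent (decMass R PS PY PQ W) w →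
      linCost (natCost (decBias PQ pd)) (decMass R PS PY PQ W) (decParam PS PY PQ W U) <
        linCost (natCost (decBias PQ pd)) (decMass R PS PY PQ W) w)
    (hzero : ∀ [Fintype Y], (∀ t, 0 < decMass R PS PY PQ W t → decBias PQ pd t ≠ 1) →
      linCost (natCost (decBias PQ pd)) (decMass R PS PY PQ W) (decParam PS PY PQ W U) <
        linCost (natCost (decBias PQ pd)) (decMass R PS PY PQ W) 0)
    (τ : TieBreak) {ε η : ℝ} (hε : 0 < ε) (hη : 0 < η) :
    ∃ δ > 0, ∃ N₀ : ℕ, ∀ (k r : ℕ) (s : Fin (k + r) → PS.support) (q : Fin r → PQ.support),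
      N₀ ≤ k + r → |(r : ℝ) / (k + r : ℕ) - (1 - R)| ≤ δ →
      (∀ t, |(letterCount (Sum.map s q) t : ℝ) / (k + r : ℕ) - encMass R PS PQ t| ≤ δ) →
      ∀ m : Fin k → ZMod 2, m ≠ 0 →
      ((PMF.uniformOfFintype (GL (Fin (k + r)) (ZMod 2))).bind fun H =>
        (prodPMF fun i => PY (s i)
          (encode τ pe H (fun j => (q j : I)) m (fun i => (s i : S)) i)).map fun y =>
        ({ message := m, state := fun i => s i, parityBias := fun j => q j, matrix := H,
           codeword := encode τ pe H (fun j => (q j : I)) m (fun i => (s i : S)),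
           output := y } : Run S Y k r)).toOuterMeasure
        ({ω | decode τ pd ω.matrix ω.parityBias ω.output ≠ ω.message} ∪
          {ω | ∃ (a : S) (b : ZMod 2),
            ε ≤ |empirical ω.state ω.codeword a b - (PS a * W a b).toReal|}) ≤
        ENNReal.ofReal η := by
  have := Fintype.ofFinite Y
  have hμ := encMass_pos hR1 PS PQ
  set μ := encMass R PS PQ with hμdef
  set w₀ := encParam PS PQ W U with hw₀def
  set pE := encBias PS PQ pe with hpE
  set pD := decBias PQ pd with hpD
  set μD := decMass R PS PY PQ W with hμD
  set wD := decParam PS PY PQ W U with hwD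
  have hlog : 0 < Real.log 2 := Real.log_pos one_lt_two
  obtain ⟨γ, hγ, δd, hδd, hgap⟩ := exists_decoder_gap hdec hzero
  -- Tightness limits the typical vectors to `exp (N (log 2 + γ / 4))`, which the probability of
  -- about `2^(-N)` of being linked nearly cancels; the rest is covered by the decoder's margin `γ`.
  have htight := ent_eq_log_two hw₀ hfeas huniq
  obtain ⟨δt, hδt, htyp⟩ := exists_card_type_le (p := pE) hμ
    (show ent μ w₀ < Real.log 2 + γ / 4 by rw [htight]; linarith)
  obtain ⟨ε₁, hε₁, N₁, hout⟩ := exists_outputTypical R PS PY PQ W U hδd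
    (show 0 < η / 4 by positivity)
  -- One tolerance for the selected codeword serves the count of typical vectors, the channel
  -- outputs and the empirical distribution.
  set εe := min (min δt ε₁) (ε / 4) with hεe
  have hεe0 : 0 < εe := by positivity
  obtain ⟨δe, hδe, Ne, hgood⟩ := exists_encoderGood hμ hw₀ hfeas huniq hslack hεe0
    (show 0 < η / 4 by positivity)
  obtain ⟨N₂, hN₂⟩ := exists_nat_mul_exp_neg_le 4 (half_pos hγ) (show 0 < η / 4 by positivity)
  refine ⟨min (min δe εe) (γ / 4 / Real.log 2), by positivity, max (max Ne N₁) (max N₂ 2),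
    fun k r s q hN hr hl m hm => ?_⟩
  simp only [max_le_iff] at hN
  obtain ⟨⟨hNe, hN1⟩, hN2, hk2⟩ := hN
  have hle : ∀ t, |(letterCount (Sum.map s q) t : ℝ) / (k + r : ℕ) - μ t| ≤ εe := fun t =>
    (hl t).trans ((min_le_left _ _).trans (min_le_right _ _))
  have hr' : |(r : ℝ) / (k + r : ℕ) - (1 - R)| * Real.log 2 ≤ γ / 4 := by
    rw [← le_div_iff₀ hlog]
    exact hr.trans (min_le_right _ _)
  have hεt : εe ≤ δt := (min_le_left _ _).trans (min_le_left _ _)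
  have hεo : εe ≤ ε₁ := (min_le_left _ _).trans (min_le_right _ _)
  have hε4 : εe ≤ ε / 4 := min_le_right _ _
  set l := Sum.map s q with hldef
  set x : GL (Fin (k + r)) (ZMod 2) → Fin (k + r) → ZMod 2 := fun H =>
    encode τ pe H (fun j => (q j : I)) m (fun i => (s i : S)) with hx
  set P : (Fin (k + r) ⊕ Fin r → ZMod 2) → PMF (Fin (k + r) → Y) := fun z =>
    prodPMF fun i => PY (s i) (z (Sum.inl i)) with hP
  set typ : Finset (Fin (k + r) ⊕ Fin r → ZMod 2) := Finset.univ.filter fun z =>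
    letterWeight pE l z ≠ 0 ∧
      ∀ t, |(onesCount l t z : ℝ) / (k + r : ℕ) - μ t * w₀ t| ≤ εe with htypdef
  have hgapk := fun (y : Fin (k + r) → Y) z (hy : OutputTypical μD wD δd q z y)
    (hz : letterWeight pD (Sum.map y q) z ≠ 0) =>
      hgap (Sum.map y q) (k + r) (by omega) hy.1 z hz hy.2
  have hF : ∀ H ∉ {H | ¬ EncoderGood pE μ w₀ εe l m H}, withParity H (x H) ∈ typ ∧
      ((prodPMF fun i => PY (s i) (x H i)).map fun y =>
        ({ message := m, state := fun i => s i, parityBias := fun j => q j, matrix := H,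
           codeword := x H, output := y } : Run S Y k r)).toOuterMeasure
        ({ω | decode τ pd ω.matrix ω.parityBias ω.output ≠ ω.message} ∪
          {ω | ∃ (a : S) (b : ZMod 2),
            ε ≤ |empirical ω.state ω.codeword a b - (PS a * W a b).toReal|}) ≤
        ENNReal.ofReal (η / 4) +
          (P (withParity H (x H))).toOuterMeasure
            (confusing pD μD wD δd q m H (withParity H (x H))) := by
    intro H hH
    simp only [Set.mem_ofPred_eq, not_not] at hH
    obtain ⟨hlink, hwt, hmax⟩ := encode_spec τ pe pE l (fun i => (s i : S)) (fun j => (q j : I))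
      (fun _ => rfl) (fun _ => rfl) m H hH.1
    have htt := hH.2 _ hlink hmax
    have hmem : withParity H (x H) ∈ typ :=
      Finset.mem_filter.2 ⟨Finset.mem_univ _, hwt, fun t => (htt t).le⟩
    refine ⟨hmem, ?_⟩
    rw [PMF.toOuterMeasure_map_apply]
    refine le_trans ?_ (add_le_add_left (hout k r s q _ hN1 (fun t => (hle t).trans hεo)
      fun t => (htt t).le.trans hεo) _)
    refine le_trans ?_ (MeasureTheory.measure_union_le _ _)
    refine PMF.toOuterMeasure_mono _ ?_
    rintro y ⟨hy, hysupp⟩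
    exact bad_event_subset hnd τ hε (fun t => (hle t).trans hε4) hlink hwt
      (fun t => (htt t).le.trans hε4) (fun y z h h' => (hgapk y z h h').2) hysupp hy
  have hmain := uniform_bind_le _ _ _ (fun H => withParity H (x H)) typ P _ hF fun z _ y =>
    card_confusing_le hk2 hm (fun y z h h' => (hgapk y z h h').1) (Real.exp_pos _).le z y
  refine hmain.trans ?_
  have hbad : (PMF.uniformOfFintype (GL (Fin (k + r)) (ZMod 2))).toOuterMeasure
      {H | ¬ EncoderGood pE μ w₀ εe l m H} ≤ ENNReal.ofReal (η / 4) := by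
    refine toOuterMeasure_uniform_le _ ?_
    exact hgood k r s q hNe (fun t => (hl t).trans ((min_le_left _ _).trans (min_le_left _ _))) m hm
  have htypcard : (typ.card : ℝ) ≤ Real.exp ((k + r : ℕ) * (Real.log 2 + γ / 4)) :=
    htyp l (k + r) (by omega) (fun t => (hle t).trans hεt) typ
      (fun z hz => (Finset.mem_filter.1 hz).2.1)
      (fun z hz t => ((Finset.mem_filter.1 hz).2.2 t).trans hεt)
  set β : ℝ := Real.exp ((k + r : ℕ) * ((1 - R) * Real.log 2 - γ)) * 2 ^ k /
        ((2 ^ (k + r) - 1) * (2 ^ (k + r) - 2)) with hβ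
  have hβ0 : 0 ≤ β := by
    have hpow : (4 : ℝ) ≤ 2 ^ (k + r) := by
      calc (4 : ℝ) = 2 ^ 2 := by norm_num
        _ ≤ _ := pow_le_pow_right₀ (by norm_num) hk2
    refine div_nonneg (by positivity) (mul_nonneg ?_ ?_) <;> linarith
  have hprod : (typ.card : ℝ≥0∞) * ENNReal.ofReal β ≤ ENNReal.ofReal (η / 4) := by
    rw [← ENNReal.ofReal_natCast, ← ENNReal.ofReal_mul (by positivity)]
    refine ENNReal.ofReal_le_ofReal ?_
    exact (mul_le_mul_of_nonneg_right htypcard hβ0).trans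
      ((union_bound_le hk2 hr').trans (hN₂ (k + r) hN2))
  calc _ ≤ ENNReal.ofReal (η / 4) + ENNReal.ofReal (η / 4) + ENNReal.ofReal (η / 4) :=
        add_le_add (add_le_add_left hbad _) hprod
    _ ≤ ENNReal.ofReal η := by
        rw [← ENNReal.ofReal_add (by positivity) (by positivity),
          ← ENNReal.ofReal_add (by positivity) (by positivity)]
        exact ENNReal.ofReal_le_ofReal (by linarith)

end

section

/-! ### The hypotheses in terms of letters -/

variable {S Y : Type*}

theorem toReal_expect_of_ne_top {α : Type*} (P : PMF α) [Fintype P.support] {f : α → ℝ≥0∞}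
    (hf : expect P f ≠ ⊤) :
    (expect P f).toReal = ∑ a : P.support, (P a).toReal * (f a).toReal := by
  rw [expect_eq_sum] at hf ⊢
  rw [ENNReal.toReal_sum fun (a : P.support) ha =>
    ne_top_of_le_ne_top hf (Finset.single_le_sum (f := fun a : P.support => P a * f a)
      (fun _ _ => zero_le) ha)]
  simp

theorem expect_eq_sum_univ {α : Type*} [Fintype α] (P : PMF α) (f : α → ℝ≥0∞) :
    expect P f = ∑ a, P a * f a := tsum_fintype _

theorem toReal_expect_univ_of_ne_top {α : Type*} [Fintype α] (P : PMF α) {f : α → ℝ≥0∞}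
    (hf : expect P f ≠ ⊤) :
    (expect P f).toReal = ∑ a, (P a).toReal * (f a).toReal := by
  rw [expect_eq_sum_univ] at hf ⊢
  rw [ENNReal.toReal_sum fun a ha =>
    ne_top_of_le_ne_top hf (Finset.single_le_sum (f := fun a => P a * f a)
      (fun _ _ => zero_le) ha)]
  simp

theorem expect_ne_top {α : Type*} (P : PMF α) [Fintype P.support] {f : α → ℝ≥0∞}
    (hf : ∀ a ∈ P.support, f a ≠ ⊤) : expect P f ≠ ⊤ := by
  rw [expect_eq_sum]
  exact ENNReal.sum_ne_top.2 fun a _ => ENNReal.mul_ne_top (P.apply_ne_top _) (hf a a.2)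

theorem ne_top_of_expect_ne_top {α : Type*} {P : PMF α} {f : α → ℝ≥0∞} (hf : expect P f ≠ ⊤)
    {a : α} (ha : a ∈ P.support) : f a ≠ ⊤ := by
  intro h
  refine hf (ENNReal.tsum_eq_top_of_eq_top ⟨a, ?_⟩)
  rw [h, ENNReal.mul_top ((PMF.mem_support_iff _ _).1 ha)]

theorem negLog_eq (t : I) :
    negLog t = if (t : ℝ) = 0 then ⊤ else ENNReal.ofReal (-Real.log t / Real.log 2) := by
  unfold negLog
  have : t = 0 ↔ (t : ℝ) = 0 := by rw [Subtype.ext_iff]; rfl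
  simp only [this, Real.logb, neg_div]

theorem crossEntropy_bit (b : ZMod 2) (t : I) :
    crossEntropy (bit b) t = if bitProb t b = 0 then ⊤ else
      ENNReal.ofReal (-Real.log (bitProb t b) / Real.log 2) := by
  rcases zmod_two_cases b with rfl | rfl
  · have h : bitProb t 0 = (σ t : I) := by simp
    rw [h, ← negLog_eq]
    simp [crossEntropy, bit]
  · simp [crossEntropy, bit, negLog_eq]

theorem crossEntropy_bit_eq_top_iff (b : ZMod 2) (t : I) :
    crossEntropy (bit b) t = ⊤ ↔ bitProb t b = 0 := by
  rw [crossEntropy_bit]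
  split_ifs with h <;> simp [h]

theorem bitProb_le_one (t : I) (b : ZMod 2) : bitProb t b ≤ 1 := by
  unfold bitProb
  split_ifs
  · exact t.2.2
  · linarith [t.2.1]

/-- At probability zero both sides are `0` by convention, so finiteness of the cross entropy is
tracked separately. -/
theorem toReal_crossEntropy_bit (b : ZMod 2) (t : I) :
    (crossEntropy (bit b) t).toReal = -Real.log (bitProb t b) / Real.log 2 := by
  rw [crossEntropy_bit]
  split_ifs with h
  · simp [h]
  · rw [ENNReal.toReal_ofReal]
    refine div_nonneg (neg_nonneg.2
      (Real.log_nonpos (bitProb_nonneg t.2 b) (bitProb_le_one t b))) ?_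
    exact (Real.log_pos one_lt_two).le

/-- Since `0 * ∞ = 0`, the expectation is finite exactly when no bit of zero bias is charged. This
turns finite cost into membership in `compatible`. -/
theorem expect_crossEntropy_ne_top_iff (P : PMF (ZMod 2)) (t : I) :
    (expect P fun b => crossEntropy (bit b) t) ≠ ⊤ ↔
      (t = 0 → (P 1).toReal = 0) ∧ (t = 1 → (P 1).toReal = 1) := by
  have hP := sum_pmf_toReal P
  rw [sum_zmod_two] at hP
  have key : (expect P fun b => crossEntropy (bit b) t) ≠ ⊤ ↔
      ∀ b, bitProb t b = 0 → (P b).toReal = 0 := by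
    rw [expect_eq_sum_univ, ENNReal.sum_ne_top]
    refine forall_congr' fun b => ?_
    rw [Ne, ENNReal.mul_eq_top, crossEntropy_bit_eq_top_iff, ENNReal.toReal_eq_zero_iff]
    have := P.apply_ne_top b
    simp only [Finset.mem_univ, true_imp_iff, this, false_and, or_false]
    tauto
  rw [key]
  have h0 : t = 0 ↔ (t : ℝ) = 0 := by rw [Subtype.ext_iff]; rfl
  have h1 : t = 1 ↔ (t : ℝ) = 1 := by rw [Subtype.ext_iff]; rfl
  rw [h0, h1]
  constructor
  · intro h
    refine ⟨fun ht => h 1 (by simpa using ht), fun ht => ?_⟩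
    have := h 0 (by simp [ht])
    linarith
  · rintro ⟨ha, hb⟩ b hbt
    rcases zmod_two_cases b with rfl | rfl
    · rw [bitProb_zero] at hbt
      have := hb (by linarith)
      linarith
    · exact ha (by simpa using hbt)

theorem toReal_expect_crossEntropy {P : PMF (ZMod 2)} {t : I}
    (h : (expect P fun b => crossEntropy (bit b) t) ≠ ⊤) :
    (expect P fun b => crossEntropy (bit b) t).toReal =
      ((P 1).toReal * -Real.log (bitProb t 1) + (1 - (P 1).toReal) * -Real.log (bitProb t 0)) /
        Real.log 2 := by
  rw [toReal_expect_univ_of_ne_top P h, sum_zmod_two, toReal_crossEntropy_bit,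
    toReal_crossEntropy_bit, pmf_bit_toReal P 0, bitProb_zero]
  ring

theorem entropy_eq (P : PMF (ZMod 2)) :
    entropy P = ENNReal.ofReal (Real.binEntropy (P 1).toReal / Real.log 2) := by
  have hlog : 0 < Real.log 2 := Real.log_pos one_lt_two
  have h1 := pmf_toReal_mem_Icc P 1
  have h0 := pmf_toReal_mem_Icc P 0
  rw [entropy, sum_zmod_two, ← ENNReal.ofReal_add
    (div_nonneg (Real.negMulLog_nonneg h0.1 h0.2) hlog.le)
    (div_nonneg (Real.negMulLog_nonneg h1.1 h1.2) hlog.le),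
    Real.binEntropy_eq_negMulLog_add_negMulLog_one_sub, pmf_bit_toReal P 0, bitProb_zero]
  congr 1
  ring

/-- The Bernoulli distribution on bits. -/
def bernPMF (θ : ℝ) : PMF (ZMod 2) :=
  if h : θ ∈ Set.Icc (0 : ℝ) 1 then
    PMF.ofFintype (fun b => ENNReal.ofReal (bitProb θ b)) (by
      rw [← ENNReal.ofReal_sum_of_nonneg fun b _ => bitProb_nonneg h b, sum_bitProb,
        ENNReal.ofReal_one])
  else PMF.pure 0

theorem bernPMF_one_toReal {θ : ℝ} (h : θ ∈ Set.Icc (0 : ℝ) 1) : (bernPMF θ 1).toReal = θ := by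
  rw [bernPMF, dif_pos h, PMF.ofFintype_apply, bitProb_one, ENNReal.toReal_ofReal h.1]

open Classical in
/-- Conditional distributions with given parameters on the support of `P`. -/
def condBern {α : Type*} (P : PMF α) (w : P.support → ℝ) (a : α) : PMF (ZMod 2) :=
  if h : a ∈ P.support then bernPMF (w ⟨a, h⟩) else PMF.pure 0

theorem condBern_one_toReal {α : Type*} {P : PMF α} {w : P.support → ℝ} (a : P.support)
    (h : w a ∈ Set.Icc (0 : ℝ) 1) : (condBern P w a 1).toReal = w a := by
  rw [condBern, dif_pos a.2, bernPMF_one_toReal h]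

theorem toReal_condEntropy {α : Type*} (P : PMF α) [Fintype P.support] (W : α → PMF (ZMod 2)) :
    condEntropy P W ≠ ⊤ ∧ (condEntropy P W).toReal =
      (∑ a : P.support, (P a).toReal * Real.binEntropy (W a 1).toReal) / Real.log 2 := by
  have hlog : 0 < Real.log 2 := Real.log_pos one_lt_two
  have h : condEntropy P W ≠ ⊤ := expect_ne_top P fun a _ => by
    rw [entropy_eq]; exact ENNReal.ofReal_ne_top
  refine ⟨h, ?_⟩
  rw [condEntropy, toReal_expect_of_ne_top P h, Finset.sum_div]
  refine Finset.sum_congr rfl fun a _ => ?_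
  have := pmf_toReal_mem_Icc (W a) 1
  rw [entropy_eq, ENNReal.toReal_ofReal
    (div_nonneg (Real.binEntropy_nonneg this.1 this.2) hlog.le), mul_div_assoc]

theorem toReal_expCrossEntropy {α : Type*} {P : PMF α} [Fintype P.support]
    {W : α → PMF (ZMod 2)} {p : α → I} (h : expCrossEntropy P W p ≠ ⊤) :
    (expCrossEntropy P W p).toReal = (∑ a : P.support, (P a).toReal *
      ((W a 1).toReal * -Real.log (bitProb (p a) 1) +
        (1 - (W a 1).toReal) * -Real.log (bitProb (p a) 0))) / Real.log 2 := by
  rw [expCrossEntropy] at h ⊢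
  rw [toReal_expect_of_ne_top P h, Finset.sum_div]
  refine Finset.sum_congr rfl fun a _ => ?_
  rw [toReal_expect_crossEntropy (ne_top_of_expect_ne_top h a.2), mul_div_assoc]

theorem expCrossEntropy_ne_top_iff {α : Type*} {P : PMF α} [Fintype P.support]
    {W : α → PMF (ZMod 2)} {p : α → I} :
    expCrossEntropy P W p ≠ ⊤ ↔ ∀ a : P.support,
      (p a = 0 → (W a 1).toReal = 0) ∧ (p a = 1 → (W a 1).toReal = 1) := by
  constructor
  · intro h a
    exact (expect_crossEntropy_ne_top_iff _ _).1 (ne_top_of_expect_ne_top h a.2)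
  · intro h
    exact expect_ne_top P fun a ha => (expect_crossEntropy_ne_top_iff _ _).2 (h ⟨a, ha⟩)

theorem encParam_condBern {PS : PMF S} {PQ : PMF I} {w : PS.support ⊕ PQ.support → ℝ}
    (hw : ∀ t, w t ∈ Set.Icc (0 : ℝ) 1) :
    encParam PS PQ (condBern PS (w ∘ Sum.inl)) (condBern PQ (w ∘ Sum.inr)) = w := by
  funext t
  rcases t with a | t
  · exact condBern_one_toReal a (hw _)
  · exact condBern_one_toReal t (hw _)

/-- If the minimum were infinite, every feasible pair would be a minimizer. Uniform `X` is feasible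
with `V` constantly `0` and with `V` constantly `1`, so uniqueness would fail. -/
theorem encCost_ne_top_of_isUniqueMinimizer {R : ℝ} {PS : PMF S} {pe : S → I} {PQ : PMF I}
    {W : S → PMF (ZMod 2)} {U : I → PMF (ZMod 2)} (h : IsUniqueMinimizer R PS pe PQ W U) :
    encCost R PS pe PQ W U ≠ ⊤ := by
  intro htop
  have hall : ∀ W' U', EncFeasible R PS PQ W' U' → IsMinimizer R PS pe PQ W' U' := by
    intro W' U' hf
    refine ⟨hf, fun W'' U'' hf'' => ?_⟩
    have := h.1.2 W'' U'' hf''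
    rw [htop, top_le_iff] at this
    rw [this]
    exact le_top
  have hfeas : ∀ b : ZMod 2, EncFeasible R PS PQ (fun _ => bernPMF 2⁻¹) fun _ => PMF.pure b := by
    intro b
    have : condEntropy PS (fun _ => bernPMF 2⁻¹) = 1 := by
      have hlog : 0 < Real.log 2 := Real.log_pos one_lt_two
      rw [condEntropy, entropy_eq, bernPMF_one_toReal (by norm_num), Real.binEntropy_two_inv,
        div_self hlog.ne', expect, ENNReal.tsum_mul_right, PS.tsum_coe]
      simp
    rw [EncFeasible, this]
    exact le_self_add
  obtain ⟨t, ht⟩ := PQ.support_nonempty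
  have h0 := (h.2 _ _ (hall _ _ (hfeas 0))).2 t ht
  have h1 := (h.2 _ _ (hall _ _ (hfeas 1))).2 t ht
  have := congrArg (fun P : PMF (ZMod 2) => P 1) (h0.trans h1.symm)
  simp at this

/-! ### The encoder's problem and nondegeneracy -/

section

variable {R : ℝ} {PS : PMF S} {pe : S → I} {PQ : PMF I} [Fintype PS.support] [Fintype PQ.support]
  {W : S → PMF (ZMod 2)} {U : I → PMF (ZMod 2)}

theorem encFeasible_iff (hR : R < 1) :
    EncFeasible R PS PQ W U ↔ Real.log 2 ≤ ent (encMass R PS PQ) (encParam PS PQ W U) := by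
  have hlog : 0 < Real.log 2 := Real.log_pos one_lt_two
  obtain ⟨h1, h1'⟩ := toReal_condEntropy PS W
  obtain ⟨h2, h2'⟩ := toReal_condEntropy PQ U
  have h3 : ENNReal.ofReal (1 - R) * condEntropy PQ U ≠ ⊤ :=
    ENNReal.mul_ne_top ENNReal.ofReal_ne_top h2
  rw [EncFeasible, ← ENNReal.toReal_le_toReal ENNReal.one_ne_top (ENNReal.add_ne_top.2 ⟨h1, h3⟩),
    ENNReal.toReal_add h1 h3, ENNReal.toReal_mul, h1', h2',
    ENNReal.toReal_ofReal (by linarith), ENNReal.toReal_one, mul_div_assoc', ← add_div,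
    le_div_iff₀ hlog, one_mul, ent, Fintype.sum_sum_type]
  simp only [encMass, encParam, Sum.elim_inl, Sum.elim_inr, Finset.mul_sum, mul_assoc]

theorem encCost_ne_top_iff (hR : R < 1) :
    encCost R PS pe PQ W U ≠ ⊤ ↔ encParam PS PQ W U ∈ compatible (encBias PS PQ pe) := by
  have hR' : ENNReal.ofReal (1 - R) ≠ 0 := by simpa using hR
  have h : ENNReal.ofReal (1 - R) * expCrossEntropy PQ U id ≠ ⊤ ↔
      expCrossEntropy PQ U id ≠ ⊤ := by
    refine ⟨fun h h' => h (by rw [h', ENNReal.mul_top hR']),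
      ENNReal.mul_ne_top ENNReal.ofReal_ne_top⟩
  rw [encCost, ENNReal.add_ne_top, h, expCrossEntropy_ne_top_iff, expCrossEntropy_ne_top_iff]
  constructor
  · rintro ⟨h1, h2⟩ (a | t)
    · exact ⟨pmf_toReal_mem_Icc _ _, h1 a⟩
    · exact ⟨pmf_toReal_mem_Icc _ _, h2 t⟩
  · intro h
    exact ⟨fun a => (h (Sum.inl a)).2, fun t => (h (Sum.inr t)).2⟩

theorem toReal_encCost (hR : R < 1) (h : encCost R PS pe PQ W U ≠ ⊤) :
    (encCost R PS pe PQ W U).toReal =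
      linCost (natCost (encBias PS PQ pe)) (encMass R PS PQ) (encParam PS PQ W U) /
        Real.log 2 := by
  have hR' : ENNReal.ofReal (1 - R) ≠ 0 := by simpa using hR
  rw [encCost] at h ⊢
  obtain ⟨h1, h2⟩ := ENNReal.add_ne_top.1 h
  have h3 : expCrossEntropy PQ U id ≠ ⊤ := fun h' => h2 (by rw [h', ENNReal.mul_top hR'])
  rw [ENNReal.toReal_add h1 h2, ENNReal.toReal_mul, toReal_expCrossEntropy h1,
    toReal_expCrossEntropy h3, ENNReal.toReal_ofReal (by linarith), linCost,
    Fintype.sum_sum_type, mul_div_assoc', ← add_div]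
  simp only [encMass, encParam, natCost, encBias, Sum.elim_inl, Sum.elim_inr, Finset.mul_sum,
    mul_assoc, id]

/-- The unique minimizer in terms of letters. -/
theorem letters_of_isUniqueMinimizer (hR : R < 1) (h : IsUniqueMinimizer R PS pe PQ W U) :
    encParam PS PQ W U ∈ compatible (encBias PS PQ pe) ∧
    Real.log 2 ≤ ent (encMass R PS PQ) (encParam PS PQ W U) ∧
    ∀ w ∈ compatible (encBias PS PQ pe), Real.log 2 ≤ ent (encMass R PS PQ) w →
      linCost (natCost (encBias PS PQ pe)) (encMass R PS PQ) w ≤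
        linCost (natCost (encBias PS PQ pe)) (encMass R PS PQ) (encParam PS PQ W U) →
      w = encParam PS PQ W U := by
  have hlog : 0 < Real.log 2 := Real.log_pos one_lt_two
  have hfin := encCost_ne_top_of_isUniqueMinimizer h
  refine ⟨(encCost_ne_top_iff hR).1 hfin, (encFeasible_iff hR).1 h.1.1, fun w hw hent hle => ?_⟩
  have hpar := encParam_condBern fun t => (hw t).1
  set W' := condBern PS (w ∘ Sum.inl)
  set U' := condBern PQ (w ∘ Sum.inr)
  have hfeas : EncFeasible R PS PQ W' U' := (encFeasible_iff hR).2 (by rwa [hpar])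
  have hfin' : encCost R PS pe PQ W' U' ≠ ⊤ := (encCost_ne_top_iff hR).2 (by rwa [hpar])
  have hle' : encCost R PS pe PQ W' U' ≤ encCost R PS pe PQ W U := by
    rw [← ENNReal.toReal_le_toReal hfin' hfin, toReal_encCost hR hfin', toReal_encCost hR hfin,
      hpar]
    exact div_le_div_of_nonneg_right hle hlog.le
  have hmin' : IsMinimizer R PS pe PQ W' U' :=
    ⟨hfeas, fun W'' U'' hf => hle'.trans (h.1.2 W'' U'' hf)⟩
  obtain ⟨h1, h2⟩ := h.2 W' U' hmin'
  rw [← hpar]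
  funext t
  rcases t with a | t
  · simp only [encParam, Sum.elim_inl]
    rw [h1 a a.2]
  · simp only [encParam, Sum.elim_inr]
    rw [h2 t t.2]

open Classical in
theorem toReal_toOuterMeasure {α : Type*} (P : PMF α) [Fintype P.support] (s : Set α) :
    (P.toOuterMeasure s).toReal = ∑ a : P.support, (P a).toReal * if (a : α) ∈ s then 1 else 0 := by
  have h : P.toOuterMeasure s = expect P fun a => if a ∈ s then 1 else 0 := by
    rw [PMF.toOuterMeasure_apply, expect]
    refine tsum_congr fun a => ?_
    rw [Set.indicator_apply]
    split_ifs <;> simp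
  rw [h, toReal_expect P fun a => by split_ifs <;> simp]
  refine Finset.sum_congr rfl fun a _ => ?_
  split_ifs <;> simp

theorem toOuterMeasure_ne_top {α : Type*} (P : PMF α) (s : Set α) : P.toOuterMeasure s ≠ ⊤ :=
  ne_top_of_le_ne_top ENNReal.one_ne_top ((PMF.toOuterMeasure_mono _ (Set.subset_univ _)).trans
    ((PMF.toOuterMeasure_apply_eq_one_iff _ _).2 (Set.subset_univ _)).le)

theorem sum_support_toReal {α : Type*} (P : PMF α) [Fintype P.support] :
    ∑ a : P.support, (P a).toReal = 1 := by
  have := toReal_expect P (f := fun _ => 1) (by simp)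
  simp only [ENNReal.toReal_one, mul_one, expect] at this
  rw [← this, P.tsum_coe, ENNReal.toReal_one]

theorem mem_Ioo_iff (t : I) : t ∈ Set.Ioo (0 : I) 1 ↔ t ≠ 0 ∧ t ≠ 1 := by
  rw [Set.mem_Ioo, unitInterval.pos_iff_ne_zero, unitInterval.lt_one_iff_ne_one]

/-- Nondegeneracy of the encoder in terms of letters. -/
theorem letters_of_encNondegenerate (hR : R < 1) (h : EncNondegenerate R PS pe PQ) :
    (∃ u ∈ compatible (encBias PS PQ pe), Real.log 2 < ent (encMass R PS PQ) u) ∨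
      ((∀ a, encBias PS PQ pe (Sum.inl a) ≠ 0 ∧ encBias PS PQ pe (Sum.inl a) ≠ 1) ∧
        (∀ b, encBias PS PQ pe (Sum.inr b) = 0 ∨ encBias PS PQ pe (Sum.inr b) = 1) ∧
        ∑ a, encMass R PS PQ (Sum.inl a) = 1) := by
  classical
  have hlog : 0 < Real.log 2 := Real.log_pos one_lt_two
  by_cases h2 : 1 < PS.toOuterMeasure {a | pe a ∈ Set.Ioo (0 : I) 1} +
      ENNReal.ofReal (1 - R) * PQ.toOuterMeasure (Set.Ioo (0 : I) 1)
  · left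
    have h3 : ENNReal.ofReal (1 - R) * PQ.toOuterMeasure (Set.Ioo (0 : I) 1) ≠ ⊤ :=
      ENNReal.mul_ne_top ENNReal.ofReal_ne_top (toOuterMeasure_ne_top _ _)
    rw [← ENNReal.toReal_lt_toReal ENNReal.one_ne_top
      (ENNReal.add_ne_top.2 ⟨toOuterMeasure_ne_top _ _, h3⟩),
      ENNReal.toReal_add (toOuterMeasure_ne_top _ _) h3, ENNReal.toReal_mul,
      toReal_toOuterMeasure, toReal_toOuterMeasure, ENNReal.toReal_ofReal (by linarith),
      ENNReal.toReal_one] at h2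
    set p := encBias PS PQ pe with hp
    -- Free letters get a uniform bit and forced letters the forced one; the entropy is `log 2`
    -- times the mass of the free letters.
    refine ⟨fun t => if p t = 0 then 0 else if p t = 1 then 1 else 2⁻¹, fun t => ?_, ?_⟩
    · refine ⟨?_, fun h => by simp [h], fun h => by simp [h]⟩
      dsimp only
      split_ifs <;> norm_num
    · have hent : ∀ t, Real.binEntropy (if p t = 0 then 0 else if p t = 1 then 1 else 2⁻¹) =
          Real.log 2 * if p t ∈ Set.Ioo (0 : I) 1 then 1 else 0 := by
        intro t
        by_cases h0 : p t = 0
        · simp [h0]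
        by_cases h1 : p t = 1
        · simp [h1]
        rw [if_neg h0, if_neg h1, if_pos ((mem_Ioo_iff _).2 ⟨h0, h1⟩), Real.binEntropy_two_inv,
          mul_one]
      rw [ent]
      simp only [hent]
      rw [Fintype.sum_sum_type]
      simp only [encMass, hp, encBias, Sum.elim_inl, Sum.elim_inr]
      have h4 := mul_lt_mul_of_pos_left h2 hlog
      rw [mul_one] at h4
      refine h4.trans_eq ?_
      rw [mul_add, Finset.mul_sum, Finset.mul_sum]
      congr 1
      · refine Finset.sum_congr rfl fun a _ => ?_
        rw [Set.mem_ofPred_eq]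
        split_ifs <;> ring
      · rw [Finset.mul_sum]
        refine Finset.sum_congr rfl fun a _ => ?_
        split_ifs <;> ring
  · right
    have h1 := h.resolve_right h2
    refine ⟨fun a => (mem_Ioo_iff _).1 (h1 a a.2), fun t => ?_, sum_support_toReal PS⟩
    by_contra hcon
    rw [not_or] at hcon
    -- A free parity letter would add positive mass to the `1` contributed by the states, which is
    -- the case with slack.
    refine h2 ?_
    have hone : PS.toOuterMeasure {a | pe a ∈ Set.Ioo (0 : I) 1} = 1 :=
      (PMF.toOuterMeasure_apply_eq_one_iff _ _).2 fun a ha => h1 a ha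
    rw [hone]
    refine ENNReal.lt_add_right ENNReal.one_ne_top (mul_ne_zero (by simpa using hR) ?_)
    rw [Ne, PMF.toOuterMeasure_apply_eq_zero_iff, Set.not_disjoint_iff]
    exact ⟨t, t.2, (mem_Ioo_iff _).2 hcon⟩

end


theorem bitProb_ne_zero_of_decNondegenerate {PS : PMF S} {PY : S → ZMod 2 → PMF Y} {pe : S → I}
    {pd : Y → I} (h : DecNondegenerate PS PY pe pd) (a : PS.support) (b : ZMod 2)
    (hb : bitProb (pe a) b ≠ 0) (y : Y) (hy : y ∈ (PY a b).support) : bitProb (pd y) b ≠ 0 := by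
  rw [Ne, ← crossEntropy_bit_eq_top_iff] at hb ⊢
  exact h a a.2 b hb y hy

theorem sum_support_mul {α : Type*} [Fintype α] (P : PMF α) [Fintype P.support] (g : α → ℝ) :
    ∑ a : P.support, (P a).toReal * g a = ∑ a, (P a).toReal * g a := by
  classical
  rw [← Finset.sum_subtype (Finset.univ.filter (· ∈ P.support)) (by simp)
    fun a => (P a).toReal * g a]
  refine Finset.sum_filter_of_ne fun a _ ha => (PMF.mem_support_iff _ _).2 fun h => ha ?_
  rw [h, ENNReal.toReal_zero, zero_mul]

/-! ### The decoder inequality -/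

section

variable [Fintype Y] {R : ℝ} {PS : PMF S} {PY : S → ZMod 2 → PMF Y} {pd : Y → I} {PQ : PMF I}
  [Fintype PS.support] [Fintype PQ.support] {W : S → PMF (ZMod 2)} {U : I → PMF (ZMod 2)}

theorem toReal_decCost (hR : R < 1)
    (h : expect (lawXY PS W PY) (fun z => crossEntropy (bit z.1) (pd z.2)) +
      ENNReal.ofReal (1 - R) * expCrossEntropy PQ U id ≠ ⊤) :
    (expect (lawXY PS W PY) (fun z => crossEntropy (bit z.1) (pd z.2)) +
      ENNReal.ofReal (1 - R) * expCrossEntropy PQ U id).toReal =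
      linCost (natCost (decBias PQ pd)) (decMass R PS PY PQ W) (decParam PS PY PQ W U) /
        Real.log 2 := by
  have hR' : ENNReal.ofReal (1 - R) ≠ 0 := by simpa using hR
  obtain ⟨h1, h2⟩ := ENNReal.add_ne_top.1 h
  have h3 : expCrossEntropy PQ U id ≠ ⊤ := fun h' => h2 (by rw [h', ENNReal.mul_top hR'])
  have hsplit : ∀ y, decMass R PS PY PQ W (Sum.inl y) *
      (1 - decParam PS PY PQ W U (Sum.inl y)) = (lawXY PS W PY (0, y)).toReal := by
    intro y
    rw [mul_sub, mul_one, decMass_mul_decParam, decMass, Sum.elim_inl, lawY_toReal]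
    ring
  rw [ENNReal.toReal_add h1 h2, ENNReal.toReal_mul, toReal_expect_univ_of_ne_top _ h1,
    toReal_expCrossEntropy h3, ENNReal.toReal_ofReal (by linarith), linCost,
    Fintype.sum_sum_type, Fintype.sum_prod_type, sum_zmod_two, ← Finset.sum_add_distrib,
    mul_div_assoc', add_div, Finset.sum_div]
  congr 1
  · refine Finset.sum_congr rfl fun y _ => ?_
    rw [mul_add, ← mul_assoc, ← mul_assoc, decMass_mul_decParam, hsplit, toReal_crossEntropy_bit,
      toReal_crossEntropy_bit]
    simp only [natCost, decBias, Sum.elim_inl]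
    ring
  · simp only [decMass, decParam, natCost, decBias, Sum.elim_inr, Finset.mul_sum, mul_assoc, id]

/-- Outputs may have probability zero, so compatibility is required only at letters of positive
mass; the comparison with the zero codeword uses this weaker form. -/
theorem linCost_decParam_lt (hR : R < 1) (h : DecoderInequality R PS PY pd PQ W U)
    {w : Y ⊕ PQ.support → ℝ} (hw : ∀ t, w t ∈ Set.Icc (0 : ℝ) 1)
    (hcomp : ∀ t, 0 < decMass R PS PY PQ W t →
      (decBias PQ pd t = 0 → w t = 0) ∧ (decBias PQ pd t = 1 → w t = 1))
    (hent : (1 - R) * Real.log 2 ≤ ent (decMass R PS PY PQ W) w) :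
    linCost (natCost (decBias PQ pd)) (decMass R PS PY PQ W) (decParam PS PY PQ W U) <
      linCost (natCost (decBias PQ pd)) (decMass R PS PY PQ W) w := by
  classical
  have hlog : 0 < Real.log 2 := Real.log_pos one_lt_two
  set P := (lawXY PS W PY).map Prod.snd with hP
  have hfin : Fintype P.support := Fintype.ofFinite _
  set W' : Y → PMF (ZMod 2) := fun y => bernPMF (w (Sum.inl y)) with hW'
  set U' := condBern PQ (w ∘ Sum.inr) with hU'
  have hW1 : ∀ y, (W' y 1).toReal = w (Sum.inl y) := fun y => bernPMF_one_toReal (hw _)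
  have hU1 : ∀ t : PQ.support, (U' t 1).toReal = w (Sum.inr t) :=
    fun t => condBern_one_toReal t (hw _)
  obtain ⟨h1, h1'⟩ := toReal_condEntropy P W'
  obtain ⟨h2, h2'⟩ := toReal_condEntropy PQ U'
  have h3 : ENNReal.ofReal (1 - R) * condEntropy PQ U' ≠ ⊤ :=
    ENNReal.mul_ne_top ENNReal.ofReal_ne_top h2
  have hfeas : ENNReal.ofReal (1 - R) ≤
      condEntropy P W' + ENNReal.ofReal (1 - R) * condEntropy PQ U' := by
    rw [← ENNReal.toReal_le_toReal ENNReal.ofReal_ne_top (ENNReal.add_ne_top.2 ⟨h1, h3⟩),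
      ENNReal.toReal_add h1 h3, ENNReal.toReal_mul, h1', h2',
      ENNReal.toReal_ofReal (by linarith), mul_div_assoc', ← add_div, le_div_iff₀ hlog,
      sum_support_mul P fun y => Real.binEntropy (W' y 1).toReal]
    refine hent.trans_eq ?_
    rw [ent, Fintype.sum_sum_type]
    simp only [decMass, Sum.elim_inl, Sum.elim_inr, Finset.mul_sum, mul_assoc, hW1, hU1, hP]
  have h4 : expCrossEntropy P W' pd ≠ ⊤ := by
    refine expCrossEntropy_ne_top_iff.2 fun y => ?_
    rw [hW1]
    exact hcomp (Sum.inl y)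
      (ENNReal.toReal_pos ((PMF.mem_support_iff _ _).1 y.2) (P.apply_ne_top _))
  have h5 : expCrossEntropy PQ U' id ≠ ⊤ := by
    refine expCrossEntropy_ne_top_iff.2 fun t => ?_
    rw [hU1]
    exact hcomp (Sum.inr t) (mul_pos (by linarith)
      (ENNReal.toReal_pos ((PMF.mem_support_iff _ _).1 t.2) (PQ.apply_ne_top _)))
  have h6 : ENNReal.ofReal (1 - R) * expCrossEntropy PQ U' id ≠ ⊤ :=
    ENNReal.mul_ne_top ENNReal.ofReal_ne_top h5
  have hlt := h W' U' hfeas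
  have hltt := hlt.ne_top
  have h7 := ENNReal.add_ne_top.2 ⟨h4, h6⟩
  rw [← ENNReal.toReal_lt_toReal hltt h7, toReal_decCost hR hltt,
    ENNReal.toReal_add h4 h6, ENNReal.toReal_mul, toReal_expCrossEntropy h4,
    toReal_expCrossEntropy h5, ENNReal.toReal_ofReal (by linarith), mul_div_assoc', ← add_div,
    div_lt_div_iff_of_pos_right hlog,
    sum_support_mul P fun y => (W' y 1).toReal * -Real.log (bitProb (pd y) 1) +
        (1 - (W' y 1).toReal) * -Real.log (bitProb (pd y) 0)] at hlt
  refine hlt.trans_eq ?_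
  rw [linCost, Fintype.sum_sum_type]
  simp only [decMass, natCost, decBias, Sum.elim_inl, Sum.elim_inr, Finset.mul_sum, mul_assoc,
    hW1, hU1, hP, id]

/-- The choice `X̃ = 0` with uniform `Ṽ` has entropy exactly `(1 - R) log 2`, so the decoder
inequality applies to it. By symmetry `-log Q` and `-log (1 - Q)` have the same mean, so uniform `Ṽ`
costs as much as `Ṽ = 0`. Symmetry also excludes the parity bias `0` once `1` is excluded, which
keeps this cost finite. -/
theorem linCost_decParam_lt_zero (hR : R < 1) (hsymm : PQ.map unitInterval.symm = PQ)
    (h : DecoderInequality R PS PY pd PQ W U)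
    (hbias : ∀ t, 0 < decMass R PS PY PQ W t → decBias PQ pd t ≠ 1) :
    linCost (natCost (decBias PQ pd)) (decMass R PS PY PQ W) (decParam PS PY PQ W U) <
      linCost (natCost (decBias PQ pd)) (decMass R PS PY PQ W) 0 := by
  classical
  have hσ : ∀ t, PQ (σ t) = PQ t := by
    intro t
    conv_lhs => rw [← hsymm]
    rw [PMF.map_apply, tsum_eq_single t]
    · simp
    · intro t' ht'
      rw [if_neg]
      exact fun h => ht' (unitInterval.symm_bijective.1 h.symm)
  have hmem : ∀ t, σ t ∈ PQ.support ↔ t ∈ PQ.support := by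
    intro t
    rw [PMF.mem_support_iff, PMF.mem_support_iff, hσ]
  have hpos : ∀ t : PQ.support, 0 < decMass R PS PY PQ W (Sum.inr t) := fun t =>
    mul_pos (by linarith)
      (ENNReal.toReal_pos ((PMF.mem_support_iff _ _).1 t.2) (PQ.apply_ne_top _))
  have hne1 : ∀ t : PQ.support, (t : I) ≠ 1 := fun t => hbias (Sum.inr t) (hpos t)
  have hne0 : ∀ t : PQ.support, (t : I) ≠ 0 := by
    intro t ht
    refine hne1 ⟨σ t, (hmem t).2 t.2⟩ ?_
    simp [ht]
  let e : PQ.support ≃ PQ.support :=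
    { toFun := fun t => ⟨σ t, (hmem t).2 t.2⟩
      invFun := fun t => ⟨σ t, (hmem t).2 t.2⟩
      left_inv := fun t => Subtype.ext (unitInterval.symm_symm _)
      right_inv := fun t => Subtype.ext (unitInterval.symm_symm _) }
  refine (linCost_decParam_lt (w := Sum.elim 0 fun _ => 2⁻¹) hR h ?_ ?_ ?_).trans_eq ?_
  · rintro (y | t)
    · simp
    · simp only [Sum.elim_inr]; norm_num
  · rintro (y | t) ht
    · exact ⟨fun _ => rfl, fun h1 => absurd h1 (hbias _ ht)⟩
    · exact ⟨fun h0 => absurd h0 (hne0 t), fun h1 => absurd h1 (hne1 t)⟩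
  · rw [ent, Fintype.sum_sum_type]
    simp only [Sum.elim_inl, Sum.elim_inr, Pi.zero_apply, Real.binEntropy_zero, mul_zero,
      Finset.sum_const_zero, zero_add, Real.binEntropy_two_inv, decMass]
    rw [← Finset.sum_mul, ← Finset.mul_sum, sum_support_toReal, mul_one]
  · rw [linCost, linCost, Fintype.sum_sum_type, Fintype.sum_sum_type]
    congr 1
    simp only [Sum.elim_inr, Pi.zero_apply, zero_mul, zero_add, sub_zero, one_mul, natCost, decMass,
      decBias, bitProb_one, bitProb_zero]
    have hswap : ∑ t : PQ.support, (1 - R) * (PQ t).toReal * -Real.log ((t : I) : ℝ) =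
        ∑ t : PQ.support, (1 - R) * (PQ t).toReal * -Real.log (1 - ((t : I) : ℝ)) := by
      refine Fintype.sum_equiv e _ _ fun t => ?_
      simp [e, hσ]
    have hhalf : ∀ t : PQ.support, (1 - R) * (PQ t).toReal *
        (2⁻¹ * -Real.log ((t : I) : ℝ) + (1 - 2⁻¹) * -Real.log (1 - ((t : I) : ℝ))) =
        2⁻¹ * ((1 - R) * (PQ t).toReal * -Real.log ((t : I) : ℝ)) +
        2⁻¹ * ((1 - R) * (PQ t).toReal * -Real.log (1 - ((t : I) : ℝ))) := fun t => by ring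
    simp only [hhalf]
    rw [Finset.sum_add_distrib, ← Finset.mul_sum, ← Finset.mul_sum, hswap]
    ring

end

end

section

/-! ### Averaging over the message, the states and the parity biases -/

variable {S Y : Type*}

theorem mem_support_of_mem_support_prodPMF {α : Type*} {n : ℕ} {P : Fin n → PMF α}
    {a : Fin n → α} (h : a ∈ (prodPMF P).support) (i : Fin n) : a i ∈ (P i).support := by
  rw [PMF.mem_support_iff, prodPMF_apply] at h
  exact (PMF.mem_support_iff _ _).2 (Finset.prod_ne_zero_iff.1 h i (Finset.mem_univ _))

/-- Independent letters with law `P` have empirical frequencies close to `P`. -/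
theorem iid_deviation_le {α : Type*} [DecidableEq α] (P : PMF α) [Fintype P.support] (n : ℕ) {c : ℝ}
    (hc : 0 < c) :
    (prodPMF fun _ : Fin n => P).toOuterMeasure {a | ∃ t : P.support,
      c ≤ |((Finset.univ.filter fun i => a i = t).card : ℝ) - n * (P t).toReal|} ≤
      ENNReal.ofReal (Fintype.card P.support * (n / c ^ 2)) := by
  have hset : {a : Fin n → α | ∃ t : P.support,
      c ≤ |((Finset.univ.filter fun i => a i = t).card : ℝ) - n * (P t).toReal|} =
      ⋃ t : P.support, {a : Fin n → α |
        c ≤ |((Finset.univ.filter fun i => a i = (t : α)).card : ℝ) -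
          ∑ _i : Fin n, (P.toOuterMeasure {b | b = (t : α)}).toReal|} := by
    ext a
    simp [Set.ofPred_eq_eq_singleton, PMF.toOuterMeasure_apply_singleton]
  rw [hset]
  refine (MeasureTheory.measure_iUnion_le _).trans ?_
  rw [tsum_fintype]
  refine (Finset.sum_le_sum fun (t : P.support) _ =>
    prodPMF_deviation_le (fun _ => P) (fun _ b => b = (t : α)) hc).trans ?_
  rw [Finset.sum_const, nsmul_eq_mul, ENNReal.ofReal_mul (Nat.cast_nonneg _),
    ENNReal.ofReal_natCast, Finset.card_univ]

theorem uniform_zero_toOuterMeasure (k : ℕ) :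
    (PMF.uniformOfFintype (Fin k → ZMod 2)).toOuterMeasure {0} = ENNReal.ofReal (2⁻¹ ^ k) := by
  rw [PMF.toOuterMeasure_apply_singleton, PMF.uniformOfFintype_apply, ENNReal.ofReal_pow (by simp),
    Fintype.card_fun, ZMod.card, Fintype.card_fin, ENNReal.ofReal_inv_of_pos two_pos]
  simp [ENNReal.inv_pow]

open Classical in
/-- A bound for the law of a run from a bound given typical states and parity biases. -/
theorem runLaw_toOuterMeasure_le {R : ℝ} (τ : TieBreak) {PS : PMF S} {PY : S → ZMod 2 → PMF Y}
    {pe : S → I} {PQ : PMF I} [Fintype PS.support] [Fintype PQ.support] {k r : ℕ}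
    (hn : 0 < k + r) {E : Set (Run S Y k r)} {δ η : ℝ} (hδ : 0 < δ)
    (hr : |(r : ℝ) / (k + r : ℕ) - (1 - R)| ≤ δ / 2)
    (h : ∀ (s : Fin (k + r) → PS.support) (q : Fin r → PQ.support),
      (∀ t, |(letterCount (Sum.map s q) t : ℝ) / (k + r : ℕ) - encMass R PS PQ t| ≤ δ) →
      ∀ m : Fin k → ZMod 2, m ≠ 0 →
      ((PMF.uniformOfFintype (GL (Fin (k + r)) (ZMod 2))).bind fun H =>
        (prodPMF fun i => PY (s i)
          (encode τ pe H (fun j => (q j : I)) m (fun i => (s i : S)) i)).map fun y =>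
        ({ message := m, state := fun i => s i, parityBias := fun j => q j, matrix := H,
           codeword := encode τ pe H (fun j => (q j : I)) m (fun i => (s i : S)),
           output := y } : Run S Y k r)).toOuterMeasure E ≤ ENNReal.ofReal η) :
    (runLaw τ PS PY pe PQ k r).toOuterMeasure E ≤ ENNReal.ofReal (2⁻¹ ^ k) +
      (ENNReal.ofReal
          (Fintype.card PS.support * ((k + r : ℕ) / (δ / 2 * (k + r : ℕ)) ^ 2)) +
        (ENNReal.ofReal (Fintype.card PQ.support * (r / (δ / 2 * (k + r : ℕ)) ^ 2)) +
          ENNReal.ofReal η)) := by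
  have hN : (0 : ℝ) < (k + r : ℕ) := by exact_mod_cast hn
  have hc : 0 < δ / 2 * (k + r : ℕ) := by positivity
  rw [← uniform_zero_toOuterMeasure]
  -- The message `0`, of probability `2^(-k)`, is given up because the bounds on linked vectors need
  -- `m ≠ 0`.
  refine toOuterMeasure_bind_le _ _ _ _ _ fun m _ hm => ?_
  refine (toOuterMeasure_bind_le _ _ _ _ _ fun s hs hs' => ?_).trans
    (add_le_add_left (iid_deviation_le PS (k + r) hc) _)
  refine (toOuterMeasure_bind_le _ _ _ _ _ fun q hq hq' => ?_).trans
    (add_le_add_left (iid_deviation_le PQ r hc) _)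
  have hs1 := mem_support_of_mem_support_prodPMF hs
  have hq1 := mem_support_of_mem_support_prodPMF hq
  refine h (fun i => ⟨s i, hs1 i⟩) (fun j => ⟨q j, hq1 j⟩) ?_ m hm
  simp only [Set.mem_ofPred_eq, not_exists, not_le] at hs' hq'
  rintro (a | t)
  · have h1 := hs' a
    have hcount : (Finset.univ.filter fun i => (⟨s i, hs1 i⟩ : PS.support) = a).card =
        (Finset.univ.filter fun i => s i = a).card := by
      congr 1
      ext i
      simp [Subtype.ext_iff]
    rw [letterCount_map_inl, hcount, encMass, Sum.elim_inl, div_sub' hN.ne', abs_div,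
      abs_of_pos hN, div_le_iff₀ hN]
    nlinarith
  · have h1 := hq' t
    have h2 := pmf_toReal_mem_Icc PQ t
    have hcount : (Finset.univ.filter fun j => (⟨q j, hq1 j⟩ : PQ.support) = t).card =
        (Finset.univ.filter fun j => q j = t).card := by
      congr 1
      ext j
      simp [Subtype.ext_iff]
    rw [letterCount_map_inr, hcount, encMass, Sum.elim_inr]
    -- There are `r` parity letters but frequencies are relative to `k + r`; half of `δ` pays for
    -- the fluctuation and half for replacing `r / (k + r)` by `1 - R`.
    have h3 : |((Finset.univ.filter fun j => q j = t).card : ℝ) / (k + r : ℕ) -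
        (r : ℝ) / (k + r : ℕ) * (PQ t).toReal| ≤ δ / 2 := by
      rw [div_mul_eq_mul_div, ← sub_div, abs_div, abs_of_pos hN, div_le_iff₀ hN]
      exact h1.le
    rw [abs_le] at h3 hr ⊢
    constructor <;> nlinarith [h2.1, h2.2]

/-! ### Limits along `k = ⌊n R⌋` -/

theorem floor_mul_le {R : ℝ} (hR1 : R ≤ 1) (n : ℕ) : ⌊(n : ℝ) * R⌋₊ ≤ n :=
  Nat.floor_le_of_le (mul_le_of_le_one_right (Nat.cast_nonneg n) hR1)

theorem tendsto_floor_div {R : ℝ} (hR0 : 0 < R) (hR1 : R < 1) :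
    Filter.Tendsto (fun n : ℕ => ((n - ⌊(n : ℝ) * R⌋₊ : ℕ) : ℝ) / n) Filter.atTop (𝓝 (1 - R)) := by
  have h := (tendsto_nat_floor_mul_div_atTop hR0.le).comp
    (tendsto_natCast_atTop_atTop (R := ℝ))
  refine (h.const_sub 1).congr' ?_
  filter_upwards [Filter.eventually_gt_atTop 0] with n hn
  have hn' : (0 : ℝ) < n := by exact_mod_cast hn
  rw [Nat.cast_sub (floor_mul_le hR1.le n), Function.comp_apply, mul_comm R, sub_div,
    div_self hn'.ne']

theorem tendsto_nat_div_sq (K c : ℝ) :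
    Filter.Tendsto (fun n : ℕ => K * ((n : ℝ) / (c * n) ^ 2)) Filter.atTop (𝓝 0) := by
  have h : Filter.Tendsto (fun n : ℕ => K / c ^ 2 * ((n : ℝ))⁻¹) Filter.atTop (𝓝 0) := by
    simpa using tendsto_inv_atTop_nhds_zero_nat (𝕜 := ℝ).const_mul (K / c ^ 2)
  refine h.congr' ?_
  filter_upwards [Filter.eventually_gt_atTop 0] with n hn
  have hn' : (n : ℝ) ≠ 0 := by exact_mod_cast hn.ne'
  rw [mul_pow, div_mul_eq_div_div_swap]
  field_simp

open Classical in
/-- If the events `E k r` are unlikely given typical states, typical parity biases and a nonzero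
message, then they are unlikely. -/
theorem tendsto_runLaw_zero {R : ℝ} (hR0 : 0 < R) (hR1 : R < 1) (τ : TieBreak) {PS : PMF S}
    {PY : S → ZMod 2 → PMF Y} {pe : S → I} {PQ : PMF I} [Fintype PS.support]
    [Fintype PQ.support] (E : ∀ k r, Set (Run S Y k r))
    (h : ∀ η : ℝ, 0 < η → ∃ δ > 0, ∃ N₀ : ℕ, ∀ (k r : ℕ) (s : Fin (k + r) → PS.support)
      (q : Fin r → PQ.support), N₀ ≤ k + r → |(r : ℝ) / (k + r : ℕ) - (1 - R)| ≤ δ →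
      (∀ t, |(letterCount (Sum.map s q) t : ℝ) / (k + r : ℕ) - encMass R PS PQ t| ≤ δ) →
      ∀ m : Fin k → ZMod 2, m ≠ 0 →
      ((PMF.uniformOfFintype (GL (Fin (k + r)) (ZMod 2))).bind fun H =>
        (prodPMF fun i => PY (s i)
          (encode τ pe H (fun j => (q j : I)) m (fun i => (s i : S)) i)).map fun y =>
        ({ message := m, state := fun i => s i, parityBias := fun j => q j, matrix := H,
           codeword := encode τ pe H (fun j => (q j : I)) m (fun i => (s i : S)),
           output := y } : Run S Y k r)).toOuterMeasure (E k r) ≤ ENNReal.ofReal η) :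
    Filter.Tendsto (fun n : ℕ => (runLaw τ PS PY pe PQ ⌊(n : ℝ) * R⌋₊
      (n - ⌊(n : ℝ) * R⌋₊)).toOuterMeasure (E ⌊(n : ℝ) * R⌋₊ (n - ⌊(n : ℝ) * R⌋₊)))
      Filter.atTop (𝓝 0) := by
  rw [ENNReal.tendsto_nhds_zero]
  intro ε hε
  obtain ⟨η, hη, hηε⟩ : ∃ η : ℝ, 0 < η ∧ ENNReal.ofReal (4 * η) ≤ ε := by
    by_cases htop : ε = ⊤
    · exact ⟨1, one_pos, htop ▸ le_top⟩
    · refine ⟨ε.toReal / 4, div_pos (ENNReal.toReal_pos hε.ne' htop) (by norm_num), ?_⟩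
      rw [mul_div_cancel₀ _ (by norm_num), ENNReal.ofReal_toReal htop]
  obtain ⟨δ, hδ, N₀, hbound⟩ := h η hη
  have hfloor : Filter.Tendsto (fun n : ℕ => ⌊(n : ℝ) * R⌋₊) Filter.atTop Filter.atTop :=
    tendsto_nat_floor_atTop.comp
      (tendsto_natCast_atTop_atTop.atTop_mul_const hR0)
  have hpow : Filter.Tendsto (fun n : ℕ => (2⁻¹ : ℝ) ^ ⌊(n : ℝ) * R⌋₊) Filter.atTop (𝓝 0) :=
    (tendsto_pow_atTop_nhds_zero_of_lt_one (by norm_num) (by norm_num)).comp hfloor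
  filter_upwards [hpow.eventually_le_const hη,
    (tendsto_nat_div_sq (Fintype.card PS.support) (δ / 2)).eventually_le_const hη,
    (tendsto_nat_div_sq (Fintype.card PQ.support) (δ / 2)).eventually_le_const hη,
    (tendsto_floor_div hR0 hR1).eventually (Metric.closedBall_mem_nhds _ (half_pos hδ)),
    Filter.eventually_gt_atTop 0, Filter.eventually_ge_atTop N₀] with n h1 h2 h3 h4 h5 h6
  have hkr : ⌊(n : ℝ) * R⌋₊ + (n - ⌊(n : ℝ) * R⌋₊) = n :=
    Nat.add_sub_cancel' (floor_mul_le hR1.le n)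
  have hrn : n - ⌊(n : ℝ) * R⌋₊ ≤ n := Nat.sub_le _ _
  generalize ⌊(n : ℝ) * R⌋₊ = k at *
  generalize n - k = r at *
  subst hkr
  rw [Real.dist_eq] at h4
  refine (runLaw_toOuterMeasure_le τ h5 hδ h4
    (fun s q => hbound k r s q h6 (h4.trans (by linarith)))).trans ?_
  refine le_trans ?_ hηε
  rw [← ENNReal.ofReal_add (by positivity) hη.le,
    ← ENNReal.ofReal_add (by positivity) (by positivity),
    ← ENNReal.ofReal_add (by positivity) (by positivity)]
  refine ENNReal.ofReal_le_ofReal ?_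
  have h7 : (Fintype.card PQ.support : ℝ) * (r / (δ / 2 * (k + r : ℕ)) ^ 2) ≤
      Fintype.card PQ.support * ((k + r : ℕ) / (δ / 2 * (k + r : ℕ)) ^ 2) := by
    gcongr
  linarith

end

end

end WPC


theorem mainTheorem1 {S Y : Type*} [Finite S] [Finite Y]
    (R : ℝ) (hR0 : 0 < R) (hR1 : R < 1)
    (PS : PMF S) (PY : S → ZMod 2 → PMF Y)
    (pe : S → unitInterval) (pd : Y → unitInterval)
    (PQ : PMF unitInterval) (hQfin : PQ.support.Finite)
    (hQsymm : PQ.map unitInterval.symm = PQ)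
    (hpe : WPC.EncNondegenerate R PS pe PQ) (hpd : WPC.DecNondegenerate PS PY pe pd)
    (W : S → PMF (ZMod 2)) (U : unitInterval → PMF (ZMod 2))
    (hmin : WPC.IsUniqueMinimizer R PS pe PQ W U)
    (hdec : WPC.DecoderInequality R PS PY pd PQ W U)
    (τ : WPC.TieBreak) :
    Filter.Tendsto
        (fun n : ℕ => WPC.errorProb τ PS PY pe pd PQ ⌊(n : ℝ) * R⌋₊ (n - ⌊(n : ℝ) * R⌋₊))
        Filter.atTop (𝓝 0) ∧
      ∀ ε : ℝ, 0 < ε →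
        Filter.Tendsto
          (fun n : ℕ => WPC.deviationProb τ PS PY pe PQ W ε ⌊(n : ℝ) * R⌋₊ (n - ⌊(n : ℝ) * R⌋₊))
          Filter.atTop (𝓝 0) := by
  have := Fintype.ofFinite PS.support
  have := hQfin.fintype
  obtain ⟨hw₀, hfeas, huniq⟩ := WPC.letters_of_isUniqueMinimizer hR1 hmin
  -- Decoding errors and deviations are bounded together, as one bad event; each claim then follows
  -- by monotonicity, with an arbitrary `ε` for the error.
  have key : ∀ ε : ℝ, 0 < ε → Filter.Tendsto (fun n : ℕ =>
      (WPC.runLaw τ PS PY pe PQ ⌊(n : ℝ) * R⌋₊ (n - ⌊(n : ℝ) * R⌋₊)).toOuterMeasure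
        ({ω | WPC.decode τ pd ω.matrix ω.parityBias ω.output ≠ ω.message} ∪
          {ω | ∃ (a : S) (b : ZMod 2),
            ε ≤ |WPC.empirical ω.state ω.codeword a b - (PS a * W a b).toReal|}))
      Filter.atTop (𝓝 0) := fun ε hε =>
    WPC.tendsto_runLaw_zero hR0 hR1 τ
      (fun k r => {ω | WPC.decode τ pd ω.matrix ω.parityBias ω.output ≠ ω.message} ∪
        {ω | ∃ (a : S) (b : ZMod 2),
          ε ≤ |WPC.empirical ω.state ω.codeword a b - (PS a * W a b).toReal|})
      fun η hη => WPC.exists_run_bound hR1 hw₀ hfeas huniq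
        (WPC.letters_of_encNondegenerate hR1 hpe)
        (WPC.bitProb_ne_zero_of_decNondegenerate hpd)
        (fun w hw => WPC.linCost_decParam_lt hR1 hdec (fun t => (hw t).1) fun t _ => (hw t).2)
        (WPC.linCost_decParam_lt_zero hR1 hQsymm hdec) τ hε hη
  refine ⟨?_, fun ε hε => ?_⟩
  · exact tendsto_of_tendsto_of_tendsto_of_le_of_le tendsto_const_nhds (key 1 one_pos)
      (fun _ => zero_le) fun n => MeasureTheory.measure_mono Set.subset_union_left
  · exact tendsto_of_tendsto_of_tendsto_of_le_of_le tendsto_const_nhds (key ε hε)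
      (fun _ => zero_le) fun n => MeasureTheory.measure_mono Set.subset_union_right
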